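/- **Setting.** Let $K$ be an ordered field and $n,k\ge 1$. All structure groups carry the discrete topology, so all bundles are flat. Put $GL_+(n,K)=\{g\in GL(n,K):\det g>0\}$, $K_+=\{\lambda\in K:\lambda>0\}$, $P_+GL_+(n,K)=GL_+(n,K)/\{\lambda I:\lambda\in K_+\}$ and $\mathbf P_+^{n-1}(K)=(K^n\setminus\{0\})/K_+$. Let $X_{n,+}$ be the simplicial complex with vertex set $\mathbf P^{n-1}_+(K)$ in which finitely many rays span a simplex iff any at most $n$ of them are linearly independent; $G=P_+GL_+(n,K)$ acts on it. Let $C_*$ denote its complex of alternating simplicial chains, let $B_n\subset C_n$ be the group of boundaries, and let $U_{n,+}=(C_n/B_n)_G$ (coinvariants). The quotient map $C_n\to U_{n,+}$ is a $G$-invariant cocycle $T_+$; since $C_*$ is acyclic, pulling $T_+$ back along any augmentation-preserving $G$-chain map from the homogeneous bar resolution of $G$ to $C_*$ gives a well-defined (tautological) class $eu_+\in H^n(G,U_{n,+})$. There is a well-defined homomorphism $T_0\colon U_{n,+}\to\mathbb Z$ with $$T_0([v_1],\dots,[v_{n+1}])=\begin{cases}\operatorname{sgn}\det(v_1,\dots,v_n)&\text{if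 }v_{n+1}=\sum_{i=1}^n\alpha_iv_i\text{ with all }\alpha_i<0,\\0&\text{otherwise},\end{cases}$$ and $eu_0\in H^n(P_+GL_+(n,K),\mathbb Z)$ is the image of $eu_+$ under $T_0$. For a $GL_+(n,K)$-bundle $E$ over a simplicial complex $X$, let $eu_0(E)\in H^n(X,\mathbb Z)$ be the pull-back of $eu_0$ by a classifying map $X\to BP_+GL_+(n,K)$ of the associated $P_+GL_+(n,K)$-bundle. Let $X,X'$ be simplicial complexes, with chosen total orders on their vertex sets. Triangulate $X\times X'$ in the standard way: the vertices are pairs of vertices, and a finite non-empty set of pairs spans a simplex iff it is a chain for the product order and projects to simplices of $X$ and of $X'$. For $\sigma=(x_0<\dots<x_n)$ in $X$ and $\sigma'=(x'_0<\dots<x'_k)$ in $X'$ put $\sigma\times\sigma'=\sum_\gamma(-1)^{\operatorname{area}(\gamma)}\sigma_\gamma$, where $\gamma$ runs over the lattice paths from $(0,0)$ to $(n,k)$ with unit steps to the right or up, $\operatorname{area}(\gamma)$ is the area under $\gamma$, and $\sigma_\gamma$ is the $(n+k)$-simplex with vertices $(x_i,x'_j)$, $(i,j)\in\gamma$, in increasing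 order. Extend this bilinearly to chains $z\times z'$. **Theorem 11.1.** Let $E$ be a $GL_+(n,K)$-bundle over $X$ and $E'$ a $GL_+(k,K)$-bundle over $X'$, and let $E\times E'$ be the product bundle over $X\times X'$, regarded as a $GL_+(n+k,K)$-bundle via block diagonal matrices. For any simplicial cycles $z\in Z_n(X,\mathbb Z)$ and $z'\in Z_k(X',\mathbb Z)$, the chain $z\times z'$ is a cycle and $$\langle eu_0(E),z\rangle\cdot\langle eu_0(E'),z'\rangle=\langle eu_0(E\times E'),z\times z'\rangle .$$ -/

import Mathlib

open scoped Matrix MatrixGroups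

set_option linter.unusedSectionVars false

namespace TautEuler

universe u v w

noncomputable section

/-! ### Δ-sets, their chains, their cohomology, and the Kronecker pairing -/

/-- A Δ-set (semisimplicial set): the combinatorial form of a Δ-complex.
`face i σ` is the face of `σ` opposite to its `i`-th vertex. -/
structure DeltaSet where
  simplex : ℕ → Type u
  face : ∀ {m : ℕ}, Fin (m + 2) → simplex (m + 1) → simplex m
  face_face : ∀ {m : ℕ} (i j : Fin (m + 2)) (σ : simplex (m + 2)), i ≤ j →
    face i (face j.succ σ) = face j (face i.castSucc σ)

lemma succAbove_comm {m : ℕ} {i j : Fin (m + 2)} (h : i ≤ j) (l : Fin (m + 1)) :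
    j.succ.succAbove (i.succAbove l) = i.castSucc.succAbove (j.succAbove l) := by
  ext
  simp only [Fin.succAbove, Fin.lt_def, Fin.val_castSucc, apply_ite Fin.val, Fin.val_succ]
  simp only [Fin.le_def] at h
  split_ifs <;> lia

/-- Cancellation in pairs in an iterated alternating sum over faces. -/
lemma alternating_sum_sum {A : Type*} [AddCommGroup A] {m : ℕ}
    (F : Fin (m + 3) → Fin (m + 2) → A)
    (hF : ∀ i j : Fin (m + 2), i ≤ j → F j.succ i = F i.castSucc j) :
    ∑ a : Fin (m + 3), (-1 : ℤ) ^ (a : ℕ) • ∑ b : Fin (m + 2), (-1 : ℤ) ^ (b : ℕ) • F a b = 0 := by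
  simp only [Finset.smul_sum, smul_smul, ← pow_add]
  rw [← Finset.sum_product']
  let S : Finset (Fin (m + 3) × Fin (m + 2)) :=
    Finset.univ.filter fun p => (p.1 : ℕ) ≤ (p.2 : ℕ)
  rw [Finset.univ_product_univ, ← Finset.sum_add_sum_compl S, ← eq_neg_iff_add_eq_zero,
    ← Finset.sum_neg_distrib]
  refine Finset.sum_bij'
    (i := fun p hp => (p.2.succ, p.1.castLT (lt_of_le_of_lt (Finset.mem_filter.mp hp).2 p.2.2)))
    (j := fun p hp => (p.2.castSucc, p.1.pred (by
      rintro h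
      simp only [S, Finset.compl_filter, Finset.mem_filter_univ, not_le, h] at hp
      simp at hp))) ?_ ?_ ?_ ?_ ?_
  · rintro ⟨a, b⟩ hp
    simp only [S, Finset.compl_filter, Finset.mem_filter_univ, Fin.val_succ, Fin.val_castLT] at hp ⊢
    lia
  · rintro ⟨a, b⟩ hp
    simp only [S, Finset.compl_filter, Finset.mem_filter_univ, Fin.val_castSucc,
      Fin.val_pred] at hp ⊢
    lia
  · rintro ⟨a, b⟩ hp; simp
  · rintro ⟨a, b⟩ hp; simp
  · rintro ⟨a, b⟩ hp
    have hp' : (a : ℕ) ≤ (b : ℕ) := (Finset.mem_filter.mp hp).2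
    dsimp only
    rw [hF (a.castLT (lt_of_le_of_lt hp' b.2)) b (by simpa [Fin.le_def] using hp')]
    simp only [Fin.castSucc_castLT, Fin.val_succ, Fin.val_castLT, ← neg_smul]
    congr 1
    ring

namespace DeltaSet

variable (S : DeltaSet.{u}) (T : DeltaSet.{v})

/-- Simplicial chains with integral coefficients. -/
abbrev Chain (m : ℕ) : Type u := S.simplex m →₀ ℤ

/-- The simplicial boundary operator. -/
def boundary (m : ℕ) : S.Chain (m + 1) →ₗ[ℤ] S.Chain m :=
  Finsupp.linearCombination ℤ fun σ =>
    ∑ i : Fin (m + 2), (-1 : ℤ) ^ (i : ℕ) • Finsupp.single (S.face i σ) (1 : ℤ)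

/-- The group `Z_m` of simplicial cycles. -/
def cycles : ∀ m : ℕ, Submodule ℤ (S.Chain m)
  | 0 => ⊤
  | m + 1 => LinearMap.ker (S.boundary m)

variable (A : Type w) [AddCommGroup A]

/-- Simplicial cochains with (constant) coefficients in `A`. -/
abbrev Cochain (m : ℕ) : Type (max u w) := S.simplex m → A

/-- The simplicial coboundary operator, `(δc)(σ) = ∑ᵢ (-1)ⁱ c(∂ᵢσ)`. -/
def coboundary (m : ℕ) : S.Cochain A m →ₗ[ℤ] S.Cochain A (m + 1) where
  toFun c σ := ∑ i : Fin (m + 2), (-1 : ℤ) ^ (i : ℕ) • c (S.face i σ)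
  map_add' c c' := by ext σ; simp [Finset.sum_add_distrib]
  map_smul' r c := by
    ext σ
    simp only [Pi.smul_apply, RingHom.id_apply, Finset.smul_sum]
    exact Finset.sum_congr rfl fun i _ => smul_comm _ _ _

lemma coboundary_coboundary (m : ℕ) (c : S.Cochain A m) :
    S.coboundary A (m + 1) (S.coboundary A m c) = 0 := by
  ext σ
  exact alternating_sum_sum (fun a b => c (S.face b (S.face a σ)))
    fun i j h => congrArg c (S.face_face i j σ h)

/-- Cocycles. -/
def cocycles (m : ℕ) : Submodule ℤ (S.Cochain A m) := LinearMap.ker (S.coboundary A m)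

/-- Coboundaries. -/
def coboundaries : ∀ m : ℕ, Submodule ℤ (S.Cochain A m)
  | 0 => ⊥
  | m + 1 => LinearMap.range (S.coboundary A m)

lemma coboundaries_le_cocycles (m : ℕ) : S.coboundaries A m ≤ S.cocycles A m := by
  cases m with
  | zero => exact bot_le
  | succ m =>
    rintro _ ⟨c, rfl⟩
    exact S.coboundary_coboundary A m c

/-- The cohomology group `Hᵐ(S; A)`: cocycles modulo coboundaries. -/
abbrev Cohomology (m : ℕ) : Type (max u w) :=
  S.cocycles A m ⧸ (S.coboundaries A m).submoduleOf (S.cocycles A m)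

/-- The cohomology class of a cocycle. -/
def cohomologyClass {m : ℕ} (c : S.Cochain A m) (hc : c ∈ S.cocycles A m) : S.Cohomology A m :=
  Submodule.Quotient.mk ⟨c, hc⟩

/-- Evaluation of cochains on a chain: `c(∑ n_σ σ) = ∑ n_σ c(σ)`. -/
def eval {m : ℕ} (z : S.Chain m) : S.Cochain A m →ₗ[ℤ] A where
  toFun c := z.sum fun σ r => r • c σ
  map_add' c c' := by simp [Finsupp.sum_add]
  map_smul' r c := by
    simp only [Pi.smul_apply, RingHom.id_apply, Finsupp.smul_sum]
    exact Finsupp.sum_congr fun i _ => smul_comm _ _ _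

lemma eval_coboundary {m : ℕ} (c : S.Cochain A m) (z : S.Chain (m + 1)) :
    S.eval A z (S.coboundary A m c) = S.eval A (S.boundary m z) c := by
  change Finsupp.linearCombination ℤ (S.coboundary A m c) z =
    Finsupp.linearCombination ℤ c (S.boundary m z)
  induction z using Finsupp.induction_linear with
  | zero => simp
  | add x y hx hy => rw [map_add, map_add, map_add, hx, hy]
  | single σ r => simp [boundary, coboundary, map_sum]

lemma eval_eq_zero {m : ℕ} (z : S.cycles m) (c : S.Cochain A m) (hc : c ∈ S.coboundaries A m) :
    S.eval A (z : S.Chain m) c = 0 := by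
  obtain ⟨z, hz⟩ := z
  cases m with
  | zero =>
    have : c = 0 := hc
    rw [this, map_zero]
  | succ m =>
    obtain ⟨b, rfl⟩ := hc
    have hz' : S.boundary m z = 0 := hz
    rw [eval_coboundary, hz']
    rfl

/-- The Kronecker pairing `⟨α, z⟩` of a cohomology class with a cycle:
`⟨[c], z⟩ = c(z)`. -/
def pairing {m : ℕ} (α : S.Cohomology A m) (z : S.cycles m) : A :=
  Submodule.liftQ ((S.coboundaries A m).submoduleOf (S.cocycles A m))
    ((S.eval A (z : S.Chain m)).comp (S.cocycles A m).subtype)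
    (fun c hc => S.eval_eq_zero A z c.1 hc) α

lemma pairing_cohomologyClass {m : ℕ} (c : S.Cochain A m) (hc : c ∈ S.cocycles A m)
    (z : S.cycles m) : S.pairing A (S.cohomologyClass A c hc) z =
      (z : S.Chain m).sum fun σ r => r • c σ := rfl

/-- The map on cohomology induced by a homomorphism of coefficient groups. -/
def coeffMap {A : Type w} [AddCommGroup A] {B : Type v} [AddCommGroup B] (f : A →ₗ[ℤ] B) (m : ℕ) :
    S.Cohomology A m →ₗ[ℤ] S.Cohomology B m :=
  Submodule.mapQ _ _
    ((f.compLeft (S.simplex m)).restrict (p := S.cocycles A m) (q := S.cocycles B m) (by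
      intro c hc
      have hc' : S.coboundary A m c = 0 := hc
      change S.coboundary B m _ = 0
      ext σ
      have := congrArg f (congrFun hc' σ)
      simpa [coboundary] using this)) (by
    rintro ⟨c, hc⟩ hb
    change c ∈ S.coboundaries A m at hb
    change f.compLeft _ c ∈ S.coboundaries B m
    cases m with
    | zero =>
      have : c = 0 := hb
      rw [this, map_zero]
      exact Submodule.zero_mem _
    | succ m =>
      obtain ⟨b, rfl⟩ := hb
      refine ⟨f.compLeft _ b, ?_⟩
      ext σ
      simp [coboundary])

/-- A map of Δ-sets. -/
structure Hom (S : DeltaSet.{u}) (T : DeltaSet.{v}) where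
  toFun : ∀ m : ℕ, S.simplex m → T.simplex m
  map_face : ∀ {m : ℕ} (i : Fin (m + 2)) (σ : S.simplex (m + 1)),
    toFun m (S.face i σ) = T.face i (toFun (m + 1) σ)

variable {S T} in
/-- The pull-back map on cohomology induced by a map of Δ-sets. -/
def Hom.pullback (f : Hom S T) (A : Type w) [AddCommGroup A] (m : ℕ) :
    T.Cohomology A m →ₗ[ℤ] S.Cohomology A m :=
  Submodule.mapQ _ _
    ((LinearMap.funLeft ℤ A (f.toFun m)).restrict (p := T.cocycles A m) (q := S.cocycles A m) (by
      intro c hc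
      have hc' : T.coboundary A m c = 0 := hc
      change S.coboundary A m _ = 0
      ext σ
      have := congrFun hc' (f.toFun (m + 1) σ)
      simpa [coboundary, LinearMap.funLeft, f.map_face] using this)) (by
    rintro ⟨c, hc⟩ hb
    change c ∈ T.coboundaries A m at hb
    change LinearMap.funLeft ℤ A (f.toFun m) c ∈ S.coboundaries A m
    cases m with
    | zero =>
      have : c = 0 := hb
      rw [this, map_zero]
      exact Submodule.zero_mem _
    | succ m =>
      obtain ⟨b, rfl⟩ := hb
      refine ⟨LinearMap.funLeft ℤ A (f.toFun m) b, ?_⟩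
      ext σ
      simp [coboundary, LinearMap.funLeft, f.map_face])

end DeltaSet

/-! ### The classifying space of a discrete group -/

/-- The Δ-set `BG = G \ EG`, where the `m`-simplices of `EG` are the elements of `G^(m+1)`. Its
cochain complex is the complex of homogeneous cochains, so `Hᵐ(BG; A)` is the group cohomology
`Hᵐ(G; A)` with coefficients in the trivial `G`-module `A`. -/
def classifyingSpace (G : Type u) [Group G] : DeltaSet.{u} where
  simplex m := MulAction.orbitRel.Quotient G (Fin (m + 1) → G)
  face i := Quotient.map' (fun γ => γ ∘ i.succAbove) (by
    rintro γ γ' ⟨g, rfl⟩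
    exact ⟨g, rfl⟩)
  face_face := by
    rintro m i j ⟨γ⟩ h
    change Quotient.mk'' _ = Quotient.mk'' _
    congr 1
    funext l
    exact congrArg γ (succAbove_comm h l)

/-- The `G`-orbit of a tuple, as a simplex of `BG`. -/
def classifyingSpace.mk {G : Type u} [Group G] {m : ℕ} (γ : Fin (m + 1) → G) :
    (classifyingSpace G).simplex m :=
  (Quotient.mk'' γ : MulAction.orbitRel.Quotient G (Fin (m + 1) → G))

/-- The `A`-valued cochain on `BG` given by a `G`-invariant function. -/
def homogeneousCochain {G : Type u} [Group G] {A : Type w} [AddCommGroup A] {m : ℕ}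
    (c : (Fin (m + 1) → G) → A) (hc : ∀ (g : G) (γ : Fin (m + 1) → G), c (g • γ) = c γ) :
    (classifyingSpace G).Cochain A m :=
  fun σ => Quotient.liftOn' (s₁ := MulAction.orbitRel G (Fin (m + 1) → G)) σ c (by
    rintro γ γ' ⟨g, rfl⟩
    exact hc g γ')


/-! ### Oriented chains of a simplicial complex with a group action -/

section Oriented

variable {V : Type v} (X : AbstractSimplicialComplex V)

/-- The set `s` of vertices spans a simplex of `X`. -/
def Spans (s : Set V) : Prop := ∃ t ∈ X, (t : Set V) = s

variable {X} in
lemma Spans.mono {s t : Set V} (ht : Spans X t) (h : s ⊆ t) (hs : s.Nonempty) : Spans X s := by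
  obtain ⟨t, ht, rfl⟩ := ht
  have hfin : s.Finite := t.finite_toSet.subset h
  refine ⟨hfin.toFinset, (X.isRelLowerSet_faces ht).2 ?_ ?_, by simp⟩
  · intro x hx
    exact h (by simpa using hx)
  · simpa using hs

/-- Ordered (possibly degenerate) `m`-simplices of `X`: `(m+1)`-tuples of vertices that span a
simplex. -/
@[ext]
structure OrderedSimplex (m : ℕ) : Type v where
  vertex : Fin (m + 1) → V
  spans : Spans X (Set.range vertex)

namespace OrderedSimplex

variable {X} {m : ℕ}

/-- Omit the `i`-th vertex. -/
def face (i : Fin (m + 2)) (σ : OrderedSimplex X (m + 1)) : OrderedSimplex X m :=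
  ⟨σ.vertex ∘ i.succAbove, σ.spans.mono (Set.range_comp_subset_range _ _) (Set.range_nonempty _)⟩

/-- Permute the vertices. -/
def perm (t : Equiv.Perm (Fin (m + 1))) (σ : OrderedSimplex X m) : OrderedSimplex X m :=
  ⟨σ.vertex ∘ t, σ.spans.mono (Set.range_comp_subset_range _ _) (Set.range_nonempty _)⟩

end OrderedSimplex

/-- The relations `t·σ = sgn(t) σ` for permutations `t`, and `σ = 0` for degenerate `σ`. -/
def alternation (m : ℕ) : Submodule ℤ (OrderedSimplex X m →₀ ℤ) :=
  Submodule.span ℤ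
    ({c | ∃ (σ : OrderedSimplex X m) (t : Equiv.Perm (Fin (m + 1))),
        c = Finsupp.single (σ.perm t) 1 - ((Equiv.Perm.sign t : ℤˣ) : ℤ) • Finsupp.single σ 1} ∪
      {c | ∃ σ : OrderedSimplex X m, ¬ Function.Injective σ.vertex ∧ c = Finsupp.single σ 1})

/-- The group `C_m X` of (alternating) simplicial chains of `X`. -/
abbrev OrientedChain (m : ℕ) : Type v := (OrderedSimplex X m →₀ ℤ) ⧸ alternation X m

variable {X} in
/-- The oriented simplex `[v₀, …, v_m]`. -/
def oriented {m : ℕ} (σ : OrderedSimplex X m) : OrientedChain X m :=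
  Submodule.Quotient.mk (Finsupp.single σ 1)

lemma oriented_perm {m : ℕ} (σ : OrderedSimplex X m) (t : Equiv.Perm (Fin (m + 1))) :
    oriented (σ.perm t) = ((Equiv.Perm.sign t : ℤˣ) : ℤ) • oriented σ := by
  rw [oriented, oriented, ← Submodule.Quotient.mk_smul, Submodule.Quotient.eq]
  exact Submodule.subset_span (Or.inl ⟨σ, t, rfl⟩)

lemma oriented_degenerate {m : ℕ} (σ : OrderedSimplex X m) (h : ¬ Function.Injective σ.vertex) :
    oriented σ = 0 := by
  rw [oriented, Submodule.Quotient.mk_eq_zero]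
  exact Submodule.subset_span (Or.inr ⟨σ, h, rfl⟩)

variable {X} in
/-- Homomorphisms out of `C_m X` are alternating functions vanishing on degenerate simplices. -/
def OrientedChain.lift {A : Type w} [AddCommGroup A] {m : ℕ} (f : OrderedSimplex X m → A)
    (hp : ∀ σ t, f (σ.perm t) = ((Equiv.Perm.sign t : ℤˣ) : ℤ) • f σ)
    (hd : ∀ σ : OrderedSimplex X m, ¬ Function.Injective σ.vertex → f σ = 0) :
    OrientedChain X m →ₗ[ℤ] A :=
  Submodule.liftQ _ (Finsupp.linearCombination ℤ f) (by
    rw [alternation, Submodule.span_le]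
    rintro c (⟨σ, t, rfl⟩ | ⟨σ, h, rfl⟩)
    · simp [hp]
    · simp [hd σ h])

@[simp]
lemma OrientedChain.lift_oriented {A : Type w} [AddCommGroup A] {m : ℕ}
    (f : OrderedSimplex X m → A) (hp hd) (σ : OrderedSimplex X m) :
    OrientedChain.lift f hp hd (oriented σ) = f σ := by
  change Finsupp.linearCombination ℤ f (Finsupp.single σ 1) = f σ
  simp

variable {X} in
lemma OrientedChain.hom_ext {A : Type w} [AddCommGroup A] {m : ℕ}
    {f g : OrientedChain X m →ₗ[ℤ] A} (h : ∀ σ, f (oriented σ) = g (oriented σ)) : f = g := by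
  apply Submodule.linearMap_qext
  apply Finsupp.lhom_ext
  intro σ r
  have : (Finsupp.single σ r : OrderedSimplex X m →₀ ℤ) = r • Finsupp.single σ 1 := by simp
  rw [this, map_smul, map_smul]
  exact congrArg _ (h σ)

/-- The sum `∑ᵢ (-1)ⁱ [v₀, …, v̂ᵢ, …, v_{m+1}]`. -/
def faceSum {m : ℕ} (σ : OrderedSimplex X (m + 1)) : OrientedChain X m :=
  ∑ i : Fin (m + 2), (-1 : ℤ) ^ (i : ℕ) • oriented (σ.face i)

lemma faceSum_swap {m : ℕ} (σ : OrderedSimplex X (m + 1)) (j : Fin (m + 1)) :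
    faceSum X (σ.perm (Equiv.swap j.castSucc j.succ)) = - faceSum X σ := by
  have key : ∀ i : Fin (m + 2), (-1 : ℤ) ^ ((Equiv.swap j.castSucc j.succ i : Fin (m + 2)) : ℕ) •
      oriented ((σ.perm (Equiv.swap j.castSucc j.succ)).face (Equiv.swap j.castSucc j.succ i)) =
      - ((-1 : ℤ) ^ (i : ℕ) • oriented (σ.face i)) := by
    intro i
    by_cases h1 : i = j.castSucc
    · subst h1
      have : (σ.perm (Equiv.swap j.castSucc j.succ)).face j.succ = σ.face j.castSucc := by
        apply OrderedSimplex.ext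
        funext l
        change σ.vertex (Equiv.swap j.castSucc j.succ (j.succ.succAbove l)) = σ.vertex (j.castSucc.succAbove l)
        apply congrArg σ.vertex
        rcases lt_trichotomy l j with h | h | h
        · rw [Fin.succAbove_succ_of_le _ _ h.le, Fin.succAbove_castSucc_of_lt _ _ h,
            Equiv.swap_apply_of_ne_of_ne]
          · simpa using h.ne
          · intro h'
            rw [Fin.ext_iff] at h'
            rw [Fin.lt_def] at h
            simp only [Fin.val_castSucc, Fin.val_succ] at h'
            lia
        · subst h
          simp
        · rw [Fin.succAbove_succ_of_lt _ _ h, Fin.succAbove_castSucc_of_le _ _ h.le,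
            Equiv.swap_apply_of_ne_of_ne]
          · intro h'
            rw [Fin.ext_iff] at h'
            rw [Fin.lt_def] at h
            simp only [Fin.val_castSucc, Fin.val_succ] at h'
            lia
          · simpa using h.ne'
      rw [Equiv.swap_apply_left, this, Fin.val_succ, Fin.val_castSucc, pow_succ]
      simp
    by_cases h2 : i = j.succ
    · subst h2
      have : (σ.perm (Equiv.swap j.castSucc j.succ)).face j.castSucc = σ.face j.succ := by
        apply OrderedSimplex.ext
        funext l
        change σ.vertex (Equiv.swap j.castSucc j.succ (j.castSucc.succAbove l)) = σ.vertex (j.succ.succAbove l)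
        apply congrArg σ.vertex
        rcases lt_trichotomy l j with h | h | h
        · rw [Fin.succAbove_succ_of_le _ _ h.le, Fin.succAbove_castSucc_of_lt _ _ h,
            Equiv.swap_apply_of_ne_of_ne]
          · simpa using h.ne
          · intro h'
            rw [Fin.ext_iff] at h'
            rw [Fin.lt_def] at h
            simp only [Fin.val_castSucc, Fin.val_succ] at h'
            lia
        · subst h
          simp
        · rw [Fin.succAbove_succ_of_lt _ _ h, Fin.succAbove_castSucc_of_le _ _ h.le,
            Equiv.swap_apply_of_ne_of_ne]
          · intro h'
            rw [Fin.ext_iff] at h'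
            rw [Fin.lt_def] at h
            simp only [Fin.val_castSucc, Fin.val_succ] at h'
            lia
          · simpa using h.ne'
      rw [Equiv.swap_apply_right, this, Fin.val_succ, Fin.val_castSucc, pow_succ]
      simp
    · rw [Equiv.swap_apply_of_ne_of_ne h1 h2, ← smul_neg]
      congr 1
      obtain ⟨a, ha⟩ := Fin.exists_succAbove_eq (Ne.symm h1)
      obtain ⟨b, hb⟩ := Fin.exists_succAbove_eq (Ne.symm h2)
      have hab : a ≠ b := by
        rintro rfl
        rw [ha] at hb
        simp [Fin.ext_iff] at hb
      have : (σ.perm (Equiv.swap j.castSucc j.succ)).face i =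
          (σ.face i).perm (Equiv.swap a b) := by
        apply OrderedSimplex.ext
        funext l
        change σ.vertex (Equiv.swap j.castSucc j.succ (i.succAbove l)) =
          σ.vertex (i.succAbove (Equiv.swap a b l))
        apply congrArg σ.vertex
        rw [← ha, ← hb, Function.Injective.swap_apply Fin.succAbove_right_injective]
      rw [this, oriented_perm, Equiv.Perm.sign_swap hab]
      simp
  rw [faceSum, ← Equiv.sum_comp (Equiv.swap j.castSucc j.succ), Finset.sum_congr rfl fun i _ => key i,
    Finset.sum_neg_distrib, faceSum]

lemma faceSum_perm {m : ℕ} (t : Equiv.Perm (Fin (m + 2))) :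
    ∀ σ : OrderedSimplex X (m + 1),
      faceSum X (σ.perm t) = ((Equiv.Perm.sign t : ℤˣ) : ℤ) • faceSum X σ := by
  have ht : t ∈ Submonoid.closure
      (Set.range fun i : Fin (m + 1) => Equiv.swap i.castSucc i.succ) := by
    rw [Equiv.Perm.mclosure_swap_castSucc_succ]; trivial
  induction ht using Submonoid.closure_induction with
  | mem t ht =>
    obtain ⟨j, rfl⟩ := ht
    intro σ
    rw [faceSum_swap, Equiv.Perm.sign_swap (by simp [Fin.ext_iff])]
    simp
  | one =>
    intro σ
    rw [Equiv.Perm.sign_one, Units.val_one, one_smul]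
    rfl
  | mul t t' _ _ h h' =>
    intro σ
    have : σ.perm (t * t') = (σ.perm t).perm t' := rfl
    rw [this, h', h, smul_smul, Equiv.Perm.sign_mul, mul_comm]
    simp

lemma faceSum_degenerate {m : ℕ} (σ : OrderedSimplex X (m + 1))
    (h : ¬ Function.Injective σ.vertex) : faceSum X σ = 0 := by
  simp only [Function.Injective, not_forall] at h
  obtain ⟨a, b, hab, hne⟩ := h
  -- move the repeated vertex to positions `0` and `1`
  obtain ⟨t, ht0, ht1⟩ : ∃ t : Equiv.Perm (Fin (m + 2)), t 0 = a ∧ t 1 = b := by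
    refine ⟨Equiv.swap 0 a * Equiv.swap 1 (Equiv.swap 0 a b), ?_, ?_⟩
    · rw [Equiv.Perm.mul_apply, Equiv.swap_apply_of_ne_of_ne (a := 1) (x := 0), Equiv.swap_apply_left]
      · simp
      · intro h0
        apply hne
        have := congrArg (Equiv.swap 0 a) h0
        simpa using this
    · rw [Equiv.Perm.mul_apply, Equiv.swap_apply_left, Equiv.swap_apply_self]
  have h0 : faceSum X (σ.perm t) = 0 := by
    have e : (σ.perm t).vertex 0 = (σ.perm t).vertex 1 := by
      change σ.vertex (t 0) = σ.vertex (t 1)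
      rw [ht0, ht1, hab]
    rw [faceSum, Fin.sum_univ_succ, Fin.sum_univ_succ]
    have e1 : (σ.perm t).face (Fin.succ 0) = (σ.perm t).face 0 := by
      apply OrderedSimplex.ext
      funext l
      change (σ.perm t).vertex _ = (σ.perm t).vertex _
      refine Fin.cases ?_ (fun l => ?_) l
      · exact e
      · rfl
    have e2 : ∀ i : Fin m, oriented ((σ.perm t).face i.succ.succ) = 0 := by
      intro i
      apply oriented_degenerate
      intro hinj
      obtain ⟨c, hc⟩ := Fin.exists_succAbove_eq (show (0 : Fin (m + 2)) ≠ i.succ.succ by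
        simp [Fin.ext_iff])
      obtain ⟨d, hd⟩ := Fin.exists_succAbove_eq (show (1 : Fin (m + 2)) ≠ i.succ.succ by
        simp [Fin.ext_iff])
      have hcd : c = d := by
        apply hinj
        change (σ.perm t).vertex (i.succ.succ.succAbove c) = (σ.perm t).vertex (i.succ.succ.succAbove d)
        rw [hc, hd, e]
      rw [hcd, hd] at hc
      simp at hc
    rw [e1, Finset.sum_congr rfl fun i _ => by rw [e2 i, smul_zero]]
    simp
  rw [faceSum_perm] at h0
  have h1 := congrArg (fun x => ((Equiv.Perm.sign t : ℤˣ) : ℤ) • x) h0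
  simpa [smul_smul] using h1

/-- The boundary operator `∂ : C_{m+1} X → C_m X`. -/
def orientedBoundary (m : ℕ) : OrientedChain X (m + 1) →ₗ[ℤ] OrientedChain X m :=
  OrientedChain.lift (faceSum X) (fun σ t => faceSum_perm X t σ) (faceSum_degenerate X)

/-- The augmentation `C_0 X → ℤ`. -/
def augmentation : OrientedChain X 0 →ₗ[ℤ] ℤ :=
  OrientedChain.lift (fun _ => 1) (fun _ t => by
      have : t = 1 := Equiv.ext fun i => (Fin.eq_zero _).trans (Fin.eq_zero _).symm
      simp [this])
    (fun σ h => absurd (fun i j _ => (Fin.eq_zero i).trans (Fin.eq_zero j).symm) h)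

variable (G : Type u) [Group G] [MulAction G V]

/-- `G` acts on `X` by simplicial automorphisms. -/
class IsSimplicialAction : Prop where
  spans_smul : ∀ (g : G) (s : Set V), Spans X s → Spans X ((fun x => g • x) '' s)

variable [IsSimplicialAction X G]

variable {G X} in
/-- The translate `g·σ`. -/
def OrderedSimplex.translate {m : ℕ} (g : G) (σ : OrderedSimplex X m) : OrderedSimplex X m :=
  ⟨fun i => g • σ.vertex i, by
    have := IsSimplicialAction.spans_smul g _ σ.spans
    rwa [← Set.range_comp] at this⟩

variable {G} in
lemma OrderedSimplex.perm_translate {m : ℕ} (g : G) (σ : OrderedSimplex X m)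
    (t : Equiv.Perm (Fin (m + 1))) : (σ.perm t).translate g = (σ.translate g).perm t := rfl

variable {G} in
/-- The action of `g ∈ G` on `C_m X`. -/
def translate {m : ℕ} (g : G) : OrientedChain X m →ₗ[ℤ] OrientedChain X m :=
  OrientedChain.lift (fun σ => oriented (σ.translate g))
    (fun σ t => by rw [OrderedSimplex.perm_translate, oriented_perm])
    (fun σ h => oriented_degenerate X _ fun h' => h fun _ _ hab =>
      h' (congrArg (fun x => g • x) hab))

variable {G} in
lemma translate_oriented {m : ℕ} (g : G) (σ : OrderedSimplex X m) :
    translate X g (oriented σ) = oriented (σ.translate g) := by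
  rw [translate, OrientedChain.lift_oriented]

/-- The coefficient group `U_m = (C_m / B_m)_G`: the `G`-coinvariants of chains modulo
boundaries. -/
abbrev TautCoeff (m : ℕ) : Type v :=
  OrientedChain X m ⧸ (LinearMap.range (orientedBoundary X m) ⊔
    Submodule.span ℤ {c | ∃ (g : G) (x : OrientedChain X m), c = translate X g x - x})

/-- The tautological cocycle: the quotient map `C_m → U_m`. -/
def tautologicalCocycle (m : ℕ) : OrientedChain X m →ₗ[ℤ] TautCoeff X G m := Submodule.mkQ _

/-- An augmentation preserving `G`-chain map from the standard homogeneous resolution of `G`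
(whose group in degree `m` is free abelian on `G^(m+1)`) to the simplicial chain complex of `X`. -/
structure ResolutionMap where
  toFun : ∀ m : ℕ, (Fin (m + 1) → G) → OrientedChain X m
  equivariant : ∀ (m : ℕ) (g : G) (γ : Fin (m + 1) → G),
    toFun m (g • γ) = translate X g (toFun m γ)
  augmentation_eq : ∀ γ : Fin 1 → G, augmentation X (toFun 0 γ) = 1
  boundary_eq : ∀ (m : ℕ) (γ : Fin (m + 2) → G),
    orientedBoundary X m (toFun (m + 1) γ) =
      ∑ i : Fin (m + 2), (-1 : ℤ) ^ (i : ℕ) • toFun m (γ ∘ i.succAbove)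

lemma tautologicalCocycle_translate (m : ℕ) (g : G) (x : OrientedChain X m) :
    tautologicalCocycle X G m (translate X g x) = tautologicalCocycle X G m x := by
  rw [tautologicalCocycle, Submodule.mkQ_apply, Submodule.mkQ_apply, Submodule.Quotient.eq]
  exact Submodule.mem_sup_right (Submodule.subset_span ⟨g, x, rfl⟩)

lemma tautologicalCocycle_boundary (m : ℕ) (x : OrientedChain X (m + 1)) :
    tautologicalCocycle X G m (orientedBoundary X m x) = 0 := by
  rw [tautologicalCocycle, Submodule.mkQ_apply, Submodule.Quotient.mk_eq_zero]
  exact Submodule.mem_sup_left ⟨x, rfl⟩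

variable {X G} in
/-- The pull-back of the tautological cocycle along a resolution map, a homogeneous cocycle
of `G`. -/
def ResolutionMap.cocycle (ψ : ResolutionMap X G) (m : ℕ) :
    (classifyingSpace G).Cochain (TautCoeff X G m) m :=
  homogeneousCochain (fun γ => tautologicalCocycle X G m (ψ.toFun m γ))
    fun g γ => by rw [ψ.equivariant, tautologicalCocycle_translate]

variable {X G} in
lemma ResolutionMap.cocycle_mem (ψ : ResolutionMap X G) (m : ℕ) :
    ψ.cocycle m ∈ (classifyingSpace G).cocycles (TautCoeff X G m) m := by
  change (classifyingSpace G).coboundary (TautCoeff X G m) m (ψ.cocycle m) = 0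
  ext σ
  obtain ⟨γ⟩ := σ
  change ∑ i : Fin (m + 2), (-1 : ℤ) ^ (i : ℕ) •
    tautologicalCocycle X G m (ψ.toFun m (γ ∘ i.succAbove)) = 0
  simp only [← map_smul, ← map_sum]
  rw [← ψ.boundary_eq, tautologicalCocycle_boundary]

variable {X G} in
/-- The cohomology class of the pull-back of the tautological cocycle along a resolution map. -/
def ResolutionMap.cohomClass (ψ : ResolutionMap X G) (m : ℕ) :
    (classifyingSpace G).Cohomology (TautCoeff X G m) m :=
  (classifyingSpace G).cohomologyClass _ (ψ.cocycle m) (ψ.cocycle_mem m)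

/-- Any finitely many simplices can be joined with a common vertex. -/
def StarProperty : Prop :=
  ∀ F : Set (Set V), F.Finite → (∀ s ∈ F, Spans X s) → ∃ v : V, ∀ s ∈ F, Spans X (insert v s)

open Classical in
/-- The cone operator with vertex `v`; simplices that cannot be joined with `v` go to zero. -/
def cone (v : V) (m : ℕ) : OrientedChain X m →ₗ[ℤ] OrientedChain X (m + 1) :=
  OrientedChain.lift
    (fun σ => if h : Spans X (Set.range (Fin.cons v σ.vertex : Fin (m + 2) → V)) then
      oriented ⟨Fin.cons v σ.vertex, h⟩ else 0)
    (fun σ t => by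
      have hr : Set.range (Fin.cons v (σ.perm t).vertex : Fin (m + 2) → V) =
          Set.range (Fin.cons v σ.vertex : Fin (m + 2) → V) := by
        rw [Fin.range_cons, Fin.range_cons]
        congr 1
        exact t.surjective.range_comp σ.vertex
      by_cases h : Spans X (Set.range (Fin.cons v σ.vertex : Fin (m + 2) → V))
      · rw [dif_pos h, dif_pos (hr ▸ h)]
        have : (⟨Fin.cons v (σ.perm t).vertex, hr ▸ h⟩ : OrderedSimplex X (m + 1)) =
            OrderedSimplex.perm (Equiv.Perm.decomposeFin.symm (0, t)) ⟨Fin.cons v σ.vertex, h⟩ := by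
          apply OrderedSimplex.ext
          funext i
          change (Fin.cons v (σ.vertex ∘ t) : Fin (m + 2) → V) i =
            (Fin.cons v σ.vertex : Fin (m + 2) → V) (Equiv.Perm.decomposeFin.symm (0, t) i)
          refine Fin.cases ?_ (fun i => ?_) i
          · simp
          · simp
        rw [this, oriented_perm, Equiv.Perm.decomposeFin.symm_sign]
        simp
      · rw [dif_neg h, dif_neg (hr ▸ h), smul_zero])
    (fun σ h => by
      split_ifs with h'
      · apply oriented_degenerate
        intro hinj
        exact h fun a b hab => Fin.succ_injective _ (hinj (by simpa using hab))
      · rfl)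

lemma cone_oriented (v : V) {m : ℕ} (σ : OrderedSimplex X m)
    (h : Spans X (Set.range (Fin.cons v σ.vertex : Fin (m + 2) → V))) :
    cone X v m (oriented σ) = oriented ⟨Fin.cons v σ.vertex, h⟩ := by
  rw [cone, OrientedChain.lift_oriented, dif_pos h]

/-- The vertex `v` as a `0`-chain. -/
def vertexChain (v : V) : OrientedChain X 0 :=
  oriented ⟨fun _ => v, {v}, X.singleton_mem v, by simp⟩

lemma boundary_oriented {m : ℕ} (σ : OrderedSimplex X (m + 1)) :
    orientedBoundary X m (oriented σ) =
      ∑ i : Fin (m + 2), (-1 : ℤ) ^ (i : ℕ) • oriented (σ.face i) := by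
  rw [orientedBoundary, OrientedChain.lift_oriented, faceSum]

lemma boundary_cone_zero (v : V) (σ : OrderedSimplex X 0)
    (h : Spans X (insert v (Set.range σ.vertex))) :
    orientedBoundary X 0 (cone X v 0 (oriented σ)) = oriented σ - vertexChain X v := by
  rw [cone_oriented X v σ (by rwa [Fin.range_cons]), boundary_oriented, Fin.sum_univ_two]
  have e0 : OrderedSimplex.face 0 (⟨Fin.cons v σ.vertex, by rwa [Fin.range_cons]⟩ :
      OrderedSimplex X 1) = σ := rfl
  have e1 : oriented (OrderedSimplex.face 1 (⟨Fin.cons v σ.vertex, by rwa [Fin.range_cons]⟩ :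
      OrderedSimplex X 1)) = vertexChain X v := by
    rw [vertexChain]
    congr 1
    apply OrderedSimplex.ext
    funext i
    rw [Fin.eq_zero i]
    rfl
  rw [e0, e1]
  simp [sub_eq_add_neg]

lemma boundary_cone_succ (v : V) {m : ℕ} (σ : OrderedSimplex X (m + 1))
    (h : Spans X (insert v (Set.range σ.vertex))) :
    orientedBoundary X (m + 1) (cone X v (m + 1) (oriented σ)) =
      oriented σ - cone X v m (orientedBoundary X m (oriented σ)) := by
  have h' : Spans X (Set.range (Fin.cons v σ.vertex : Fin (m + 3) → V)) := by rwa [Fin.range_cons]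
  rw [cone_oriented X v σ h', boundary_oriented, boundary_oriented, Fin.sum_univ_succ, map_sum,
    sub_eq_add_neg, ← Finset.sum_neg_distrib]
  congr 1
  · simp only [Fin.val_zero, pow_zero, one_smul]
    rfl
  · refine Finset.sum_congr rfl fun i _ => ?_
    have hi : Spans X (Set.range (Fin.cons v (σ.face i).vertex : Fin (m + 2) → V)) := by
      refine h.mono ?_ (Set.range_nonempty _)
      rw [Fin.range_cons]
      exact Set.insert_subset_insert (by rintro _ ⟨l, rfl⟩; exact ⟨_, rfl⟩)
    rw [map_smul, cone_oriented X v _ hi]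
    have : OrderedSimplex.face i.succ (⟨Fin.cons v σ.vertex, h'⟩ : OrderedSimplex X (m + 2)) =
        ⟨Fin.cons v (σ.face i).vertex, hi⟩ := by
      apply OrderedSimplex.ext
      funext l
      change (Fin.cons v σ.vertex : Fin (m + 3) → V) (i.succ.succAbove l) =
        (Fin.cons v (σ.vertex ∘ i.succAbove) : Fin (m + 2) → V) l
      refine Fin.cases ?_ (fun l => ?_) l
      · simp
      · simp
    rw [this, Fin.val_succ, pow_succ]
    simp

/-- A lift of a chain, as a combination of ordered simplices that are all joinable with some
vertex. -/
lemma exists_joinable (hX : StarProperty X) {m : ℕ} (c : OrientedChain X m) :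
    ∃ (v : V) (c' : OrderedSimplex X m →₀ ℤ), c = ∑ σ ∈ c'.support, c' σ • oriented σ ∧
      ∀ σ ∈ c'.support, Spans X (insert v (Set.range σ.vertex)) := by
  obtain ⟨c', rfl⟩ := Submodule.Quotient.mk_surjective _ c
  obtain ⟨v, hv⟩ := hX ((fun σ : OrderedSimplex X m => Set.range σ.vertex) '' c'.support)
    (c'.support.finite_toSet.image _) (by rintro _ ⟨σ, _, rfl⟩; exact σ.spans)
  refine ⟨v, c', ?_, fun σ hσ => hv _ ⟨σ, hσ, rfl⟩⟩
  conv_lhs => rw [← Finsupp.sum_single c', Finsupp.sum]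
  rw [← Submodule.mkQ_apply, map_sum]
  refine Finset.sum_congr rfl fun σ _ => ?_
  rw [oriented, ← Submodule.mkQ_apply, ← map_smul]
  simp

lemma exact_zero (hX : StarProperty X) (c : OrientedChain X 0) (hc : augmentation X c = 0) :
    ∃ b, orientedBoundary X 0 b = c := by
  obtain ⟨v, c', hc', hv⟩ := exists_joinable X hX c
  refine ⟨cone X v 0 c, ?_⟩
  have h0 : (∑ σ ∈ c'.support, c' σ) = 0 := by
    rw [hc', map_sum] at hc
    simpa [augmentation] using hc
  rw [hc', map_sum, map_sum]
  have : ∀ σ ∈ c'.support, orientedBoundary X 0 (cone X v 0 (c' σ • oriented σ)) =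
      c' σ • oriented σ - c' σ • vertexChain X v := by
    intro σ hσ
    rw [map_smul, map_smul, boundary_cone_zero X v σ (hv σ hσ), smul_sub]
  rw [Finset.sum_congr rfl this, Finset.sum_sub_distrib, ← Finset.sum_smul, h0, zero_smul,
    sub_zero]

lemma exact_succ (hX : StarProperty X) {m : ℕ} (c : OrientedChain X (m + 1))
    (hc : orientedBoundary X m c = 0) : ∃ b, orientedBoundary X (m + 1) b = c := by
  obtain ⟨v, c', hc', hv⟩ := exists_joinable X hX c
  refine ⟨cone X v (m + 1) c, ?_⟩
  have h0 : cone X v m (orientedBoundary X m c) = 0 := by rw [hc, map_zero]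
  rw [hc', map_sum, map_sum] at h0
  rw [hc', map_sum, map_sum]
  have : ∀ σ ∈ c'.support, orientedBoundary X (m + 1) (cone X v (m + 1) (c' σ • oriented σ)) =
      c' σ • oriented σ - cone X v m (orientedBoundary X m (c' σ • oriented σ)) := by
    intro σ hσ
    rw [map_smul, map_smul, boundary_cone_succ X v σ (hv σ hσ), smul_sub, map_smul, map_smul]
  rw [Finset.sum_congr rfl this, Finset.sum_sub_distrib, h0, sub_zero]

/-- Reduced cycles. -/
def IsReducedCycle : ∀ {m : ℕ}, OrientedChain X m → Prop
  | 0, c => augmentation X c = 0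
  | _ + 1, c => orientedBoundary X _ c = 0

lemma exists_filling (hX : StarProperty X) :
    ∀ {m : ℕ} (c : OrientedChain X m), IsReducedCycle X c → ∃ b, orientedBoundary X m b = c
  | 0, c, hc => exact_zero X hX c hc
  | _ + 1, c, hc => exact_succ X hX c hc

variable {G} in
/-- The value on `∂γ` of a homogeneous chain-valued function. -/
def onBoundary {m : ℕ} (f : (Fin (m + 1) → G) → OrientedChain X m) (γ : Fin (m + 2) → G) :
    OrientedChain X m :=
  ∑ i : Fin (m + 2), (-1 : ℤ) ^ (i : ℕ) • f (γ ∘ i.succAbove)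

variable {G} in
lemma boundary_translate {m : ℕ} (g : G) (c : OrientedChain X (m + 1)) :
    orientedBoundary X m (translate X g c) = translate X g (orientedBoundary X m c) := by
  have : (orientedBoundary X m).comp (translate X g) =
      (translate X g).comp (orientedBoundary X m) := by
    apply OrientedChain.hom_ext
    intro σ
    simp only [LinearMap.comp_apply]
    rw [translate_oriented, boundary_oriented, boundary_oriented, map_sum]
    refine Finset.sum_congr rfl fun i _ => ?_
    rw [map_smul, translate_oriented]
    rfl
  exact LinearMap.congr_fun this c

variable {G} in
lemma translate_translate {m : ℕ} (g h : G) (c : OrientedChain X m) :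
    translate X g (translate X h c) = translate X (g * h) c := by
  have : (translate X g).comp (translate X h) = translate (m := m) X (g * h) := by
    apply OrientedChain.hom_ext
    intro σ
    simp only [LinearMap.comp_apply, translate_oriented]
    congr 1
    apply OrderedSimplex.ext
    funext i
    exact (mul_smul g h _).symm
  exact LinearMap.congr_fun this c

/-- The inductive data for the construction of a resolution map. -/
abbrev PartialMap (m : ℕ) : Type (max u v) :=
  {f : (Fin (m + 1) → G) → OrientedChain X m //
    (∀ (g : G) (γ : Fin (m + 1) → G), f (g • γ) = translate X g (f γ)) ∧
    ∀ γ : Fin (m + 2) → G, IsReducedCycle X (onBoundary X f γ)}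

lemma exists_partialMap_succ (hX : StarProperty X) {m : ℕ} (f : PartialMap X G m) :
    ∃ f' : PartialMap X G (m + 1), ∀ γ, orientedBoundary X m (f'.1 γ) = onBoundary X f.1 γ := by
  choose b hb using fun γ => exists_filling X hX _ (f.2.2 γ)
  have hequiv : ∀ (g : G) (γ : Fin (m + 2) → G),
      onBoundary X f.1 (g • γ) = translate X g (onBoundary X f.1 γ) := by
    intro g γ
    rw [onBoundary, onBoundary, map_sum]
    refine Finset.sum_congr rfl fun i _ => ?_
    rw [map_smul, ← f.2.1]
    rfl
  have hbd : ∀ γ : Fin (m + 2) → G,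
      orientedBoundary X m (translate X (γ 0) (b ((γ 0)⁻¹ • γ))) = onBoundary X f.1 γ := by
    intro γ
    rw [boundary_translate, hb, ← hequiv, smul_inv_smul]
  refine ⟨⟨fun γ => translate X (γ 0) (b ((γ 0)⁻¹ • γ)), ?_, ?_⟩, hbd⟩
  · intro g γ
    have : ((g • γ) 0)⁻¹ • g • γ = (γ 0)⁻¹ • γ := by
      rw [Pi.smul_apply, smul_eq_mul, mul_inv_rev, mul_smul, inv_smul_smul]
    change translate X ((g • γ) 0) (b (((g • γ) 0)⁻¹ • g • γ)) =
      translate X g (translate X (γ 0) (b ((γ 0)⁻¹ • γ)))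
    rw [this, translate_translate]
    rfl
  · intro γ
    change orientedBoundary X m _ = 0
    rw [onBoundary, map_sum]
    simp only [map_smul, hbd]
    refine alternating_sum_sum (fun a b => f.1 ((γ ∘ a.succAbove) ∘ b.succAbove)) fun i j h => ?_
    apply congrArg f.1
    funext l
    exact congrArg γ (succAbove_comm h l)

lemma exists_partialMap_zero (hX : StarProperty X) :
    ∃ f : PartialMap X G 0, ∀ γ, augmentation X (f.1 γ) = 1 := by
  obtain ⟨v, -⟩ := hX ∅ Set.finite_empty (by simp)
  have haug : ∀ g : G, augmentation X (translate X g (vertexChain X v)) = 1 := by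
    intro g
    rw [vertexChain, translate_oriented, augmentation,
      OrientedChain.lift_oriented]
  refine ⟨⟨fun γ => translate X (γ 0) (vertexChain X v), ?_, ?_⟩, fun γ => haug _⟩
  · intro g γ
    rw [translate_translate]
    rfl
  · intro γ
    change augmentation X _ = 0
    rw [onBoundary, map_sum]
    simp [haug, Fin.sum_univ_two]

/-- Resolution maps exist: the chain complex of a complex with the star property is acyclic. -/
lemma nonempty_resolutionMap (hX : StarProperty X) : Nonempty (ResolutionMap X G) := by
  obtain ⟨f₀, h₀⟩ := exists_partialMap_zero X G hX
  choose next hnext using fun (m : ℕ) (f : PartialMap X G m) => exists_partialMap_succ X G hX f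
  let F : ∀ m, PartialMap X G m := fun m => Nat.rec f₀ next m
  exact ⟨{
    toFun := fun m => (F m).1
    equivariant := fun m => (F m).2.1
    augmentation_eq := h₀
    boundary_eq := fun m γ => hnext m (F m) γ }⟩

/-- The tautological class `τᵐ ∈ Hᵐ(G; U_m)` of a simplicial `G`-complex with the star property.
(It does not depend on the resolution map, any two of which are chain homotopic.) -/
def tautologicalClass (hX : StarProperty X) (m : ℕ) :
    (classifyingSpace G).Cohomology (TautCoeff X G m) m :=
  (Classical.choice (nonempty_resolutionMap X G hX)).cohomClass m

end Oriented

/-! ### Degrees of `(n+1)`-tuples of vectors in `Kⁿ` -/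

section Degree

variable {K : Type u} [Field K] [LinearOrder K] [IsStrictOrderedRing K] {n : ℕ}

open Classical in
/-- For `v₀, …, v_n ∈ Kⁿ`: the sign of `det(v₀, …, v_{n-1})` if `v_n` is a combination of
`v₀, …, v_{n-1}` with negative coefficients, and `0` otherwise. -/
def degree (v : Fin (n + 1) → Fin n → K) : ℤ :=
  if ∃ α : Fin n → K, (∀ i, α i < 0) ∧ v (Fin.last n) = ∑ i, α i • v i.castSucc then
    (SignType.sign (Matrix.of fun i : Fin n => v i.castSucc).det : ℤ)
  else 0

/-- The signed maximal minors of `(v₀, …, v_n)`. -/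
def minor (v : Fin (n + 1) → Fin n → K) (i : Fin (n + 1)) : K :=
  (-1) ^ (i : ℕ) * (Matrix.of fun r : Fin n => v (i.succAbove r)).det

/-- `1` if all entries are positive, `-1` if all are negative, `0` otherwise. -/
def commonSign {m : ℕ} (a : Fin m → K) : ℤ :=
  if ∀ i, 0 < a i then 1 else if ∀ i, a i < 0 then -1 else 0

lemma minor_relation (v : Fin (n + 1) → Fin n → K) : ∑ i, minor v i • v i = 0 := by
  ext j
  let M : Matrix (Fin (n + 1)) (Fin (n + 1)) K := Matrix.of fun r => Fin.cons (v r j) (v r)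
  have h : M.det = 0 := Matrix.det_zero_of_column_eq (i := 0) (j := j.succ)
    (Fin.succ_ne_zero j).symm (fun r => by simp [M])
  rw [Matrix.det_succ_column_zero] at h
  rw [Finset.sum_apply, Pi.zero_apply, ← h]
  refine Finset.sum_congr rfl fun r _ => ?_
  have : M.submatrix r.succAbove Fin.succ = Matrix.of fun s : Fin n => v (r.succAbove s) := by
    ext a b
    simp [M]
  rw [this]
  simp only [minor, Pi.smul_apply, smul_eq_mul, M, Matrix.of_apply, Fin.cons_zero]
  ring

lemma minor_eq_det (v : Fin (n + 1) → Fin n → K) (i : Fin (n + 1)) :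
    minor v i = (Matrix.of fun r => (Fin.cons (if r = i then 1 else 0) (v r) :
      Fin (n + 1) → K)).det := by
  rw [Matrix.det_succ_column_zero, Finset.sum_eq_single i]
  · have : (Matrix.of fun r => (Fin.cons (if r = i then 1 else 0) (v r) :
        Fin (n + 1) → K)).submatrix i.succAbove Fin.succ =
        Matrix.of fun s : Fin n => v (i.succAbove s) := by
      ext a b
      simp
    rw [this]
    simp [minor]
  · intro r _ hr
    simp [hr]
  · simp

lemma minor_perm (v : Fin (n + 1) → Fin n → K) (t : Equiv.Perm (Fin (n + 1)))
    (i : Fin (n + 1)) :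
    minor (v ∘ t) i = ((Equiv.Perm.sign t : ℤˣ) : ℤ) * minor v (t i) := by
  rw [minor_eq_det, minor_eq_det, ← Matrix.det_permute]
  congr 1
  ext a b
  refine Fin.cases ?_ (fun b => ?_) b
  · simp
  · simp

/-- A relation between `v₀, …, v_n` determines the minors up to a scalar. -/
lemma minor_of_relation (v : Fin (n + 1) → Fin n → K) (i : Fin (n + 1)) (hi : minor v i ≠ 0)
    (x : Fin (n + 1) → K) (hx : ∑ j, x j • v j = 0) (l : Fin (n + 1)) :
    x l * minor v i = x i * minor v l := by
  have hli : LinearIndependent K fun r : Fin n => v (i.succAbove r) := by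
    have hdet : (Matrix.of fun r : Fin n => v (i.succAbove r)).det ≠ 0 := by
      intro h
      exact hi (by rw [minor, h, mul_zero])
    exact Matrix.linearIndependent_rows_of_det_ne_zero hdet
  have h : ∑ j, (x j * minor v i - x i * minor v j) • v j = 0 := by
    have h1 := congrArg (fun y => minor v i • y) hx
    have h2 := congrArg (fun y => x i • y) (minor_relation v)
    simp only [Finset.smul_sum, smul_zero, smul_smul] at h1 h2
    simp only [sub_smul, Finset.sum_sub_distrib, mul_comm (x _) (minor v i), h1, h2, sub_zero]
  rw [Fin.sum_univ_succAbove _ i] at h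
  simp only [sub_self, zero_smul, zero_add] at h
  rw [Fintype.linearIndependent_iff] at hli
  by_cases hl : l = i
  · rw [hl]
  · obtain ⟨r, rfl⟩ := Fin.exists_succAbove_eq hl
    exact sub_eq_zero.1 (hli _ h r)

lemma degree_eq (v : Fin (n + 1) → Fin n → K) :
    degree v = (-1) ^ n * commonSign (minor v) := by
  have hlast : minor v (Fin.last n) =
      (-1) ^ n * (Matrix.of fun i : Fin n => v i.castSucc).det := by
    simp [minor]
  have hsq : ((-1 : K) ^ n) * ((-1) ^ n) = 1 := by rw [← mul_pow]; simp
  have hdet : (Matrix.of fun i : Fin n => v i.castSucc).det = (-1) ^ n * minor v (Fin.last n) := by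
    rw [hlast, ← mul_assoc, hsq, one_mul]
  have hsign : (SignType.sign (Matrix.of fun i : Fin n => v i.castSucc).det : ℤ) =
      (-1) ^ n * (SignType.sign (minor v (Fin.last n)) : ℤ) := by
    rw [hdet]
    rcases neg_one_pow_eq_or K n with h | h
    · have h' : Even n := by
        by_contra ho
        rw [Nat.not_even_iff_odd] at ho
        rw [ho.neg_one_pow] at h
        linarith [one_pos (α := K)]
      rw [h, h'.neg_one_pow, one_mul, one_mul]
    · have h' : Odd n := by
        by_contra ho
        rw [Nat.not_odd_iff_even] at ho
        rw [ho.neg_one_pow] at h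
        linarith [one_pos (α := K)]
      rw [h, h'.neg_one_pow, neg_one_mul, neg_one_mul, Left.sign_neg]
      simp
  rw [degree, hsign]
  by_cases h0 : minor v (Fin.last n) = 0
  · rw [h0]
    have h1 : ¬ ∀ i, 0 < minor v i := fun h => (h (Fin.last n)).ne' h0
    have h2 : ¬ ∀ i, minor v i < 0 := fun h => (h (Fin.last n)).ne h0
    simp [commonSign, h1, h2]
  have hrel : ∀ α : Fin n → K, v (Fin.last n) = ∑ i, α i • v i.castSucc →
      ∀ i, minor v i.castSucc = - (α i * minor v (Fin.last n)) := by
    intro α hα i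
    have := minor_of_relation v (Fin.last n) h0 (Fin.snoc (fun i => - α i) 1) (by
      rw [Fin.sum_univ_castSucc]
      simp [hα]) i.castSucc
    simp at this
    rw [← this]
  have hex : ∃ α : Fin n → K, v (Fin.last n) = ∑ i, α i • v i.castSucc := by
    refine ⟨fun i => - minor v i.castSucc / minor v (Fin.last n), ?_⟩
    have h := minor_relation v
    rw [Fin.sum_univ_castSucc, add_comm, ← eq_neg_iff_add_eq_zero] at h
    have h' := congrArg (fun y => (minor v (Fin.last n))⁻¹ • y) h
    simp only [inv_smul_smul₀ h0] at h'
    rw [h', ← Finset.sum_neg_distrib, Finset.smul_sum]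
    refine Finset.sum_congr rfl fun i _ => ?_
    rw [← neg_smul, smul_smul]
    congr 1
    ring
  rcases lt_or_gt_of_ne h0 with hneg | hpos
  · have h1 : ¬ ∀ i, 0 < minor v i := fun h => (h (Fin.last n)).not_gt hneg
    rw [commonSign, if_neg h1, sign_neg hneg]
    by_cases hall : ∀ i, minor v i < 0
    · rw [if_pos hall, if_pos]
      · simp
      · obtain ⟨α, hα⟩ := hex
        refine ⟨α, fun i => ?_, hα⟩
        have := hrel α hα i
        have h3 := hall i.castSucc
        nlinarith
    · rw [if_neg hall, if_neg]
      · simp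
      · rintro ⟨α, hα, hv⟩
        apply hall
        intro i
        refine Fin.lastCases hneg (fun i => ?_) i
        rw [hrel α hv i]
        nlinarith [hα i]
  · have h2 : ¬ ∀ i, minor v i < 0 := fun h => (h (Fin.last n)).not_gt hpos
    rw [commonSign, if_neg h2, sign_pos hpos]
    by_cases hall : ∀ i, 0 < minor v i
    · rw [if_pos hall, if_pos]
      · simp
      · obtain ⟨α, hα⟩ := hex
        refine ⟨α, fun i => ?_, hα⟩
        have := hrel α hα i
        have h3 := hall i.castSucc
        nlinarith
    · rw [if_neg hall, if_neg]
      · simp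
      · rintro ⟨α, hα, hv⟩
        apply hall
        intro i
        refine Fin.lastCases hpos (fun i => ?_) i
        rw [hrel α hv i]
        nlinarith [hα i]

lemma commonSign_congr {m : ℕ} (a b : Fin m → K)
    (h : ∀ i, SignType.sign (a i) = SignType.sign (b i)) : commonSign a = commonSign b := by
  have h1 : ∀ i, 0 < a i ↔ 0 < b i := fun i => by rw [← sign_eq_one_iff, h, sign_eq_one_iff]
  have h2 : ∀ i, a i < 0 ↔ b i < 0 := fun i => by
    rw [← sign_eq_neg_one_iff, h, sign_eq_neg_one_iff]
  simp [commonSign, h1, h2]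

lemma commonSign_neg {m : ℕ} (a : Fin (m + 1) → K) : commonSign (-a) = - commonSign a := by
  simp only [commonSign, Pi.neg_apply, Left.neg_pos_iff, Left.neg_neg_iff]
  split_ifs with h1 h2 <;> try rfl
  exact absurd (h2 0) (h1 0).not_gt

lemma degree_perm (v : Fin (n + 1) → Fin n → K) (t : Equiv.Perm (Fin (n + 1))) :
    degree (v ∘ t) = ((Equiv.Perm.sign t : ℤˣ) : ℤ) * degree v := by
  have hcomp : ∀ a : Fin (n + 1) → K, commonSign (a ∘ t) = commonSign a := by
    intro a
    have h1 : (∀ i, 0 < (a ∘ t) i) ↔ ∀ i, 0 < a i := t.forall_congr_right (q := fun i => 0 < a i)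
    have h2 : (∀ i, (a ∘ t) i < 0) ↔ ∀ i, a i < 0 := t.forall_congr_right (q := fun i => a i < 0)
    simp only [commonSign, h1, h2]
  rw [degree_eq, degree_eq]
  rcases Int.units_eq_one_or (Equiv.Perm.sign t) with h | h
  · have : minor (v ∘ t) = minor v ∘ t := by
      ext i
      simp [minor_perm, h]
    rw [this, hcomp, h]
    simp
  · have : minor (v ∘ t) = - (minor v ∘ t) := by
      ext i
      simp [minor_perm, h]
    rw [this, commonSign_neg, hcomp, h]
    simp

lemma degree_degenerate (v : Fin (n + 1) → Fin n → K) (h : ¬ Function.Injective v) :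
    degree v = 0 := by
  simp only [Function.Injective, not_forall] at h
  obtain ⟨a, b, hab, hne⟩ := h
  have : v ∘ Equiv.swap a b = v := by
    funext i
    rw [Function.comp_apply, Equiv.swap_apply_def]
    split_ifs with h1 h2
    · rw [h1, hab]
    · rw [h2, hab]
    · rfl
  have h := degree_perm v (Equiv.swap a b)
  rw [this, Equiv.Perm.sign_swap hne] at h
  simp at h
  lia

lemma degree_smul (v : Fin (n + 1) → Fin n → K) (c : Fin (n + 1) → K) (hc : ∀ i, 0 < c i) :
    degree (fun i => c i • v i) = degree v := by
  rw [degree_eq, degree_eq]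
  congr 1
  apply commonSign_congr
  intro i
  have : minor (fun i => c i • v i) i = (∏ r, c (i.succAbove r)) * minor v i := by
    have h := Matrix.det_mul_column (fun r : Fin n => c (i.succAbove r))
      (Matrix.of fun r : Fin n => v (i.succAbove r))
    rw [minor, minor, mul_left_comm, ← h]
    rfl
  rw [this, sign_mul, sign_pos (Finset.prod_pos fun r _ => hc _), one_mul]

lemma degree_mulVec (v : Fin (n + 1) → Fin n → K) (A : Matrix (Fin n) (Fin n) K)
    (hA : 0 < A.det) : degree (fun i => A *ᵥ v i) = degree v := by
  rw [degree_eq, degree_eq]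
  congr 1
  apply commonSign_congr
  intro i
  have : minor (fun i => A *ᵥ v i) i = A.det * minor v i := by
    have h : (Matrix.of fun r : Fin n => A *ᵥ v (i.succAbove r)) =
        (Matrix.of fun r : Fin n => v (i.succAbove r)) * Aᵀ := by
      ext r s
      simp [Matrix.mul_apply, Matrix.mulVec, dotProduct, mul_comm]
    rw [minor, minor, h, Matrix.det_mul, Matrix.det_transpose]
    ring
  rw [this, sign_mul, sign_pos hA, one_mul]

lemma sum_extremal_sign {m : ℕ} (a t : Fin (m + 1) → K) (ha : ∀ i, a i ≠ 0)
    (ht : Function.Injective t) :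
    ∑ i, (if ∀ l, l ≠ i → 0 < a l * (t i - t l) then (SignType.sign (a i) : ℤ) else 0) =
      commonSign a := by
  classical
  -- `C i` holds for at most one index with `a i > 0` and at most one with `a i < 0`
  have hP : ∀ i l, (∀ l, l ≠ i → 0 < a l * (t i - t l)) → 0 < a l → t l ≤ t i := by
    intro i l h hl
    by_cases hli : l = i
    · rw [hli]
    · have := h l hli
      exact (sub_pos.1 (pos_of_mul_pos_right this hl.le)).le
  have hN : ∀ i l, (∀ l, l ≠ i → 0 < a l * (t i - t l)) → a l < 0 → t i ≤ t l := by
    intro i l h hl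
    by_cases hli : l = i
    · rw [hli]
    · have := h l hli
      nlinarith
  have hC : ∀ i, (∀ l, 0 < a l → t l ≤ t i) → (∀ l, a l < 0 → t i ≤ t l) →
      ∀ l, l ≠ i → 0 < a l * (t i - t l) := by
    intro i h1 h2 l hl
    have hne : t l ≠ t i := fun h => hl (ht h)
    rcases lt_or_gt_of_ne (ha l) with h | h
    · exact mul_pos_of_neg_of_neg h (sub_neg.2 (lt_of_le_of_ne (h2 l h) hne.symm))
    · exact mul_pos h (sub_pos.2 (lt_of_le_of_ne (h1 l h) hne))
  by_cases hpos : ∀ i, 0 < a i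
  · obtain ⟨p, -, hp⟩ := Finset.exists_max_image Finset.univ t ⟨0, Finset.mem_univ _⟩
    rw [commonSign, if_pos hpos, Finset.sum_eq_single p, if_pos, sign_pos (hpos p)]
    · rfl
    · exact hC p (fun l _ => hp l (Finset.mem_univ _)) fun l hl => absurd hl (hpos l).not_gt
    · intro i _ hip
      rw [if_neg]
      intro h
      exact hip (ht (le_antisymm (hp i (Finset.mem_univ _)) (hP i p h (hpos p))))
    · simp
  by_cases hneg : ∀ i, a i < 0
  · obtain ⟨q, -, hq⟩ := Finset.exists_min_image Finset.univ t ⟨0, Finset.mem_univ _⟩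
    rw [commonSign, if_neg hpos, if_pos hneg, Finset.sum_eq_single q, if_pos, sign_neg (hneg q)]
    · rfl
    · exact hC q (fun l hl => absurd hl (hneg l).not_gt) fun l _ => hq l (Finset.mem_univ _)
    · intro i _ hiq
      rw [if_neg]
      intro h
      exact hiq (ht (le_antisymm (hN i q h (hneg q)) (hq i (Finset.mem_univ _))))
    · simp
  rw [commonSign, if_neg hpos, if_neg hneg]
  simp only [not_forall, not_lt] at hpos hneg
  obtain ⟨q₀, hq₀⟩ := hpos
  obtain ⟨p₀, hp₀⟩ := hneg
  obtain ⟨p, hpP, hp⟩ := Finset.exists_max_image (Finset.univ.filter fun i => 0 < a i) t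
    ⟨p₀, by simpa using lt_of_le_of_ne hp₀ (ha p₀).symm⟩
  obtain ⟨q, hqN, hq⟩ := Finset.exists_min_image (Finset.univ.filter fun i => a i < 0) t
    ⟨q₀, by simpa using lt_of_le_of_ne hq₀ (ha q₀)⟩
  simp only [Finset.mem_filter, Finset.mem_univ, true_and] at hpP hp hqN hq
  have hpq : p ≠ q := by
    rintro rfl
    exact hpP.not_gt hqN
  by_cases hlt : t p ≤ t q
  · have hother : ∀ i ∈ Finset.univ, i ∉ ({p, q} : Finset (Fin (m + 1))) →
        (if ∀ l, l ≠ i → 0 < a l * (t i - t l) then (SignType.sign (a i) : ℤ) else 0) = 0 := by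
      intro i _ hi
      rw [if_neg]
      intro h
      apply hi
      rw [Finset.mem_insert, Finset.mem_singleton]
      rcases lt_or_gt_of_ne (ha i) with h' | h'
      · exact Or.inr (ht (le_antisymm (hN i q h hqN) (hq i h')))
      · exact Or.inl (ht (le_antisymm (hp i h') (hP i p h hpP)))
    rw [← Finset.sum_subset (Finset.subset_univ ({p, q} : Finset (Fin (m + 1)))) hother,
      Finset.sum_pair hpq, if_pos, if_pos, sign_pos hpP, sign_neg hqN]
    · rfl
    · exact hC q (fun l hl => (hp l hl).trans hlt) hq
    · exact hC p hp (fun l hl => hlt.trans (hq l hl))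
  · apply Finset.sum_eq_zero
    intro i _
    rw [if_neg]
    intro h
    exact hlt ((hP i p h hpP).trans (hN i q h hqN))

/-- The degree is a cocycle on generic tuples. -/
lemma degree_cocycle (w : Fin (n + 2) → Fin n → K)
    (hw : ∀ e : Fin n → Fin (n + 2), Function.Injective e →
      LinearIndependent K fun r => w (e r)) :
    ∑ j : Fin (n + 2), (-1 : ℤ) ^ (j : ℕ) • degree (w ∘ j.succAbove) = 0 := by
  classical
  have hdet : ∀ e : Fin n → Fin (n + 2), Function.Injective e →
      (Matrix.of fun r => w (e r)).det ≠ 0 := fun e he => by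
    have := Matrix.linearIndependent_rows_iff_isUnit.1 (hw e he)
    exact ((Matrix.isUnit_iff_isUnit_det _).1 this).ne_zero
  let v : Fin (n + 1) → Fin n → K := fun i => w i.succ
  let a : Fin (n + 1) → K := minor v
  have ha : ∀ i, a i ≠ 0 := fun i => mul_ne_zero (pow_ne_zero _ (by simp))
    (hdet (fun r => (i.succAbove r).succ)
      ((Fin.succ_injective _).comp Fin.succAbove_right_injective))
  -- a relation expressing `-w₀` through `v`
  obtain ⟨x, hx⟩ : ∃ x : Fin (n + 1) → K, w 0 + ∑ l, x l • v l = 0 := by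
    have h := minor_relation (Fin.cons (w 0) fun r : Fin n => v r.castSucc :
      Fin (n + 1) → Fin n → K)
    rw [Fin.sum_univ_succ] at h
    simp only [Fin.cons_zero, Fin.cons_succ] at h
    set b := minor (Fin.cons (w 0) fun r : Fin n => v r.castSucc : Fin (n + 1) → Fin n → K)
    have hb : b 0 ≠ 0 := by
      refine mul_ne_zero (by simp) ?_
      have := hdet (fun r : Fin n => r.castSucc.succ)
        ((Fin.succ_injective _).comp (Fin.castSucc_injective _))
      simpa [v] using this
    refine ⟨Fin.snoc (fun r => (b 0)⁻¹ * b r.succ) 0, ?_⟩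
    rw [Fin.sum_univ_castSucc]
    simp only [Fin.snoc_castSucc, Fin.snoc_last, zero_smul, add_zero]
    have h' := congrArg (fun y => (b 0)⁻¹ • y) h
    simpa [smul_add, inv_smul_smul₀ hb, Finset.smul_sum, smul_smul] using h'
  let t : Fin (n + 1) → K := fun i => - x i / a i
  have hxt : ∀ i l, x l + t i * a l = a l * (t i - t l) := by
    intro i l
    have := ha l
    simp only [t]
    field_simp
    ring
  have hrel : ∀ i, w 0 + ∑ r : Fin n, (a (i.succAbove r) * (t i - t (i.succAbove r))) •
      v (i.succAbove r) = 0 := by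
    intro i
    have h : w 0 + ∑ l, (x l + t i * a l) • v l = 0 := by
      have h2 : t i • ∑ l, a l • v l = 0 := by rw [minor_relation, smul_zero]
      rw [Finset.smul_sum] at h2
      simp only [smul_smul] at h2
      simp only [add_smul, Finset.sum_add_distrib]
      rw [h2, add_zero, hx]
    rw [Fin.sum_univ_succAbove _ i] at h
    simpa [hxt] using h
  have ht : Function.Injective t := by
    intro i l hil
    by_contra hne
    obtain ⟨s, hs⟩ := Fin.exists_succAbove_eq (Ne.symm hne)
    -- `w₀` together with the vectors other than `v_i, v_l` is dependent
    let e : Fin n → Fin (n + 2) := Function.update (fun r => (i.succAbove r).succ) s 0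
    have he : Function.Injective e := by
      intro r r' hrr
      simp only [e, Function.update_apply] at hrr
      split_ifs at hrr with h1 h2 h2
      · rw [h1, h2]
      · exact absurd hrr.symm (Fin.succ_ne_zero _)
      · exact absurd hrr (Fin.succ_ne_zero _)
      · exact Fin.succAbove_right_injective (Fin.succ_injective _ hrr)
    have hli := Fintype.linearIndependent_iff.1 (hw e he)
      (Function.update (fun r => a (i.succAbove r) * (t i - t (i.succAbove r))) s 1) (by
        have h := hrel i
        rw [← Finset.add_sum_erase _ _ (Finset.mem_univ s), hs, hil, sub_self, mul_zero, zero_smul,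
          zero_add] at h
        rw [← Finset.add_sum_erase _ _ (Finset.mem_univ s)]
        simp only [e, Function.update_self, one_smul]
        rw [← h, hil]
        congr 1
        refine Finset.sum_congr rfl fun r hr => ?_
        have hrs : r ≠ s := (Finset.mem_erase.1 hr).1
        rw [Function.update_of_ne hrs, Function.update_of_ne hrs])
    have := hli s
    simp at this
  have hterm : ∀ i : Fin (n + 1), degree (w ∘ i.succ.succAbove) = (-1) ^ n * ((-1) ^ (i : ℕ) *
      (if ∀ l, l ≠ i → 0 < a l * (t i - t l) then (SignType.sign (a i) : ℤ) else 0)) := by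
    intro i
    set y : Fin (n + 1) → Fin n → K := w ∘ i.succ.succAbove with hy
    have hy0 : y 0 = w 0 := by simp [y]
    have hys : ∀ r : Fin n, y r.succ = v (i.succAbove r) := fun r => by simp [y, v]
    have hm0 : minor y 0 = (-1) ^ (i : ℕ) * a i := by
      have hsq : ((-1 : K) ^ (i : ℕ)) * ((-1) ^ (i : ℕ)) = 1 := by rw [← mul_pow]; simp
      simp only [a, minor, Fin.val_zero, pow_zero, one_mul, Fin.zero_succAbove, hys]
      rw [← mul_assoc, hsq, one_mul]
    have hm0' : minor y 0 ≠ 0 := by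
      rw [hm0]
      exact mul_ne_zero (pow_ne_zero _ (by simp)) (ha i)
    have hms : ∀ r : Fin n, minor y r.succ =
        (a (i.succAbove r) * (t i - t (i.succAbove r))) * minor y 0 := by
      intro r
      have := minor_of_relation y 0 hm0'
        (Fin.cons 1 fun r => a (i.succAbove r) * (t i - t (i.succAbove r))) (by
          rw [Fin.sum_univ_succ]
          simpa [hy0, hys] using hrel i) r.succ
      simp only [Fin.cons_succ, Fin.cons_zero, one_mul] at this
      rw [← this]
    have hiff : (∀ l, l ≠ i → 0 < a l * (t i - t l)) ↔
        ∀ r : Fin n, 0 < a (i.succAbove r) * (t i - t (i.succAbove r)) := by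
      constructor
      · intro h r
        exact h _ (Fin.succAbove_ne i r)
      · intro h l hl
        obtain ⟨r, rfl⟩ := Fin.exists_succAbove_eq hl
        exact h r
    have hcs : commonSign (minor y) = (if ∀ l, l ≠ i → 0 < a l * (t i - t l) then
        (SignType.sign (minor y 0) : ℤ) else 0) := by
      rw [commonSign]
      rcases lt_or_gt_of_ne hm0' with hneg | hpos
      · rw [if_neg fun h => (h 0).not_gt hneg, sign_neg hneg]
        have : (∀ r, minor y r < 0) ↔ ∀ l, l ≠ i → 0 < a l * (t i - t l) := by
          rw [Fin.forall_fin_succ, hiff]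
          simp only [hneg, true_and, hms]
          refine forall_congr' fun r => ?_
          constructor
          · intro h; nlinarith
          · intro h; exact mul_neg_of_pos_of_neg h hneg
        simp only [this]
        rfl
      · rw [sign_pos hpos]
        have h2 : ¬ ∀ r, minor y r < 0 := fun h => (h 0).not_gt hpos
        have : (∀ r, 0 < minor y r) ↔ ∀ l, l ≠ i → 0 < a l * (t i - t l) := by
          rw [Fin.forall_fin_succ, hiff]
          simp only [hpos, true_and, hms]
          exact forall_congr' fun r => mul_pos_iff_of_pos_right hpos
        simp only [this, if_neg h2]
        rfl
    rw [degree_eq, hcs, hm0]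
    have : (SignType.sign ((-1 : K) ^ (i : ℕ) * a i) : ℤ) =
        (-1) ^ (i : ℕ) * (SignType.sign (a i) : ℤ) := by
      rw [sign_mul, sign_pow, Left.sign_neg, sign_one]
      simp
    rw [this]
    split_ifs <;> simp
  have hsum := sum_extremal_sign a t ha ht
  rw [Fin.sum_univ_succ]
  have h0 : degree (w ∘ (0 : Fin (n + 2)).succAbove) = (-1) ^ n * commonSign a := degree_eq v
  simp only [hterm, h0, ← hsum, Fin.val_zero, pow_zero, one_mul, Fin.val_succ, smul_eq_mul]
  rw [Finset.mul_sum, ← Finset.sum_add_distrib]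
  refine Finset.sum_eq_zero fun i _ => ?_
  have hsq : ((-1 : ℤ) ^ (i : ℕ)) * ((-1) ^ (i : ℕ)) = 1 := by rw [← mul_pow]; simp
  rw [pow_succ]
  generalize (if ∀ l, l ≠ i → 0 < a l * (t i - t l) then (SignType.sign (a i) : ℤ) else 0) = q
  linear_combination (-(-1) ^ n * q) * hsq

end Degree

/-! ### The complex of generic tuples of rays, and the Euler class -/

section Rays

variable (n : ℕ) (K : Type u) [Field K] [LinearOrder K] [IsStrictOrderedRing K]

/-- The complex `X_+` of generic tuples of points of `P_+^{n-1}(K) = (Kⁿ ∖ 0)/K_+`: finitely many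
rays span a simplex if any at most `n` of them are linearly independent. -/
def genericRays : AbstractSimplicialComplex (Module.Ray K (Fin n → K)) where
  faces := {s | s.Nonempty ∧
    ∀ t ⊆ s, t.card ≤ n → LinearIndepOn K Module.Ray.someVector (t : Set (Module.Ray K (Fin n → K)))}
  isRelLowerSet_faces := fun s hs => ⟨hs.1, fun t hts ht =>
    ⟨ht, fun u hu hc => hs.2 u (hu.trans hts) hc⟩⟩
  singleton_mem := fun v => ⟨Finset.singleton_nonempty v, fun t ht _ => by
    refine LinearIndepOn.mono ?_ (Finset.coe_subset.2 ht)
    rw [Finset.coe_singleton]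
    exact linearIndepOn_singleton_iff K |>.2 v.someVector_ne_zero⟩

/-- The normal subgroup of positive multiples of the identity. -/
def posScalars : Subgroup GL(n, K)⁺ where
  carrier := {g | ∃ c : K, 0 < c ∧ ((g : GL (Fin n) K) : Matrix (Fin n) (Fin n) K) = c • 1}
  mul_mem' := by
    rintro g h ⟨c, hc, hg⟩ ⟨d, hd, hh⟩
    refine ⟨c * d, mul_pos hc hd, ?_⟩
    rw [Subgroup.coe_mul, Units.val_mul, hg, hh, smul_mul_smul_comm, one_mul]
  one_mem' := ⟨1, one_pos, by simp⟩
  inv_mem' := by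
    rintro g ⟨c, hc, hg⟩
    refine ⟨c⁻¹, inv_pos.2 hc, ?_⟩
    rw [Subgroup.coe_inv]
    refine Units.inv_eq_of_mul_eq_one_right ?_
    rw [hg]
    rw [smul_mul_smul_comm, one_mul, mul_inv_cancel₀ hc.ne', one_smul]

instance : (posScalars n K).Normal where
  conj_mem := by
    rintro g ⟨c, hc, hg⟩ h
    refine ⟨c, hc, ?_⟩
    rw [Subgroup.coe_mul, Subgroup.coe_mul, Units.val_mul, Units.val_mul, hg]
    rw [Matrix.mul_smul, Matrix.mul_one, Matrix.smul_mul, Subgroup.coe_inv, Units.mul_inv]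

/-- The group `P_+GL_+(n,K) = GL_+(n,K)/K_+`. -/
abbrev PPosGL : Type u := GL(n, K)⁺ ⧸ posScalars n K

/-- The action of `GL_+(n,K)` on rays. -/
def rayAction : GL(n, K)⁺ →* Equiv.Perm (Module.Ray K (Fin n → K)) :=
  (MulAction.toPermHom (LinearMap.GeneralLinearGroup K (Fin n → K))
    (Module.Ray K (Fin n → K))).comp
    (Matrix.GeneralLinearGroup.toLin.toMonoidHom.comp (GL(n, K)⁺).subtype)

variable {n K}

lemma rayAction_rayOfNeZero (g : GL(n, K)⁺) (v : Fin n → K) (hv : v ≠ 0)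
    (hgv : ((g : GL (Fin n) K) : Matrix (Fin n) (Fin n) K) *ᵥ v ≠ 0) :
    rayAction n K g (rayOfNeZero K v hv) = rayOfNeZero K _ hgv := rfl

lemma mulVec_ne_zero (g : GL(n, K)⁺) (v : Fin n → K) (hv : v ≠ 0) :
    ((g : GL (Fin n) K) : Matrix (Fin n) (Fin n) K) *ᵥ v ≠ 0 := by
  intro h
  apply hv
  have := congrArg (fun w => (((g : GL (Fin n) K)⁻¹ : GL (Fin n) K) :
    Matrix (Fin n) (Fin n) K) *ᵥ w) h
  simpa [Matrix.mulVec_mulVec, ← Units.val_mul] using this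

lemma someVector_rayAction (g : GL(n, K)⁺) (r : Module.Ray K (Fin n → K)) :
    ∃ c : K, 0 < c ∧ (rayAction n K g r).someVector =
      c • (((g : GL (Fin n) K) : Matrix (Fin n) (Fin n) K) *ᵥ r.someVector) := by
  have h0 := mulVec_ne_zero g _ r.someVector_ne_zero
  have h : rayOfNeZero K _ h0 =
      rayOfNeZero K _ (rayAction n K g r).someVector_ne_zero := by
    rw [Module.Ray.someVector_ray, ← rayAction_rayOfNeZero g r.someVector r.someVector_ne_zero,
      Module.Ray.someVector_ray]
  rw [ray_eq_iff] at h
  obtain ⟨c, hc, h⟩ := h.exists_pos_left h0 (Module.Ray.someVector_ne_zero _)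
  exact ⟨c, hc, h.symm⟩

variable (n K)

instance : MulAction (PPosGL n K) (Module.Ray K (Fin n → K)) :=
  MulAction.compHom _ (QuotientGroup.lift (posScalars n K) (rayAction n K) (by
    rintro g ⟨c, hc, hg⟩
    ext r
    induction r using Module.Ray.ind with
    | h v hv =>
      rw [rayAction_rayOfNeZero g v hv (mulVec_ne_zero g v hv)]
      change _ = rayOfNeZero K v hv
      rw [ray_eq_iff, hg, Matrix.smul_mulVec, Matrix.one_mulVec]
      exact SameRay.sameRay_pos_smul_left v hc))

variable {n K}

lemma mk_smul_ray (g : GL(n, K)⁺) (r : Module.Ray K (Fin n → K)) :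
    (g : PPosGL n K) • r = rayAction n K g r := rfl

lemma someVector_smul (g : PPosGL n K) : ∃ A : Matrix (Fin n) (Fin n) K, 0 < A.det ∧
    ∀ r : Module.Ray K (Fin n → K), ∃ c : K, 0 < c ∧
      (g • r).someVector = c • (A *ᵥ r.someVector) := by
  induction g using QuotientGroup.induction_on with
  | H g => exact ⟨_, g.2, someVector_rayAction g⟩

lemma linearIndepOn_smul (g : PPosGL n K) (s : Set (Module.Ray K (Fin n → K)))
    (hs : LinearIndepOn K Module.Ray.someVector s) :
    LinearIndepOn K Module.Ray.someVector ((fun r => g • r) '' s) := by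
  obtain ⟨A, hA, h⟩ := someVector_smul g
  choose c hc h using h
  have hinj : Function.Injective (Matrix.mulVecLin A) :=
    Matrix.mulVec_injective_iff_isUnit.2 ((Matrix.isUnit_iff_isUnit_det _).2 hA.ne'.isUnit)
  have h1 : LinearIndependent K fun r : s => A *ᵥ r.1.someVector :=
    hs.linearIndependent.map' (Matrix.mulVecLin A) (LinearMap.ker_eq_bot.2 hinj)
  have h2 := h1.units_smul fun r => Units.mk0 (c r) (hc r).ne'
  have h3 : LinearIndependent K fun r : s => (g • r.1).someVector := by
    convert h2 using 2 with r
    exact h r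
  let e : s ≃ ((fun r => g • r) '' s) := Equiv.Set.image _ s (MulAction.injective g)
  exact (linearIndependent_equiv e).1 h3

instance : IsSimplicialAction (genericRays n K) (PPosGL n K) where
  spans_smul := by
    classical
    rintro g _ ⟨s, hs, rfl⟩
    refine ⟨s.image fun r => g • r, ⟨hs.1.image _, fun t ht hc => ?_⟩, by simp⟩
    obtain ⟨t', ht', rfl⟩ := Finset.subset_image_iff.1 ht
    rw [Finset.card_image_of_injective _ (MulAction.injective g)] at hc
    rw [Finset.coe_image]
    exact linearIndepOn_smul g _ (hs.2 t' ht' hc)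

/-- `X_+` has the star property, since an ordered field is infinite. -/
lemma starProperty_genericRays (hn : 0 < n) : StarProperty (genericRays n K) := by
  classical
  intro F hF hFX
  have hT : (⋃ s ∈ F, s).Finite := hF.biUnion fun s hs => by
    obtain ⟨t, -, rfl⟩ := hFX s hs
    exact t.finite_toSet
  let P : Finset (Finset (Module.Ray K (Fin n → K))) :=
    hT.toFinset.powerset.filter fun t => t.card < n
  let W : Finset (Module.Ray K (Fin n → K)) → Submodule K (Fin n → K) := fun t =>
    Submodule.span K (Module.Ray.someVector '' (t : Set (Module.Ray K (Fin n → K))))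
  obtain ⟨v, hv⟩ : ∃ v : Fin n → K, ∀ t ∈ P, v ∉ W t := by
    have hne : (⊤ : Submodule K (Fin n → K)) ∉ P.image W := by
      intro h
      obtain ⟨t, ht, htop⟩ := Finset.mem_image.1 h
      have hc : t.card < n := (Finset.mem_filter.1 ht).2
      have h1 := finrank_span_finset_le_card (R := K) (t.image Module.Ray.someVector)
      rw [Set.finrank, Finset.coe_image, show Submodule.span K (Module.Ray.someVector ''
        (t : Set (Module.Ray K (Fin n → K)))) = ⊤ from htop, finrank_top,
        Module.finrank_fin_fun] at h1
      exact absurd (h1.trans Finset.card_image_le) hc.not_ge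
    have h2 := Subspace.biUnion_ne_univ_of_top_notMem hne
    rw [Set.ne_univ_iff_exists_notMem] at h2
    obtain ⟨v, hv⟩ := h2
    refine ⟨v, fun t ht hvt => hv ?_⟩
    exact Set.mem_biUnion (Finset.mem_image_of_mem W ht) hvt
  have hv0 : v ≠ 0 := by
    rintro rfl
    exact hv ∅ (by simp [P, hn]) (Submodule.zero_mem _)
  let r : Module.Ray K (Fin n → K) := rayOfNeZero K v hv0
  have hr : ∀ t ∈ P, r.someVector ∉ W t := by
    intro t ht h
    have hray := Module.Ray.someVector_ray r
    rw [ray_eq_iff] at hray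
    obtain ⟨c, hc, h'⟩ := hray.exists_pos_left r.someVector_ne_zero hv0
    exact hv t ht (h' ▸ Submodule.smul_mem _ c h)
  refine ⟨r, fun s hs => ?_⟩
  obtain ⟨s', hs', rfl⟩ := hFX s hs
  refine ⟨insert r s', ⟨Finset.insert_nonempty _ _, fun t ht hc => ?_⟩, by simp⟩
  by_cases hrt : r ∈ t
  · have hsub : t.erase r ⊆ s' := by
      intro x hx
      rw [Finset.mem_erase] at hx
      exact (Finset.mem_insert.1 (ht hx.2)).resolve_left hx.1
    have hcard : (t.erase r).card < n := lt_of_lt_of_le (Finset.card_erase_lt_of_mem hrt) hc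
    rw [← Finset.insert_erase hrt, Finset.coe_insert,
      linearIndepOn_insert (by simp)]
    refine ⟨hs'.2 _ hsub hcard.le, hr _ ?_⟩
    refine Finset.mem_filter.2 ⟨Finset.mem_powerset.2 fun x hx => ?_, hcard⟩
    rw [Set.Finite.mem_toFinset]
    exact Set.mem_biUnion hs (hsub hx)
  · refine hs'.2 t (fun x hx => (Finset.mem_insert.1 (ht hx)).resolve_left ?_) hc
    rintro rfl
    exact hrt hx

/-- The component `T_0 : U_+ → ℤ` of the tautological cocycle along the generator `0⁺` of
`U_+ = ⊕ ℤ k⁺`, `0 ≤ k ≤ ⌊n/2⌋`. On a generic simplex `[v₁, …, v_{n+1}]` it is the sign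
of `det(v₁, …, v_n)` if `v_{n+1}` is a combination of `v₁, …, v_n` with negative coefficients, and
`0` otherwise. -/
def eulerCoeff : TautCoeff (genericRays n K) (PPosGL n K) n →ₗ[ℤ] ℤ :=
  Submodule.liftQ _
    (OrientedChain.lift (fun σ => degree fun i => (σ.vertex i).someVector)
      (fun σ t => by
        rw [smul_eq_mul]
        exact degree_perm (fun i => (σ.vertex i).someVector) t)
      (fun σ h => degree_degenerate _ fun h' => h fun i j hij =>
        h' (congrArg Module.Ray.someVector hij)))
    (by
      rw [sup_le_iff]
      constructor
      · rw [LinearMap.range_le_ker_iff]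
        apply OrientedChain.hom_ext
        intro σ
        rw [LinearMap.comp_apply, LinearMap.zero_apply]
        by_cases hinj : Function.Injective σ.vertex
        · rw [boundary_oriented, map_sum]
          simp only [map_smul, OrientedChain.lift_oriented]
          refine degree_cocycle (fun i => (σ.vertex i).someVector) fun e he => ?_
          obtain ⟨s, hs, hsr⟩ := σ.spans
          classical
          have hvi : Function.Injective fun r => σ.vertex (e r) := hinj.comp he
          have h := hs.2 (Finset.univ.image fun r => σ.vertex (e r)) (by
            intro x hx
            obtain ⟨r, -, rfl⟩ := Finset.mem_image.1 hx
            rw [← Finset.mem_coe, hsr]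
            exact ⟨_, rfl⟩) (by
            rw [Finset.card_image_of_injective _ hvi]
            simp)
          rw [Finset.coe_image, Finset.coe_univ, Set.image_univ] at h
          exact h.comp (fun r => ⟨σ.vertex (e r), r, rfl⟩)
            fun a b hab => hvi (congrArg Subtype.val hab)
        · rw [oriented_degenerate _ σ hinj, map_zero, map_zero]
      · rw [Submodule.span_le]
        rintro _ ⟨g, x, rfl⟩
        rw [SetLike.mem_coe, LinearMap.mem_ker, map_sub, sub_eq_zero, ← LinearMap.comp_apply]
        refine LinearMap.congr_fun (OrientedChain.hom_ext fun σ => ?_) x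
        rw [LinearMap.comp_apply, translate_oriented, OrientedChain.lift_oriented,
          OrientedChain.lift_oriented]
        obtain ⟨A, hA, h⟩ := someVector_smul g
        choose c hc h using h
        rw [← degree_mulVec (fun i => (σ.vertex i).someVector) A hA,
          ← degree_smul (fun i => A *ᵥ (σ.vertex i).someVector) (fun i => c (σ.vertex i))
            fun i => hc _]
        exact congrArg degree (funext fun i => h (σ.vertex i)))

lemma eulerCoeff_oriented (σ : OrderedSimplex (genericRays n K) n) :
    eulerCoeff (tautologicalCocycle (genericRays n K) (PPosGL n K) n (oriented σ)) =
      degree fun i => (σ.vertex i).someVector := by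
  change Finsupp.linearCombination ℤ (fun τ : OrderedSimplex (genericRays n K) n =>
    degree fun i => (τ.vertex i).someVector) (Finsupp.single σ 1) = _
  simp

/-- The Euler class `eu_0 ∈ Hⁿ(P_+GL_+(n,K); ℤ)`: the component `T_0` of the tautological class of
the action of `P_+GL_+(n,K)` on `X_+`. -/
def eulerClass (hn : 0 < n) : (classifyingSpace (PPosGL n K)).Cohomology ℤ n :=
  (classifyingSpace (PPosGL n K)).coeffMap (eulerCoeff (n := n) (K := K)) n
    (tautologicalClass (genericRays n K) (PPosGL n K) (starProperty_genericRays hn) n)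

end Rays

/-! ### Flat bundles over simplicial complexes -/

section Bundles

variable {V : Type v}

/-- A nondegenerate `m`-simplex of `X` with its vertices listed in increasing order. -/
@[ext]
structure IncreasingSimplex (X : AbstractSimplicialComplex V) [PartialOrder V] (m : ℕ) :
    Type v where
  vertex : Fin (m + 1) → V
  strictMono : StrictMono vertex
  spans : Spans X (Set.range vertex)

/-- The simplices of `X` on which the order of the vertices is total, as a Δ-set. If the order is
total on each simplex, then these are all simplices, and one gets the usual simplicial chains,
cycles and cohomology of `X`. -/
def orderedDelta (X : AbstractSimplicialComplex V) [PartialOrder V] : DeltaSet.{v} where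
  simplex m := IncreasingSimplex X m
  face i σ := ⟨σ.vertex ∘ i.succAbove, σ.strictMono.comp (Fin.strictMono_succAbove i),
    σ.spans.mono (Set.range_comp_subset_range _ _) (Set.range_nonempty _)⟩
  face_face i j σ h := by
    ext l
    exact congrArg σ.vertex (succAbove_comm h l)

/-- A principal `G`-bundle over `X`, for a discrete group `G` (a flat `G`-bundle), given by its
transition functions with respect to the cover of `X` by the open stars of the vertices. The bundle
is trivial over each star; the stars of `x` and `y` meet iff `{x, y}` spans a simplex, and then the
intersection is connected, and the transition function is a constant `trans x y ∈ G`, taking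
coordinates in the trivialization over the star of `y` to coordinates in that over the star of
`x`. -/
structure FlatBundle (G : Type u) [Group G] (X : AbstractSimplicialComplex V) where
  trans : V → V → G
  cocycle : ∀ x y z : V, Spans X {x, y, z} → trans x y * trans y z = trans x z

namespace FlatBundle

variable {G : Type u} [Group G] {H : Type w} [Group H] {X : AbstractSimplicialComplex V}

/-- The bundle associated to a homomorphism of structure groups. -/
def map (φ : G →* H) (E : FlatBundle G X) : FlatBundle H X where
  trans x y := φ (E.trans x y)
  cocycle x y z h := by rw [← map_mul, E.cocycle x y z h]

/-- A classifying map `X → BG`. A simplex `(x₀, …, x_m)` goes to the `G`-orbit of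
`(g₀, …, g_m)`, where `gᵢ = trans x₀ xᵢ` is the coordinate, in the trivialization over the star of
`x₀`, of the unit of the trivialization over the star of `xᵢ`. -/
def classifyingMap [PartialOrder V] (E : FlatBundle G X) :
    DeltaSet.Hom (orderedDelta X) (classifyingSpace G) where
  toFun m σ := classifyingSpace.mk fun i => E.trans (σ.vertex 0) (σ.vertex i)
  map_face {m} i σ := by
    change (Quotient.mk'' _ : MulAction.orbitRel.Quotient G (Fin (m + 1) → G)) = Quotient.mk'' _
    rw [Quotient.eq'']
    refine ⟨E.trans (σ.vertex (i.succAbove 0)) (σ.vertex 0), ?_⟩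
    funext j
    exact E.cocycle _ _ _ (σ.spans.mono (by
      rintro x (rfl | rfl | rfl) <;> exact ⟨_, rfl⟩) ⟨_, Or.inl rfl⟩)

end FlatBundle

/-- The Euler class `eu_0(E) ∈ Hⁿ(X; ℤ)` of a `GL_+(n,K)`-bundle `E` over `X`: the pull-back of
`eu_0 ∈ Hⁿ(P_+GL_+(n,K); ℤ)` by a classifying map of the associated `P_+GL_+(n,K)`-bundle. -/
def eu0 {K : Type u} [Field K] [LinearOrder K] [IsStrictOrderedRing K] {n : ℕ} (hn : 0 < n)
    [PartialOrder V] {X : AbstractSimplicialComplex V} (E : FlatBundle GL(n, K)⁺ X) :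
    (orderedDelta X).Cohomology ℤ n :=
  (E.map (QuotientGroup.mk' (posScalars n K))).classifyingMap.pullback ℤ n (eulerClass hn)

end Bundles

/-! ### Products -/

section Products

variable {V : Type v} {V' : Type w} [LinearOrder V] [LinearOrder V']

/-- The standard triangulation of `X × X'`, for chosen total orders of the vertices of `X` and `X'`.
Its simplices are the chains (for the product order) of pairs of vertices that project to simplices
of `X` and of `X'`. -/
def stdProduct (X : AbstractSimplicialComplex V) (X' : AbstractSimplicialComplex V') :
    AbstractSimplicialComplex (V × V') where
  faces := {s | s.Nonempty ∧ IsChain (· ≤ ·) (s : Set (V × V')) ∧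
    Spans X (Prod.fst '' (s : Set (V × V'))) ∧ Spans X' (Prod.snd '' (s : Set (V × V')))}
  isRelLowerSet_faces := fun s hs => ⟨hs.1, fun t hts ht =>
    have hts' : (t : Set (V × V')) ⊆ s := Finset.coe_subset.2 hts
    ⟨ht, hs.2.1.mono hts',
      hs.2.2.1.mono (Set.image_mono hts') (Set.Nonempty.image _ ht),
      hs.2.2.2.mono (Set.image_mono hts') (Set.Nonempty.image _ ht)⟩⟩
  singleton_mem := fun v => ⟨Finset.singleton_nonempty v, by simp,
    ⟨{v.1}, X.singleton_mem _, by simp⟩, ⟨{v.2}, X'.singleton_mem _, by simp⟩⟩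

/-- Lattice paths from `(0,0)` to `(n,k)` with unit steps to the right or up. -/
@[ext]
structure LatticePath (n k : ℕ) where
  point : Fin (n + k + 1) → Fin (n + 1) × Fin (k + 1)
  start : point 0 = (0, 0)
  finish : point (Fin.last (n + k)) = (Fin.last n, Fin.last k)
  step : ∀ i : Fin (n + k),
    (((point i.succ).1 : ℕ) = (point i.castSucc).1 + 1 ∧ (point i.succ).2 = (point i.castSucc).2) ∨
    ((point i.succ).1 = (point i.castSucc).1 ∧ ((point i.succ).2 : ℕ) = (point i.castSucc).2 + 1)

namespace LatticePath

variable {n k : ℕ}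

instance : Fintype (LatticePath n k) :=
  Fintype.ofInjective LatticePath.point fun _ _ h => LatticePath.ext h

/-- The area under a path: the sum of the heights of its horizontal steps. -/
def area (γ : LatticePath n k) : ℕ :=
  ∑ i : Fin (n + k), if (γ.point i.succ).2 = (γ.point i.castSucc).2 then
    ((γ.point i.castSucc).2 : ℕ) else 0

lemma strictMono (γ : LatticePath n k) : StrictMono γ.point := by
  rw [Fin.strictMono_iff_lt_succ]
  intro i
  rw [Prod.lt_iff]
  rcases γ.step i with ⟨h1, h2⟩ | ⟨h1, h2⟩
  · exact Or.inl ⟨by rw [Fin.lt_def]; lia, h2.ge⟩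
  · exact Or.inr ⟨h1.ge, by rw [Fin.lt_def]; lia⟩

variable {X : AbstractSimplicialComplex V} {X' : AbstractSimplicialComplex V'}

/-- The top-dimensional simplex of the triangulation of `σ × σ'` corresponding to a path. -/
def simplex (γ : LatticePath n k) (σ : IncreasingSimplex X n) (σ' : IncreasingSimplex X' k) :
    IncreasingSimplex (stdProduct X X') (n + k) where
  vertex i := (σ.vertex (γ.point i).1, σ'.vertex (γ.point i).2)
  strictMono := by
    have h : StrictMono (Prod.map σ.vertex σ'.vertex) := by
      rintro ⟨a, a'⟩ ⟨b, b'⟩ hab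
      rw [Prod.lt_iff] at hab ⊢
      rcases hab with ⟨h, h'⟩ | ⟨h, h'⟩
      · exact Or.inl ⟨σ.strictMono h, σ'.strictMono.monotone h'⟩
      · exact Or.inr ⟨σ.strictMono.monotone h, σ'.strictMono h'⟩
    exact h.comp γ.strictMono
  spans := by
    classical
    let f : Fin (n + k + 1) → V × V' := fun i => (σ.vertex (γ.point i).1, σ'.vertex (γ.point i).2)
    have hf : Monotone f := fun i j hij =>
      ⟨σ.strictMono.monotone (γ.strictMono.monotone hij).1,
        σ'.strictMono.monotone (γ.strictMono.monotone hij).2⟩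
    refine ⟨Finset.univ.image f, ⟨⟨f 0, Finset.mem_image_of_mem _ (Finset.mem_univ _)⟩, ?_, ?_, ?_⟩,
      by simp [f]⟩
    · rw [Finset.coe_image, Finset.coe_univ, Set.image_univ]
      exact hf.isChain_range
    · refine σ.spans.mono ?_ ⟨(f 0).1, f 0, by simp, rfl⟩
      rintro _ ⟨_, h, rfl⟩
      obtain ⟨i, -, rfl⟩ := Finset.mem_image.1 h
      exact ⟨_, rfl⟩
    · refine σ'.spans.mono ?_ ⟨(f 0).2, f 0, by simp, rfl⟩
      rintro _ ⟨_, h, rfl⟩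
      obtain ⟨i, -, rfl⟩ := Finset.mem_image.1 h
      exact ⟨_, rfl⟩

end LatticePath

/-- The cross product `z × z' = ∑ n_σ n_σ' (σ × σ')`, where `σ × σ' = ∑ (-1)^{area γ} σ_γ` is the
chain of the standard subdivision of the product of simplices, summed over lattice paths `γ`. -/
def cross {X : AbstractSimplicialComplex V} {X' : AbstractSimplicialComplex V'} {n k : ℕ}
    (z : (orderedDelta X).Chain n) (z' : (orderedDelta X').Chain k) :
    (orderedDelta (stdProduct X X')).Chain (n + k) :=
  z.sum fun σ r => z'.sum fun σ' r' => ∑ γ : LatticePath n k,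
    Finsupp.single (γ.simplex σ σ') (r * r' * (-1) ^ γ.area)

variable {G : Type u} [Group G] {G' : Type*} [Group G'] in
/-- The exterior product `E × E'` over `X × X'`, a bundle with group `G × G'`. -/
def FlatBundle.prod {X : AbstractSimplicialComplex V} {X' : AbstractSimplicialComplex V'}
    (E : FlatBundle G X) (E' : FlatBundle G' X') : FlatBundle (G × G') (stdProduct X X') where
  trans x y := (E.trans x.1 y.1, E'.trans x.2 y.2)
  cocycle := by
    rintro x y z ⟨s, hs, h⟩
    have h1 := hs.2.2.1
    have h2 := hs.2.2.2
    rw [h] at h1 h2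
    refine Prod.ext (E.cocycle _ _ _ ?_) (E'.cocycle _ _ _ ?_)
    · simpa [Set.image_insert_eq] using h1
    · simpa [Set.image_insert_eq] using h2

end Products

section Block

variable {K : Type u} [Field K] [LinearOrder K] [IsStrictOrderedRing K] (n k : ℕ)

/-- Block diagonal matrices with two blocks. -/
def blockMatrix : Matrix (Fin n) (Fin n) K × Matrix (Fin k) (Fin k) K →*
    Matrix (Fin (n + k)) (Fin (n + k)) K where
  toFun p := Matrix.reindex finSumFinEquiv finSumFinEquiv (Matrix.fromBlocks p.1 0 0 p.2)
  map_one' := by simp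
  map_mul' p q := by
    simp [Matrix.submatrix_mul_equiv, Matrix.fromBlocks_multiply]

lemma det_blockMatrix (p : Matrix (Fin n) (Fin n) K × Matrix (Fin k) (Fin k) K) :
    (blockMatrix n k p).det = p.1.det * p.2.det := by
  simp [blockMatrix]

/-- The block diagonal embedding `GL_+(n,K) × GL_+(k,K) → GL_+(n+k,K)`. -/
def blockHom : GL(n, K)⁺ × GL(k, K)⁺ →* GL(n + k, K)⁺ where
  toFun p := ⟨Units.map (blockMatrix n k) (MulEquiv.prodUnits.symm (p.1.1, p.2.1)), by
    rw [Matrix.mem_glpos]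
    change 0 < (blockMatrix n k _).det
    rw [det_blockMatrix]
    exact mul_pos p.1.2 p.2.2⟩
  map_one' := Subtype.ext (map_one ((Units.map (blockMatrix (K := K) n k)).comp
    MulEquiv.prodUnits.symm.toMonoidHom))
  map_mul' p q := Subtype.ext (map_mul ((Units.map (blockMatrix n k)).comp
    MulEquiv.prodUnits.symm.toMonoidHom) (p.1.1, p.2.1) (q.1.1, q.2.1))

end Block

end

end TautEuler

namespace TautEuler

universe u v w

/-! ### Comparing a resolution map with a generic section -/

section Homotopy

variable {W : Type v} {Y : AbstractSimplicialComplex W} {G : Type u} [Group G] [MulAction G W]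
  [IsSimplicialAction Y G]

/-! Both Euler numbers are signed counts of zeros of generic sections, and a pair of sections is a
section of the product bundle. The theorem thereby becomes an identity between degrees of tuples of
vectors over one product of simplices.

Reduction to degrees. A section of the associated vector bundle, prescribed at the vertices,
attaches `n + 1` vectors of `Kⁿ` to each `n`-simplex. If all their maximal minors are nonzero, their
rays span a simplex of the complex of generic rays. That complex is acyclic and `G` acts freely on
tuples of its own elements, so any resolution map is equivariantly homotopic to the map that sends a
simplex to its rays. After applying `T_0` the homotopy becomes a simplicial coboundary, which a
cycle does not see. Hence the pairing is the sum of the degrees of the section over the cycle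
(`pairing_pullback_cohomClass`, `pairing_eu0`). It remains to prove `degree_mul_degree`: the product
of the degrees of `v` and `v'` is the sum over lattice paths `γ` of `(-1)^area` times the degree of
the vectors `(v_i, v'_j)`, `(i, j) ∈ γ`.

Multiplicativity of the degree. The minors of a tuple are the coefficients of its linear relation,
unique up to scale if some minor is nonzero, and the degree is `(-1)^n` times their common sign. Let
`a`, `b` be the minors of `v`, `v'`, with totals `A`, `B`, both nonzero. Then `B a` and `A b` have
the same total `A B`, and there is exactly one family of numbers on the vertices of `γ` with sums `B
a_i` over the points above `i` and `A b_j` over the points at height `j`; it is found greedily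
(`transport`). This family is a relation between the vectors along `γ`, hence proportional to their
minors. The factor is found by comparing totals: the sum of the minors is the determinant of the
successive differences, which along `γ` are those of `v` and `v'` shuffled, so it is `(-1)^area A B`
(`ofFn_minor_gridVectors`). The signs of the area cancel, and one has to count the paths whose
numbers all have the same sign. By the north-west corner rule there is exactly one path with
positive numbers if all `B a_i` and `A b_j` are positive, and none otherwise
(`sum_listSign_transport`).

Genericity. What is needed is that finitely many polynomials in the values of the two sections do
not vanish: the minors, their totals, and differences of partial sums of `B a` and `A b`. An ordered
field is infinite, so it suffices to find one point for each polynomial (`exists_generic_sections`).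

That the cross product is a cycle is the Leibniz rule for the shuffle product, proved for lists of
vertices by recursion on the first step of a path (`chainBoundary_shuffle`). -/

lemma OrderedSimplex.translate_translate {m : ℕ} (g h : G) (σ : OrderedSimplex Y m) :
    (σ.translate h).translate g = σ.translate (g * h) := by
  ext i
  exact (mul_smul g h _).symm

/-- The alternating sum over the faces of a tuple of group elements together with a simplex. -/
noncomputable def pairFaceSum {A : Type w} [AddCommGroup A] {m : ℕ}
    (H : (Fin (m + 1) → G) → OrderedSimplex Y m → A)
    (γ : Fin (m + 2) → G) (σ : OrderedSimplex Y (m + 1)) : A :=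
  ∑ i : Fin (m + 2), (-1 : ℤ) ^ (i : ℕ) • H (γ ∘ i.succAbove) (σ.face i)

lemma pairFaceSum_pairFaceSum {A : Type w} [AddCommGroup A] {m : ℕ}
    (H : (Fin (m + 1) → G) → OrderedSimplex Y m → A)
    (γ : Fin (m + 3) → G) (σ : OrderedSimplex Y (m + 2)) :
    pairFaceSum (pairFaceSum H) γ σ = 0 := by
  refine alternating_sum_sum (fun a b => H ((γ ∘ a.succAbove) ∘ b.succAbove)
    ((σ.face a).face b)) fun i j h => ?_
  congr 1
  · funext l
    exact congrArg γ (succAbove_comm h l)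
  · ext l
    exact congrArg σ.vertex (succAbove_comm h l)

lemma pairFaceSum_translate {m : ℕ}
    (H : (Fin (m + 1) → G) → OrderedSimplex Y m → OrientedChain Y (m + 1))
    (hH : ∀ (g : G) γ σ, H (g • γ) (σ.translate g) = translate Y g (H γ σ))
    (g : G) (γ : Fin (m + 2) → G) (σ : OrderedSimplex Y (m + 1)) :
    pairFaceSum H (g • γ) (σ.translate g) = translate Y g (pairFaceSum H γ σ) := by
  rw [pairFaceSum, pairFaceSum, map_sum]
  refine Finset.sum_congr rfl fun i _ => ?_
  rw [map_smul, ← hH]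
  rfl

/-- The defect of a homotopy in degree `m`, summed over faces, is the boundary of the next
obstruction. If the defect is itself an alternating face sum, the obstruction is a cycle and can be
filled. -/
lemma boundary_sub_sub_pairFaceSum (ψ : ResolutionMap Y G) {m : ℕ}
    (H : (Fin (m + 1) → G) → OrderedSimplex Y m → OrientedChain Y (m + 1))
    (γ : Fin (m + 2) → G) (σ : OrderedSimplex Y (m + 1)) :
    orientedBoundary Y m (ψ.toFun (m + 1) γ - oriented σ - pairFaceSum H γ σ) =
      pairFaceSum (fun γ σ => ψ.toFun m γ - oriented σ - orientedBoundary Y m (H γ σ)) γ σ := by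
  rw [map_sub, map_sub, ψ.boundary_eq, boundary_oriented]
  simp only [pairFaceSum, map_sum, map_smul, smul_sub, Finset.sum_sub_distrib]

/-- An equivariant filling of an equivariant family of fillable chains. -/
lemma exists_equivariant_filling {m : ℕ}
    (R : (Fin (m + 1) → G) → OrderedSimplex Y m → OrientedChain Y m)
    (hR : ∀ (g : G) γ σ, R (g • γ) (σ.translate g) = translate Y g (R γ σ))
    (hb : ∀ γ σ, ∃ b, orientedBoundary Y m b = R γ σ) :
    ∃ H : (Fin (m + 1) → G) → OrderedSimplex Y m → OrientedChain Y (m + 1),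
      (∀ (g : G) γ σ, H (g • γ) (σ.translate g) = translate Y g (H γ σ)) ∧
      ∀ γ σ, orientedBoundary Y m (H γ σ) = R γ σ := by
  choose b hb using hb
  -- `G` acts freely on the pairs through `γ`, and each orbit has a unique representative with `γ 0
  -- = 1`. The filling is chosen there and translated.
  refine ⟨fun γ σ => translate Y (γ 0) (b ((γ 0)⁻¹ • γ) (σ.translate (γ 0)⁻¹)), ?_, ?_⟩
  · intro g γ σ
    have h1 : ((g • γ) 0)⁻¹ • g • γ = (γ 0)⁻¹ • γ := by
      rw [Pi.smul_apply, smul_eq_mul, mul_inv_rev, mul_smul, inv_smul_smul]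
    have h2 : (σ.translate g).translate ((g • γ) 0)⁻¹ = σ.translate (γ 0)⁻¹ := by
      rw [OrderedSimplex.translate_translate, Pi.smul_apply, smul_eq_mul, mul_inv_rev,
        inv_mul_cancel_right]
    simp only [h1, h2]
    rw [translate_translate]
    rfl
  · intro γ σ
    have h2 : (σ.translate (γ 0)⁻¹).translate (γ 0) = σ := by
      ext i
      exact smul_inv_smul (γ 0) _
    rw [boundary_translate, hb, ← hR, smul_inv_smul, h2]

/-- A resolution map is equivariantly homotopic to the tautological map on pairs. -/
lemma exists_homotopy (hY : StarProperty Y) (ψ : ResolutionMap Y G) (m : ℕ) :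
    ∃ H : (Fin (m + 1) → G) → OrderedSimplex Y m → OrientedChain Y (m + 1),
      (∀ (g : G) γ σ, H (g • γ) (σ.translate g) = translate Y g (H γ σ)) ∧
      ∀ γ σ, orientedBoundary Y m (ψ.toFun (m + 1) γ - oriented σ - pairFaceSum H γ σ) = 0 := by
  -- The inductive statement records only that the next obstruction is a cycle. This is all that the
  -- following step uses, and it keeps the augmentation confined to degree zero.
  induction m with
  | zero =>
    obtain ⟨H, hH, hb⟩ := exists_equivariant_filling
      (fun γ σ => ψ.toFun 0 γ - oriented (X := Y) σ)
      (fun g γ σ => by rw [ψ.equivariant, map_sub, translate_oriented])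
      (fun γ σ => exact_zero Y hY _ (by
        rw [map_sub, ψ.augmentation_eq, augmentation, OrientedChain.lift_oriented, sub_self]))
    refine ⟨H, hH, fun γ σ => ?_⟩
    rw [boundary_sub_sub_pairFaceSum]
    simp [hb, pairFaceSum]
  | succ m ih =>
    obtain ⟨H₀, hH₀, hb₀⟩ := ih
    obtain ⟨H, hH, hb⟩ := exists_equivariant_filling
      (fun γ σ => ψ.toFun (m + 1) γ - oriented σ - pairFaceSum H₀ γ σ)
      (fun g γ σ => by
        rw [ψ.equivariant, map_sub, map_sub, translate_oriented, pairFaceSum_translate _ hH₀])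
      (fun γ σ => exact_succ Y hY _ (hb₀ γ σ))
    refine ⟨H, hH, fun γ σ => ?_⟩
    -- By the choice of `H` the defect in degree `m + 1` equals the face sum of `H₀`, so iterating
    -- the face sum gives zero.
    rw [boundary_sub_sub_pairFaceSum]
    simp only [hb, sub_sub_cancel]
    exact pairFaceSum_pairFaceSum H₀ γ σ

/-- Evaluating an invariant cocycle on a resolution map and on a simplex gives the same result up to
the coboundary of an invariant cochain. -/
lemma exists_invariant_cochain (hY : StarProperty Y) (ψ : ResolutionMap Y G) {A : Type w}
    [AddCommGroup A] {m : ℕ} (T : TautCoeff Y G (m + 1) →ₗ[ℤ] A) :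
    ∃ h : (Fin (m + 1) → G) → OrderedSimplex Y m → A,
      (∀ (g : G) γ σ, h (g • γ) (σ.translate g) = h γ σ) ∧
      ∀ γ σ, T (tautologicalCocycle Y G (m + 1) (ψ.toFun (m + 1) γ)) =
        T (tautologicalCocycle Y G (m + 1) (oriented σ)) + pairFaceSum h γ σ := by
  obtain ⟨H, hH, hb⟩ := exists_homotopy hY ψ m
  refine ⟨fun γ σ => T (tautologicalCocycle Y G (m + 1) (H γ σ)), fun g γ σ => ?_, fun γ σ => ?_⟩
  · beta_reduce
    rw [hH, tautologicalCocycle_translate]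
  -- The difference is a cycle, hence a boundary, and the tautological cocycle vanishes on
  -- boundaries. Invariance of `h` holds because the values are taken in coinvariants.
  · obtain ⟨b, hb⟩ := exact_succ Y hY _ (hb γ σ)
    have h := tautologicalCocycle_boundary Y G (m + 1) b
    rw [hb, map_sub, map_sub, sub_sub, sub_eq_zero] at h
    rw [h, map_add]
    simp [pairFaceSum, map_sum]

open Classical in
/-- The pairing of the pull-back of a coefficient image of the tautological class with a cycle may
be computed with a section of the associated bundle with fibre the vertex set of `Y` that spans
simplices over the simplices of the cycle. -/
lemma pairing_pullback_cohomClass (hY : StarProperty Y) (ψ : ResolutionMap Y G) {A : Type w}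
    [AddCommGroup A] {m : ℕ} (T : TautCoeff Y G (m + 1) →ₗ[ℤ] A)
    {V : Type*} [PartialOrder V] {X : AbstractSimplicialComplex V} (E : FlatBundle G X)
    (z : (orderedDelta X).cycles (m + 1)) (s : V → W)
    (hs : ∀ σ ∈ z.1.support, Spans Y (Set.range fun i => E.trans (σ.vertex 0) (σ.vertex i) •
      s (σ.vertex i))) (f : IncreasingSimplex X (m + 1) → A)
    (hf : ∀ σ ∈ z.1.support, ∀ τ : OrderedSimplex Y (m + 1),
      (∀ i, τ.vertex i = E.trans (σ.vertex 0) (σ.vertex i) • s (σ.vertex i)) →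
      f σ = T (tautologicalCocycle Y G (m + 1) (oriented τ))) :
    (orderedDelta X).pairing A (E.classifyingMap.pullback A (m + 1)
      ((classifyingSpace G).coeffMap T (m + 1) (ψ.cohomClass (m + 1)))) z =
      z.1.sum fun σ r => r • f σ := by
  obtain ⟨h, hinv, hT⟩ := exists_invariant_cochain hY ψ T
  -- The section need not span simplices away from the cycle. The value `0` chosen there is
  -- harmless, since only faces of simplices in the support of `z` are used below.
  let c : (orderedDelta X).Cochain A m := fun σ : IncreasingSimplex X m =>
    if hσ : Spans Y (Set.range fun i => E.trans (σ.vertex 0) (σ.vertex i) • s (σ.vertex i)) then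
      h (fun i => E.trans (σ.vertex 0) (σ.vertex i)) ⟨_, hσ⟩ else 0
  have hz : (orderedDelta X).eval A z.1 ((orderedDelta X).coboundary A m c) = 0 := by
    rw [DeltaSet.eval_coboundary]
    have : (orderedDelta X).boundary m z.1 = 0 := z.2
    rw [this]
    rfl
  have hmain : ∀ σ ∈ z.1.support,
      T (tautologicalCocycle Y G (m + 1) (ψ.toFun (m + 1) fun i =>
        E.trans (σ.vertex 0) (σ.vertex i))) = f σ + (orderedDelta X).coboundary A m c σ := by
    intro σ hσ
    have hsp := hs σ hσ
    rw [hT _ ⟨_, hsp⟩, ← hf σ hσ _ fun _ => rfl]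
    congr 1
    refine Finset.sum_congr rfl fun i _ => ?_
    congr 1
    -- Omitting vertex `0` changes the first vertex and with it the reference trivialization. The
    -- element `g` passes to the trivialization of the face, and the invariance of `h` absorbs it.
    set g := E.trans (σ.vertex (i.succAbove 0)) (σ.vertex 0) with hg
    have hmul : ∀ j, g * E.trans (σ.vertex 0) (σ.vertex j) =
        E.trans (σ.vertex (i.succAbove 0)) (σ.vertex j) := fun j =>
      E.cocycle _ _ _ (σ.spans.mono (by rintro x (rfl | rfl | rfl) <;> exact ⟨_, rfl⟩)
        ⟨_, Or.inl rfl⟩)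
    rw [← hinv g]
    have hvert : (OrderedSimplex.translate g (OrderedSimplex.face i ⟨_, hsp⟩)).vertex = fun j =>
        E.trans (σ.vertex (i.succAbove 0)) (σ.vertex (i.succAbove j)) •
          s (σ.vertex (i.succAbove j)) := by
      funext j
      change g • E.trans (σ.vertex 0) _ • s _ = _
      rw [← mul_smul, hmul]
    have hsp' := (OrderedSimplex.translate g (OrderedSimplex.face i ⟨_, hsp⟩)).spans
    rw [hvert] at hsp'
    change _ = dite _ _ _
    rw [dif_pos (show Spans Y (Set.range fun j => E.trans (((orderedDelta X).face i σ).vertex 0)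
      (((orderedDelta X).face i σ).vertex j) • s (((orderedDelta X).face i σ).vertex j)) from hsp')]
    congr 1
    · funext j
      exact hmul _
    · exact OrderedSimplex.ext hvert
  change (z.1.sum fun σ r => r • T (tautologicalCocycle Y G (m + 1) (ψ.toFun (m + 1) fun i =>
    E.trans (IncreasingSimplex.vertex σ 0) (IncreasingSimplex.vertex σ i)))) = _
  refine (Finsupp.sum_congr (g2 := fun σ r => r • (f σ + (orderedDelta X).coboundary A m c σ))
    fun σ hσ => congrArg (z.1 σ • ·) (hmain σ hσ)).trans ?_
  refine (map_add ((orderedDelta X).eval A z.1) f ((orderedDelta X).coboundary A m c)).trans ?_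
  exact (congrArg _ hz).trans (add_zero _)

end Homotopy

/-! ### Euler numbers as signed counts of zeros of generic sections -/

section EulerPairing

variable {K : Type u} [Field K] [LinearOrder K] [IsStrictOrderedRing K] {n : ℕ}

lemma linearIndependent_of_minor_ne_zero (v : Fin (n + 1) → Fin n → K) (p : Fin (n + 1))
    (hp : minor v p ≠ 0) : LinearIndependent K fun r : Fin n => v (p.succAbove r) :=
  Matrix.linearIndependent_rows_of_det_ne_zero fun h => hp (by
    rw [minor]
    exact mul_eq_zero_of_right _ h)

lemma ne_zero_of_minor_ne_zero (hn : 0 < n) (v : Fin (n + 1) → Fin n → K)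
    (hv : ∀ p, minor v p ≠ 0) (i : Fin (n + 1)) : v i ≠ 0 := by
  have : Nontrivial (Fin (n + 1)) := Fin.nontrivial_iff_two_le.2 (by lia)
  obtain ⟨p, hp⟩ := exists_ne i
  obtain ⟨r, rfl⟩ := Fin.exists_succAbove_eq hp.symm
  exact (linearIndependent_of_minor_ne_zero v p (hv p)).ne_zero r

/-- The rays of vectors all of whose maximal minors are nonzero span a simplex. -/
lemma spans_genericRays (v : Fin (n + 1) → Fin n → K) (hv : ∀ p, minor v p ≠ 0)
    (ρ : Fin (n + 1) → Module.Ray K (Fin n → K)) (c : Fin (n + 1) → K) (hc : ∀ i, 0 < c i)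
    (hρ : ∀ i, (ρ i).someVector = c i • v i) : Spans (genericRays n K) (Set.range ρ) := by
  classical
  refine ⟨Finset.univ.image ρ, ⟨⟨ρ 0, by simp⟩, fun t ht hcard => ?_⟩, by simp⟩
  have hex : ∀ x : t, ∃ i, ρ i = x := fun x => by
    obtain ⟨i, -, hi⟩ := Finset.mem_image.1 (ht x.2)
    exact ⟨i, hi⟩
  choose e he using hex
  have hinj : Function.Injective e := fun x y hxy => Subtype.ext (by rw [← he, ← he, hxy])
  -- At most `n` of the `n + 1` indices occur, so some `p` is missed and the vectors are among those
  -- of the nonzero minor `p`.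
  obtain ⟨p, hp⟩ : ∃ p, ∀ x, e x ≠ p := by
    by_contra! h
    have := Fintype.card_le_of_surjective e h
    rw [Fintype.card_fin, Fintype.card_coe] at this
    lia
  choose f hf using fun x => Fin.exists_succAbove_eq (hp x)
  have hfinj : Function.Injective f := fun x y hxy => hinj (by rw [← hf, ← hf, hxy])
  have h1 := (linearIndependent_of_minor_ne_zero v p (hv p)).comp f hfinj
  have h2 := h1.units_smul fun x => Units.mk0 (c (e x)) (hc _).ne'
  change LinearIndependent K fun x : t => (x : Module.Ray K (Fin n → K)).someVector
  convert h2 using 2 with x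
  rw [← he x, hρ]
  change _ = c (e x) • v (p.succAbove (f x))
  rw [hf]

variable {V : Type v} [PartialOrder V] {X : AbstractSimplicialComplex V}

/-- The values of a section of the associated vector bundle at the vertices of a simplex, in the
trivialization over the star of the first vertex. -/
def sectionValues (E : FlatBundle GL(n, K)⁺ X) (s : V → Fin n → K) {m : ℕ}
    (σ : IncreasingSimplex X m) (i : Fin (m + 1)) : Fin n → K :=
  ((E.trans (σ.vertex 0) (σ.vertex i) : GL (Fin n) K) : Matrix (Fin n) (Fin n) K) *ᵥ
    s (σ.vertex i)

/-- The Euler number is the number of zeros, counted with signs, of a generic section. -/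
lemma pairing_eu0 (hn : 0 < n) (E : FlatBundle GL(n, K)⁺ X) (z : (orderedDelta X).cycles n)
    (s : V → Fin n → K) (hs : ∀ σ ∈ z.1.support, ∀ p, minor (sectionValues E s σ) p ≠ 0) :
    (orderedDelta X).pairing ℤ (eu0 hn E) z =
      z.1.sum fun σ r => r * degree (sectionValues E s σ) := by
  obtain ⟨m, rfl⟩ : ∃ m, n = m + 1 := ⟨n - 1, by lia⟩
  classical
  -- The ray taken where the section vanishes is arbitrary: such vertices do not occur in simplices
  -- of the support.
  let ρ : V → Module.Ray K (Fin (m + 1) → K) := fun x =>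
    if h : s x ≠ 0 then rayOfNeZero K (s x) h else
      rayOfNeZero K (Pi.single 0 1) (by simp)
  have hρ : ∀ σ ∈ z.1.support, ∀ i, ∃ c : K, 0 < c ∧
      (((E.map (QuotientGroup.mk' (posScalars (m + 1) K))).trans (IncreasingSimplex.vertex σ 0)
        (IncreasingSimplex.vertex σ i)) • ρ (IncreasingSimplex.vertex σ i)).someVector =
        c • sectionValues E s σ i := by
    intro σ hσ i
    have h0 := ne_zero_of_minor_ne_zero hn _ (hs σ hσ) i
    have hsi : s (IncreasingSimplex.vertex σ i) ≠ 0 := by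
      intro h
      apply h0
      simp only [sectionValues, h, Matrix.mulVec_zero]
    have h1 : ((E.map (QuotientGroup.mk' (posScalars (m + 1) K))).trans
        (IncreasingSimplex.vertex σ 0) (IncreasingSimplex.vertex σ i)) •
        ρ (IncreasingSimplex.vertex σ i) = rayOfNeZero K _ h0 := by
      simp only [ρ, dif_pos hsi]
      rfl
    rw [h1]
    have h2 := Module.Ray.someVector_ray (rayOfNeZero K _ h0)
    rw [ray_eq_iff] at h2
    obtain ⟨c, hc, h⟩ := h2.exists_pos_right (Module.Ray.someVector_ne_zero _) h0
    exact ⟨c, hc, h⟩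
  rw [eu0, eulerClass, tautologicalClass]
  refine (pairing_pullback_cohomClass (starProperty_genericRays hn) _ _ _ z ρ (fun σ hσ => ?_)
    (fun σ => degree (sectionValues E s σ)) (fun σ hσ τ hτ => ?_)).trans ?_
  · choose c hc h using hρ σ hσ
    exact spans_genericRays _ (hs σ hσ) _ c hc h
  · choose c hc h using hρ σ hσ
    -- The representatives of the rays differ from the values of the section by positive factors,
    -- which do not change the degree.
    rw [eulerCoeff_oriented, ← degree_smul _ c hc]
    congr 1
    funext i
    rw [hτ i]
    exact (h i).symm
  · simp

end EulerPairing

/-! ### Chains of lists -/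

section ListChain

variable {P : Type*} {Q : Type*}

/-- Prepending a vertex to the lists of a chain. -/
noncomputable def consChain (e : P) : (List P →₀ ℤ) →ₗ[ℤ] (List P →₀ ℤ) :=
  Finsupp.lmapDomain ℤ ℤ (List.cons e)

@[simp]
lemma consChain_single (e : P) (l : List P) (r : ℤ) :
    consChain e (Finsupp.single l r) = Finsupp.single (e :: l) r := by
  simp [consChain]

/-- The boundary of a list, viewed as an ordered simplex. -/
noncomputable def listBoundary : List P → (List P →₀ ℤ)
  | [] => 0
  | e :: l => Finsupp.single l 1 - consChain e (listBoundary l)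

/-- The linear extension of `listBoundary`. -/
noncomputable def chainBoundary : (List P →₀ ℤ) →ₗ[ℤ] (List P →₀ ℤ) :=
  Finsupp.linearCombination ℤ listBoundary

lemma chainBoundary_single (l : List P) : chainBoundary (Finsupp.single l 1) = listBoundary l := by
  simp [chainBoundary]

/-- The cone formula, valid in all degrees because the list complex is augmented: a single vertex
has the empty list as its boundary. -/
lemma chainBoundary_consChain (e : P) (x : List P →₀ ℤ) :
    chainBoundary (consChain e x) = x - consChain e (chainBoundary x) := by
  induction x using Finsupp.induction_linear with
  | zero => simp
  | add x y hx hy => simp only [map_add, hx, hy]; abel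
  | single l r =>
    have : (Finsupp.single l r : List P →₀ ℤ) = r • Finsupp.single l 1 := by simp
    rw [this, map_smul, map_smul, map_smul, map_smul, consChain_single, chainBoundary_single,
      chainBoundary_single, ← smul_sub]
    rfl

/-- The shuffle product of two lists: the signed sum over the lattice paths. -/
noncomputable def shuffle : List P → List Q → (List (P × Q) →₀ ℤ)
  | [], [] => 0
  -- The values on empty lists are fixed by two demands: `[x] × [y]` must be `[(x, y)]` with
  -- coefficient one, and the Leibniz rule must hold. Only one of the two summands of the recursion
  -- may contribute the empty list, whence the asymmetry with the case of an empty second list.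
  | [], [_] => Finsupp.single [] 1
  | [], _ :: _ :: _ => 0
  | _ :: _, [] => 0
  | x :: xs, y :: ys =>
    -- A path that starts upwards raises each of its `xs.length` later horizontal steps by one,
    -- which is the sign of the second summand.
    consChain (x, y) (shuffle xs (y :: ys) + (-1 : ℤ) ^ xs.length • shuffle (x :: xs) ys)
termination_by l l' => l.length + l'.length

lemma shuffle_cons_cons (x : P) (xs : List P) (y : Q) (ys : List Q) :
    shuffle (x :: xs) (y :: ys) =
      consChain (x, y) (shuffle xs (y :: ys) + (-1 : ℤ) ^ xs.length • shuffle (x :: xs) ys) := by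
  rw [shuffle]

@[simp]
lemma shuffle_nil_right (xs : List P) : shuffle xs ([] : List Q) = 0 := by
  cases xs <;> rw [shuffle]

/-- The bilinear extension of the shuffle product. -/
noncomputable def chainShuffle :
    (List P →₀ ℤ) →ₗ[ℤ] (List Q →₀ ℤ) →ₗ[ℤ] (List (P × Q) →₀ ℤ) :=
  Finsupp.linearCombination ℤ fun xs =>
    (Finsupp.linearCombination ℤ fun ys => shuffle xs ys : (List Q →₀ ℤ) →ₗ[ℤ] _)

@[simp]
lemma chainShuffle_single_single (xs : List P) (ys : List Q) (r r' : ℤ) :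
    chainShuffle (Finsupp.single xs r) (Finsupp.single ys r') = (r * r') • shuffle xs ys := by
  simp [chainShuffle, smul_smul]

/-- Chains of lists of length `m`. -/
def HasLength (m : ℕ) (x : List P →₀ ℤ) : Prop := ∀ l ∈ x.support, l.length = m

lemma HasLength.induction {m : ℕ} {p : (List P →₀ ℤ) → Prop} {x : List P →₀ ℤ}
    (hx : HasLength m x) (h0 : p 0) (hadd : ∀ x y, p x → p y → p (x + y))
    (hsingle : ∀ l r, l.length = m → p (Finsupp.single l r)) : p x := by
  rw [← Finsupp.sum_single x, Finsupp.sum]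
  exact Finset.sum_induction _ p hadd h0 fun l hl => hsingle l _ (hx l hl)

/-- The truncated subtraction is harmless: the boundary of the empty list is zero and so satisfies
every length condition. -/
lemma hasLength_listBoundary (l : List P) : HasLength (l.length - 1) (listBoundary l) := by
  classical
  induction l with
  | nil => intro l hl; simp [listBoundary] at hl
  | cons e l ih =>
    intro l' hl'
    rw [listBoundary] at hl'
    rcases Finset.mem_union.1 (Finsupp.support_sub hl') with h | h
    · have := Finsupp.support_single_subset h
      rw [Finset.mem_singleton] at this
      rw [this, List.length_cons]
      lia
    · obtain ⟨l'', hl'', rfl⟩ := Finset.mem_image.1 (Finsupp.mapDomain_support h)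
      have := ih l'' hl''
      rcases l with _ | ⟨a, l⟩
      · simp [listBoundary] at hl''
      · simp only [List.length_cons] at this ⊢
        lia

/-- The recursion of the shuffle, extended to chains in the first factor. Homogeneity of `c` is
needed because the sign depends on the length. -/
lemma chainShuffle_consChain_left {m : ℕ} (x : P) (c : List P →₀ ℤ) (hc : HasLength m c) (y : Q)
    (ys : List Q) : chainShuffle (consChain x c) (Finsupp.single (y :: ys) 1) =
      consChain (x, y) (chainShuffle c (Finsupp.single (y :: ys) 1) +
        (-1 : ℤ) ^ m • chainShuffle (consChain x c) (Finsupp.single ys 1)) := by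
  refine hc.induction (p := fun c => chainShuffle (consChain x c) (Finsupp.single (y :: ys) 1) =
      consChain (x, y) (chainShuffle c (Finsupp.single (y :: ys) 1) +
        (-1 : ℤ) ^ m • chainShuffle (consChain x c) (Finsupp.single ys 1))) ?_ ?_ ?_
  · simp
  · intro c d h h'
    simp only [map_add, LinearMap.add_apply, h, h', smul_add]
    abel
  · intro l r hl
    simp only [consChain_single, chainShuffle_single_single, shuffle_cons_cons, hl, mul_one]
    rw [smul_comm, ← smul_add, map_smul]

lemma chainShuffle_consChain_right (x : P) (xs : List P) (y : Q) (c : List Q →₀ ℤ) :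
    chainShuffle (Finsupp.single (x :: xs) 1) (consChain y c) =
      consChain (x, y) (chainShuffle (Finsupp.single xs 1) (consChain y c) +
        (-1 : ℤ) ^ xs.length • chainShuffle (Finsupp.single (x :: xs) 1) c) := by
  induction c using Finsupp.induction_linear with
  | zero => simp
  | add c d h h' =>
    simp only [map_add, h, h', smul_add]
    abel
  | single l r =>
    simp only [consChain_single, chainShuffle_single_single, shuffle_cons_cons, one_mul]
    rw [smul_comm, ← smul_add, map_smul]

/-- Multiplication by the empty list on the left is the augmentation in the second factor, and the
augmentation vanishes on boundaries. The only case with a visible cancellation is a list of two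
vertices. -/
lemma shuffle_nil_listBoundary (ys : List Q) :
    chainShuffle (Finsupp.single ([] : List P) 1) (listBoundary ys) = 0 := by
  rcases ys with _ | ⟨y, _ | ⟨y', _ | ⟨y'', ys⟩⟩⟩
  · simp [listBoundary]
  · simp [listBoundary]
  · simp [listBoundary, shuffle]
  · refine (hasLength_listBoundary (y :: y' :: y'' :: ys)).induction
      (p := fun c => chainShuffle (Finsupp.single ([] : List P) 1) c = 0) ?_ ?_ ?_
    · simp
    · intro c d h h'
      rw [map_add, h, h', add_zero]
    · intro l r hl
      rcases l with _ | ⟨a, _ | ⟨b, l⟩⟩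
      · simp at hl
      · simp at hl
      · simp [shuffle]

/-- The Leibniz rule. -/
lemma chainBoundary_shuffle : ∀ (xs : List P) (ys : List Q), chainBoundary (shuffle xs ys) =
    chainShuffle (listBoundary xs) (Finsupp.single ys 1) -
      -- A list of length `l` has dimension `l - 1`, so this is the usual sign `(-1)^dim`.
      (-1 : ℤ) ^ xs.length • chainShuffle (Finsupp.single xs 1) (listBoundary ys)
  | [], ys => by
    rw [shuffle_nil_listBoundary]
    rcases ys with _ | ⟨y, _ | ⟨y', ys⟩⟩ <;> simp [shuffle, listBoundary, chainBoundary]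
  | x :: xs, [] => by
    refine Eq.trans (b := 0) (by simp) ?_
    have h : ∀ c : List P →₀ ℤ, chainShuffle c (Finsupp.single ([] : List Q) 1) = 0 := by
      intro c
      induction c using Finsupp.induction_linear with
      | zero => simp
      | add c d h h' => rw [map_add, LinearMap.add_apply, h, h', add_zero]
      | single l r => simp
    rw [h]
    simp [listBoundary]
  | x :: xs, y :: ys => by
    have h1 := chainBoundary_shuffle xs (y :: ys)
    have h2 := chainBoundary_shuffle (x :: xs) ys
    rw [shuffle_cons_cons, chainBoundary_consChain, map_add, map_smul, h1, h2]
    have hl : listBoundary (x :: xs) = Finsupp.single xs 1 - consChain x (listBoundary xs) := rfl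
    have hr : listBoundary (y :: ys) = Finsupp.single ys 1 - consChain y (listBoundary ys) := rfl
    have e1 : chainShuffle (listBoundary (x :: xs)) (Finsupp.single (y :: ys) 1) =
        shuffle xs (y :: ys) - consChain (x, y)
          (chainShuffle (listBoundary xs) (Finsupp.single (y :: ys) 1) +
          (-1 : ℤ) ^ (xs.length - 1) •
            chainShuffle (consChain x (listBoundary xs)) (Finsupp.single ys 1)) := by
      rw [hl, map_sub, LinearMap.sub_apply,
        chainShuffle_consChain_left x _ (hasLength_listBoundary xs)]
      simp
    have e2 : chainShuffle (Finsupp.single (x :: xs) 1) (listBoundary (y :: ys)) =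
        shuffle (x :: xs) ys - consChain (x, y)
          (chainShuffle (Finsupp.single xs 1) (consChain y (listBoundary ys)) +
          (-1 : ℤ) ^ xs.length • chainShuffle (Finsupp.single (x :: xs) 1) (listBoundary ys)) := by
      rw [hr, map_sub, chainShuffle_consChain_right]
      simp
    have e3 : chainShuffle (Finsupp.single xs 1) (listBoundary (y :: ys)) =
        shuffle xs ys - chainShuffle (Finsupp.single xs 1) (consChain y (listBoundary ys)) := by
      rw [hr, map_sub]
      simp
    have e4 : chainShuffle (listBoundary (x :: xs)) (Finsupp.single ys 1) =
        shuffle xs ys - chainShuffle (consChain x (listBoundary xs)) (Finsupp.single ys 1) := by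
      rw [hl, map_sub, LinearMap.sub_apply]
      simp
    rw [e1, e2, e3, e4]
    -- The exponent `xs.length - 1` in `e1` is truncated for the empty list; there the boundary of
    -- `xs` is zero and the term disappears.
    rcases xs with _ | ⟨x', xs⟩
    · simp [listBoundary]
      abel
    · simp only [List.length_cons, Nat.add_sub_cancel, pow_succ, smul_sub, smul_add, map_sub,
        map_add, map_smul, smul_smul]
      rcases neg_one_pow_eq_or ℤ xs.length with h | h <;> simp [h] <;> abel
termination_by l l' => l.length + l'.length

lemma chainBoundary_chainShuffle {m : ℕ} (c : List P →₀ ℤ) (hc : HasLength m c) (d : List Q →₀ ℤ) :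
    chainBoundary (chainShuffle c d) =
      chainShuffle (chainBoundary c) d - (-1 : ℤ) ^ m • chainShuffle c (chainBoundary d) := by
  refine hc.induction (p := fun c => chainBoundary (chainShuffle c d) =
      chainShuffle (chainBoundary c) d - (-1 : ℤ) ^ m • chainShuffle c (chainBoundary d)) ?_ ?_ ?_
  · simp
  · intro c c' h h'
    simp only [map_add, LinearMap.add_apply, h, h', smul_add]
    abel
  · intro l r hl
    induction d using Finsupp.induction_linear with
    | zero => simp
    | add d d' h h' =>
      simp only [map_add, h, h', smul_add]
      abel
    | single l' r' =>
      have e : (Finsupp.single l r : List P →₀ ℤ) = r • Finsupp.single l 1 := by simp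
      have e' : (Finsupp.single l' r' : List Q →₀ ℤ) = r' • Finsupp.single l' 1 := by simp
      rw [e, e']
      simp only [map_smul, LinearMap.smul_apply, chainBoundary_single]
      have := chainBoundary_shuffle l l'
      rw [hl] at this
      rw [chainShuffle_single_single, mul_one, one_smul, this]
      module

/-- Links the recursive boundary with the alternating sum over faces that defines the simplicial
boundary. -/
lemma listBoundary_ofFn : ∀ {m : ℕ} (f : Fin (m + 1) → P), listBoundary (List.ofFn f) =
    ∑ i : Fin (m + 1), (-1 : ℤ) ^ (i : ℕ) • Finsupp.single (List.ofFn (f ∘ i.succAbove)) 1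
  | 0, f => by simp [listBoundary]
  | m + 1, f => by
    rw [List.ofFn_succ, listBoundary, listBoundary_ofFn, map_sum, sub_eq_add_neg,
      ← Finset.sum_neg_distrib]
    conv_rhs => rw [Fin.sum_univ_succ]
    congr 1
    · simp [Function.comp_def]
    · refine Finset.sum_congr rfl fun i _ => ?_
      rw [map_smul, consChain_single, Fin.val_succ, pow_succ, mul_neg_one, neg_smul]
      congr 3
      rw [List.ofFn_succ]
      simp [Function.comp_def]

end ListChain

/-! ### Lattice paths as words -/

section Words

/-- The words with `i` letters `true` (steps to the right) and `j` letters `false` (steps up). -/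
def words : ℕ → ℕ → Finset (List Bool)
  | 0, 0 => {[]}
  | i + 1, 0 => (words i 0).image (List.cons true)
  | 0, j + 1 => (words 0 j).image (List.cons false)
  | i + 1, j + 1 => (words i (j + 1)).image (List.cons true) ∪
      (words (i + 1) j).image (List.cons false)

lemma mem_words {w : List Bool} : ∀ {i j : ℕ}, w ∈ words i j ↔ w.count true = i ∧ w.count false = j
  := by
  induction w with
  | nil =>
    rintro (_ | i) (_ | j) <;> simp [words]
  | cons b w ih =>
    rintro (_ | i) (_ | j) <;> cases b <;> simp [words, ih]

lemma sum_words_succ_zero {A : Type*} [AddCommMonoid A] (f : List Bool → A) (i : ℕ) :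
    ∑ w ∈ words (i + 1) 0, f w = ∑ w ∈ words i 0, f (true :: w) := by
  rw [words, Finset.sum_image fun _ _ _ _ h => List.cons_injective h]

lemma sum_words_zero_succ {A : Type*} [AddCommMonoid A] (f : List Bool → A) (j : ℕ) :
    ∑ w ∈ words 0 (j + 1), f w = ∑ w ∈ words 0 j, f (false :: w) := by
  rw [words, Finset.sum_image fun _ _ _ _ h => List.cons_injective h]

lemma sum_words_succ_succ {A : Type*} [AddCommMonoid A] (f : List Bool → A) (i j : ℕ) :
    ∑ w ∈ words (i + 1) (j + 1), f w =
      ∑ w ∈ words i (j + 1), f (true :: w) + ∑ w ∈ words (i + 1) j, f (false :: w) := by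
  rw [words, Finset.sum_union, Finset.sum_image fun _ _ _ _ h => List.cons_injective h,
    Finset.sum_image fun _ _ _ _ h => List.cons_injective h]
  rw [Finset.disjoint_left]
  intro w h h'
  obtain ⟨_, -, rfl⟩ := Finset.mem_image.1 h
  obtain ⟨_, -, h⟩ := Finset.mem_image.1 h'
  simp at h

/-- The area under the path given by a word. -/
def wordArea : List Bool → ℕ
  | [] => 0
  | true :: w => wordArea w
  | false :: w => w.count true + wordArea w

/-- Double counting of the pairs of an upward step and a later horizontal one: the recursion groups
them by the upward step, the sum by the horizontal step, as in `LatticePath.area`. -/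
lemma wordArea_eq_sum (w : List Bool) : wordArea w =
    ∑ i ∈ Finset.range w.length, if w[i]? = some true then (w.take i).count false else 0 := by
  induction w with
  | nil => rfl
  | cons b w ih =>
    rw [List.length_cons, Finset.sum_range_succ']
    cases b
    · have hc : w.count true = ∑ i ∈ Finset.range w.length, if w[i]? = some true then 1 else 0 := by
        clear ih
        induction w with
        | nil => rfl
        | cons b w ih =>
          rw [List.length_cons, Finset.sum_range_succ']
          cases b <;> simp [ih]
      rw [wordArea, ih, hc, ← Finset.sum_add_distrib]
      simp only [List.getElem?_cons_succ, List.take_succ_cons, List.count_cons_self]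
      simp only [List.take_zero, List.count_nil, ite_self, add_zero]
      refine Finset.sum_congr rfl fun i _ => ?_
      split_ifs <;> lia
    · rw [wordArea, ih]
      simp

variable {P : Type*} {Q : Type*}

/-- The path in the product of two lists that is given by a word. -/
def gridPath : List P → List Q → List Bool → List (P × Q)
  | x :: _, y :: _, [] => [(x, y)]
  | x :: xs, y :: ys, true :: w => (x, y) :: gridPath xs (y :: ys) w
  | x :: xs, y :: ys, false :: w => (x, y) :: gridPath (x :: xs) ys w
  | _, _, _ => []

lemma length_gridPath (w : List Bool) : ∀ (xs : List P) (ys : List Q),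
    xs.length = w.count true + 1 → ys.length = w.count false + 1 →
    (gridPath xs ys w).length = w.length + 1 := by
  induction w with
  | nil =>
    rintro (_ | ⟨x, xs⟩) (_ | ⟨y, ys⟩) h h' <;> simp_all [gridPath]
  | cons b w ih =>
    rintro (_ | ⟨x, xs⟩) (_ | ⟨y, ys⟩) h h'
    · simp at h
    · simp at h
    · simp at h'
    · cases b
      · simp only [gridPath, List.length_cons]
        rw [ih]
        · simpa using h
        · simpa using h'
      · simp only [gridPath, List.length_cons]
        rw [ih]
        · simpa using h
        · simpa using h'

/-- After `p` steps the position is given by the numbers of letters `true` and `false` read so far.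
This matches the recursive path with a `LatticePath`. -/
lemma getElem?_gridPath (w : List Bool) : ∀ (xs : List P) (ys : List Q) (p : ℕ) (a : P) (b : Q),
    p ≤ w.length → xs[(w.take p).count true]? = some a → ys[(w.take p).count false]? = some b →
    (gridPath xs ys w)[p]? = some (a, b) := by
  induction w with
  | nil =>
    rintro (_ | ⟨x, xs⟩) (_ | ⟨y, ys⟩) p a b hp ha hb <;> simp_all [gridPath]
  | cons c w ih =>
    rintro (_ | ⟨x, xs⟩) (_ | ⟨y, ys⟩) p a b hp ha hb
    · simp at ha
    · simp at ha
    · simp at hb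
    · rcases p with _ | p
      · cases c <;> simp_all [gridPath]
      · cases c
        · simp only [gridPath, List.getElem?_cons_succ]
          exact ih _ _ _ _ _ (by simpa using hp) (by simpa using ha) (by simpa using hb)
        · simp only [gridPath, List.getElem?_cons_succ]
          exact ih _ _ _ _ _ (by simpa using hp) (by simpa using ha) (by simpa using hb)

/-- The two summands of the shuffle recursion correspond to the first letter of the word. When that
letter is `false`, the remaining word has `xs.length` letters `true`, which matches the sign with
the increase of `wordArea`. -/
lemma shuffle_eq_sum : ∀ (i j : ℕ) (xs : List P) (ys : List Q), xs.length = i + 1 →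
    ys.length = j + 1 → shuffle xs ys =
      ∑ w ∈ words i j, (-1 : ℤ) ^ wordArea w • Finsupp.single (gridPath xs ys w) 1
  | 0, 0, [x], [y], _, _ => by
    simp [shuffle, words, wordArea, gridPath]
  | i + 1, 0, x :: xs, [y], hx, hy => by
    rw [shuffle_cons_cons, sum_words_succ_zero, shuffle_nil_right, smul_zero, add_zero,
      shuffle_eq_sum i 0 xs [y] (by simpa using hx) hy, map_sum]
    simp [wordArea, gridPath]
  | 0, j + 1, [x], y :: y' :: ys, hx, hy => by
    rw [shuffle_cons_cons, sum_words_zero_succ,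
      shuffle_eq_sum 0 j [x] (y' :: ys) hx (by simpa using hy)]
    -- A step to the right is impossible from a single vertex: the empty list times a list of at
    -- least two entries is zero.
    rw [shuffle, zero_add, List.length_nil, pow_zero, one_smul, map_sum]
    refine Finset.sum_congr rfl fun w hw => ?_
    have := (mem_words.1 hw).1
    simp [wordArea, gridPath, this]
  | i + 1, j + 1, x :: xs, y :: ys, hx, hy => by
    have hx' : xs.length = i + 1 := by simpa using hx
    rw [shuffle_cons_cons, sum_words_succ_succ, shuffle_eq_sum i (j + 1) xs (y :: ys) hx' hy,
      shuffle_eq_sum (i + 1) j (x :: xs) ys hx (by simpa using hy), map_add, map_smul, map_sum,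
      map_sum, Finset.smul_sum]
    congr 1
    · refine Finset.sum_congr rfl fun w hw => ?_
      simp [wordArea, gridPath]
    · refine Finset.sum_congr rfl fun w hw => ?_
      have := (mem_words.1 hw).1
      simp [wordArea, gridPath, this, hx', pow_add]

end Words

/-! ### The bijection between lattice paths and words -/

namespace LatticePath

variable {n k : ℕ}

/-- The word of the steps of a path. -/
def word (γ : LatticePath n k) : List Bool :=
  List.ofFn fun i : Fin (n + k) => decide ((γ.point i.succ).2 = (γ.point i.castSucc).2)

@[simp]
lemma length_word (γ : LatticePath n k) : γ.word.length = n + k := by simp [word]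

lemma getElem?_word (γ : LatticePath n k) (i : Fin (n + k)) :
    γ.word[(i : ℕ)]? = some (decide ((γ.point i.succ).2 = (γ.point i.castSucc).2)) := by
  simp [word]

/-- A path is determined by its steps; this yields both the injectivity of `word` and the comparison
with `gridPath`. -/
lemma point_eq_count (γ : LatticePath n k) (p : Fin (n + k + 1)) :
    ((γ.point p).1 : ℕ) = (γ.word.take p).count true ∧
      ((γ.point p).2 : ℕ) = (γ.word.take p).count false := by
  induction p using Fin.induction with
  | zero => simp [γ.start]
  | succ i ih =>
    rw [Fin.val_castSucc] at ih
    rw [Fin.val_succ, List.take_add_one, List.count_append, List.count_append, ← ih.1, ← ih.2,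
      getElem?_word]
    rcases γ.step i with ⟨h1, h2⟩ | ⟨h1, h2⟩
    · simp [h1, h2]
    · have : (γ.point i.succ).2 ≠ (γ.point i.castSucc).2 := fun h => by
        rw [h] at h2
        lia
      simp [h1, h2, this]

lemma word_mem (γ : LatticePath n k) : γ.word ∈ words n k := by
  have h := γ.point_eq_count (Fin.last (n + k))
  rw [γ.finish, Fin.val_last, List.take_of_length_le (by simp)] at h
  exact mem_words.2 ⟨h.1.symm, h.2.symm⟩

lemma word_injective : Function.Injective (word : LatticePath n k → List Bool) := by
  intro γ γ' h
  ext p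
  · rw [(γ.point_eq_count p).1, (γ'.point_eq_count p).1, h]
  · rw [(γ.point_eq_count p).2, (γ'.point_eq_count p).2, h]

lemma exists_word_eq {w : List Bool} (hw : w ∈ words n k) : ∃ γ : LatticePath n k, γ.word = w := by
  obtain ⟨h1, h2⟩ := mem_words.1 hw
  have hlen : w.length = n + k := by
    rw [← h1, ← h2, List.count_true_add_count_false]
  have hle : ∀ (b : Bool) p, (w.take p).count b ≤ w.count b := fun b p =>
    (List.take_sublist p w).count_le b
  have htake : ∀ i (hi : i < n + k), w.take (i + 1) = w.take i ++ [w[i]'(by lia)] := fun i hi => by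
    rw [List.take_add_one, List.getElem?_eq_getElem (by lia)]
    rfl
  -- The path is rebuilt from the word by counting the letters of its initial segments.
  let γ : LatticePath n k :=
    { point := fun p => (⟨(w.take p).count true, by have := hle true p; lia⟩,
        ⟨(w.take p).count false, by have := hle false p; lia⟩)
      start := by simp
      finish := by
        have h : w.take (n + k) = w := by rw [← hlen, List.take_length]
        ext <;> simp [h, h1, h2]
      step := fun i => by
        simp only [Fin.val_succ, Fin.val_castSucc, Fin.ext_iff, htake i i.2, List.count_append]
        cases w[i]'(by lia) <;> simp }
  refine ⟨γ, List.ext_getElem (by simp [hlen]) fun i hi hi' => ?_⟩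
  have hi'' : i < n + k := by lia
  simp only [word, List.getElem_ofFn, γ, Fin.ext_iff, Fin.val_succ, Fin.val_castSucc, htake i hi'',
    List.count_append]
  cases w[i] <;> simp

lemma sum_word {A : Type*} [AddCommMonoid A] (f : List Bool → A) :
    ∑ γ : LatticePath n k, f γ.word = ∑ w ∈ words n k, f w :=
  Finset.sum_bij (fun γ _ => γ.word) (fun γ _ => γ.word_mem)
    (fun _ _ _ _ h => word_injective h) (fun w hw => by
      obtain ⟨γ, h⟩ := exists_word_eq hw
      exact ⟨γ, Finset.mem_univ _, h⟩) fun _ _ => rfl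

lemma area_eq_wordArea (γ : LatticePath n k) : γ.area = wordArea γ.word := by
  rw [wordArea_eq_sum, length_word, ← Fin.sum_univ_eq_sum_range
    (fun i => if γ.word[i]? = some true then (γ.word.take i).count false else 0), area]
  refine Finset.sum_congr rfl fun i _ => ?_
  have := (γ.point_eq_count i.castSucc).2
  rw [Fin.val_castSucc] at this
  rw [getElem?_word, this]
  simp

lemma ofFn_point {P : Type*} {Q : Type*} (γ : LatticePath n k) (x : Fin (n + 1) → P)
    (y : Fin (k + 1) → Q) : (List.ofFn fun p => (x (γ.point p).1, y (γ.point p).2)) =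
      gridPath (List.ofFn x) (List.ofFn y) γ.word := by
  have hw := mem_words.1 γ.word_mem
  have hlen := length_gridPath γ.word (List.ofFn x) (List.ofFn y) (by simp [hw]) (by simp [hw])
  refine List.ext_getElem (by rw [hlen, List.length_ofFn, length_word]) fun p hp hp' => ?_
  have hp'' : p < n + k + 1 := by simpa using hp
  have hc := γ.point_eq_count ⟨p, hp''⟩
  have h := getElem?_gridPath γ.word (List.ofFn x) (List.ofFn y) p (x (γ.point ⟨p, hp''⟩).1)
    (y (γ.point ⟨p, hp''⟩).2) (by simp; lia)
    (by rw [← hc.1, List.getElem?_ofFn]; simp [Fin.is_le]) (by rw [← hc.2, List.getElem?_ofFn]; simp [Fin.is_le])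
  rw [List.getElem?_eq_getElem hp'] at h
  rw [Option.some_injective _ h, List.getElem_ofFn]

end LatticePath

/-! ### The cross product of cycles is a cycle -/

section Cross

variable {V : Type v} {V' : Type w}

/-- Simplicial chains as chains of lists of vertices. -/
noncomputable def toLists [PartialOrder V] (X : AbstractSimplicialComplex V) (m : ℕ) :
    (orderedDelta X).Chain m →ₗ[ℤ] (List V →₀ ℤ) :=
  Finsupp.lmapDomain ℤ ℤ fun σ : IncreasingSimplex X m => List.ofFn σ.vertex

lemma toLists_single [PartialOrder V] {X : AbstractSimplicialComplex V} {m : ℕ}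
    (σ : IncreasingSimplex X m) (r : ℤ) :
    toLists X m (Finsupp.single σ r) = Finsupp.single (List.ofFn σ.vertex) r :=
  Finsupp.mapDomain_single

/-- Allows the cycle condition to be checked on lists, where no spanning or monotonicity has to be
carried along. -/
lemma toLists_injective [PartialOrder V] (X : AbstractSimplicialComplex V) (m : ℕ) :
    Function.Injective (toLists X m) :=
  Finsupp.mapDomain_injective fun _ _ h => IncreasingSimplex.ext (List.ofFn_injective h)

lemma hasLength_toLists [PartialOrder V] (X : AbstractSimplicialComplex V) (m : ℕ)
    (c : (orderedDelta X).Chain m) : HasLength (m + 1) (toLists X m c) := by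
  classical
  intro l hl
  obtain ⟨σ, -, rfl⟩ := Finset.mem_image.1 (Finsupp.mapDomain_support hl)
  simp

lemma chainBoundary_toLists [PartialOrder V] (X : AbstractSimplicialComplex V) (m : ℕ)
    (c : (orderedDelta X).Chain (m + 1)) :
    chainBoundary (toLists X (m + 1) c) = toLists X m ((orderedDelta X).boundary m c) := by
  have : chainBoundary.comp (toLists X (m + 1)) =
      (toLists X m).comp ((orderedDelta X).boundary m) := by
    refine Finsupp.lhom_ext' fun σ => LinearMap.ext_ring ?_
    have h := toLists_single (σ : IncreasingSimplex X (m + 1)) 1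
    simp only [LinearMap.comp_apply, Finsupp.lsingle_apply]
    rw [h, chainBoundary_single, listBoundary_ofFn, DeltaSet.boundary,
      Finsupp.linearCombination_single, one_smul, map_sum]
    refine Finset.sum_congr rfl fun i _ => ?_
    rw [map_smul]
    exact congrArg _ (toLists_single ((orderedDelta X).face i σ) 1).symm
  exact LinearMap.congr_fun this c

variable [LinearOrder V] [LinearOrder V'] {X : AbstractSimplicialComplex V}
  {X' : AbstractSimplicialComplex V'} {n k : ℕ}

lemma toLists_cross (z : (orderedDelta X).Chain n) (z' : (orderedDelta X').Chain k) :
    toLists _ _ (cross z z') = chainShuffle (toLists X n z) (toLists X' k z') := by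
  have hz : z = z.sum Finsupp.single := (Finsupp.sum_single z).symm
  have hz' : z' = z'.sum Finsupp.single := (Finsupp.sum_single z').symm
  conv_rhs => rw [hz, hz']
  simp only [cross, Finsupp.sum, map_sum, LinearMap.sum_apply]
  rw [Finset.sum_comm]
  refine Finset.sum_congr rfl fun σ' _ => ?_
  refine Finset.sum_congr rfl fun σ _ => ?_
  have e := toLists_single (show IncreasingSimplex X n from σ) (z σ)
  have e' := toLists_single (show IncreasingSimplex X' k from σ') (z' σ')
  rw [e, e', chainShuffle_single_single, shuffle_eq_sum n k _ _ (by simp) (by simp),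
    ← LatticePath.sum_word (A := List (V × V') →₀ ℤ) (fun w => (-1 : ℤ) ^ wordArea w • Finsupp.single (gridPath _ _ w) 1),
    Finset.smul_sum]
  refine Finset.sum_congr rfl fun γ _ => ?_
  refine (toLists_single (γ.simplex (show IncreasingSimplex X n from σ)
    (show IncreasingSimplex X' k from σ')) _).trans ?_
  rw [← γ.ofFn_point, ← γ.area_eq_wordArea, Finsupp.smul_single, Finsupp.smul_single, smul_eq_mul,
    smul_eq_mul, mul_one]
  rfl

/-- By the Leibniz rule for lists. Positive dimension of both factors is essential to the argument:
in degree zero every chain counts as a cycle, whereas its augmented boundary need not vanish. -/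
lemma cross_mem_cycles (hn : 0 < n) (hk : 0 < k) (z : (orderedDelta X).cycles n)
    (z' : (orderedDelta X').cycles k) :
    cross z.1 z'.1 ∈ (orderedDelta (stdProduct X X')).cycles (n + k) := by
  obtain ⟨n, rfl⟩ : ∃ m, n = m + 1 := ⟨n - 1, by lia⟩
  obtain ⟨k, rfl⟩ : ∃ m, k = m + 1 := ⟨k - 1, by lia⟩
  have hz : (orderedDelta X).boundary n z.1 = 0 := z.2
  have hz' : (orderedDelta X').boundary k z'.1 = 0 := z'.2
  change (orderedDelta (stdProduct X X')).boundary (n + 1 + k)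
    (cross (n := n + 1) (k := k + 1) z.1 z'.1) = 0
  apply toLists_injective
  rw [map_zero, ← chainBoundary_toLists]
  refine (congrArg chainBoundary (toLists_cross z.1 z'.1)).trans ?_
  rw [chainBoundary_chainShuffle _ (hasLength_toLists X (n + 1) z.1), chainBoundary_toLists,
    chainBoundary_toLists, hz, hz']
  simp

end Cross

/-! ### Transport along a lattice path -/

section Transport

variable {K : Type u} [Field K] [LinearOrder K] [IsStrictOrderedRing K]

/-- The numbers at the vertices of a path with given row sums and column sums. -/
def transport : List K → List K → List Bool → List K
  -- At the endpoint the two remaining sums agree when the totals of the lists do, so either could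
  -- be recorded.
  | a :: _, _ :: _, [] => [a]
  -- Before a step to the right the current point is the last one with its first coordinate, so it
  -- must carry all that is left of `a`; this amount is also deducted from `b`. An upward step is
  -- symmetric.
  | a :: as, b :: bs, true :: w => a :: transport as ((b - a) :: bs) w
  | a :: as, b :: bs, false :: w => b :: transport ((a - b) :: as) bs w
  | _, _, _ => []

/-- Induction along a path, for a pair of lists of the sizes of its projections. -/
lemma word_induction {α β : Type*} {p : List Bool → List α → List β → Prop}
    (hnil : ∀ a b, p [] [a] [b])
    (htrue : ∀ w a as b bs, as.length = w.count true + 1 → bs.length = w.count false →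
      (∀ b', p w as (b' :: bs)) → p (true :: w) (a :: as) (b :: bs))
    (hfalse : ∀ w a as b bs, as.length = w.count true → bs.length = w.count false + 1 →
      (∀ a', p w (a' :: as) bs) → p (false :: w) (a :: as) (b :: bs))
    (w : List Bool) : ∀ (as : List α) (bs : List β), as.length = w.count true + 1 →
      bs.length = w.count false + 1 → p w as bs := by
  induction w with
  | nil =>
    rintro (_ | ⟨a, _ | _⟩) (_ | ⟨b, _ | _⟩) h h' <;> simp at h h'
    exact hnil a b
  | cons c w ih =>
    rintro (_ | ⟨a, as⟩) (_ | ⟨b, bs⟩) h h'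
    · simp at h
    · simp at h
    · simp at h'
    · cases c
      · simp only [List.length_cons, List.count_cons_self, Nat.add_right_cancel_iff, ne_eq,
          not_false_eq_true, List.count_cons_of_ne, Bool.false_eq_true] at h h'
        exact hfalse w a as b bs h h' fun a' => ih _ _ (by simp [h]) h'
      · simp only [List.length_cons, List.count_cons_self, Nat.add_right_cancel_iff, ne_eq,
          Bool.true_eq_false, not_false_eq_true, List.count_cons_of_ne] at h h'
        exact htrue w a as b bs h h' fun b' => ih _ _ h (by simp [h'])

lemma length_transport (w : List Bool) (as bs : List K) (ha : as.length = w.count true + 1)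
    (hb : bs.length = w.count false + 1) : (transport as bs w).length = w.length + 1 := by
  refine word_induction (p := fun w as bs => (transport as bs w).length = w.length + 1)
    ?_ ?_ ?_ w as bs ha hb
  · simp [transport]
  · intro w a as b bs _ _ ih
    simp [transport, ih]
  · intro w a as b bs _ _ ih
    simp [transport, ih]

/-- The weighted sum of a list of vectors. -/
def weightedSum {M : Type*} [AddCommGroup M] [Module K M] (as : List K) (xs : List M) : M :=
  (List.zipWith (fun a x => a • x) as xs).sum

section WeightedSum

variable {M : Type*} [AddCommGroup M] [Module K M]

@[simp]
lemma weightedSum_nil (xs : List M) : weightedSum ([] : List K) xs = 0 := by simp [weightedSum]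

@[simp]
lemma weightedSum_cons (a : K) (as : List K) (x : M) (xs : List M) :
    weightedSum (a :: as) (x :: xs) = a • x + weightedSum as xs := by simp [weightedSum]

lemma weightedSum_ofFn : ∀ {m : ℕ} (a : Fin m → K) (x : Fin m → M),
    weightedSum (List.ofFn a) (List.ofFn x) = ∑ i, a i • x i
  | 0, a, x => by simp
  | m + 1, a, x => by
    rw [List.ofFn_succ, List.ofFn_succ, weightedSum_cons, weightedSum_ofFn, Fin.sum_univ_succ]

/-- The numbers on the path have the prescribed sums in both directions, so weighting `x + y` by
them separates into the two original weighted sums. Equality of the totals enters at the endpoint.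
In the application both sums on the right are linear relations, so the numbers form a relation too.
-/
lemma weightedSum_transport (w : List Bool) (as bs : List K) (ha : as.length = w.count true + 1)
    (hb : bs.length = w.count false + 1) (hab : as.sum = bs.sum) :
    ∀ xs ys : List M, xs.length = as.length → ys.length = bs.length →
      weightedSum (transport as bs w) ((gridPath xs ys w).map fun q => q.1 + q.2) =
        weightedSum as xs + weightedSum bs ys := by
  refine word_induction (p := fun w as bs => as.sum = bs.sum → ∀ xs ys : List M,
      xs.length = as.length → ys.length = bs.length →
      weightedSum (transport as bs w) ((gridPath xs ys w).map fun q => q.1 + q.2) =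
        weightedSum as xs + weightedSum bs ys) ?_ ?_ ?_ w as bs ha hb hab
  · rintro a b h (_ | ⟨x, _ | _⟩) (_ | ⟨y, _ | _⟩) hx hy <;> simp at hx hy h
    subst h
    simp [transport, gridPath]
  · rintro w a as b bs _ _ ih h (_ | ⟨x, xs⟩) (_ | ⟨y, ys⟩) hx hy <;> simp at hx hy h
    simp only [transport, gridPath, List.map_cons, weightedSum_cons]
    rw [ih (b - a) (by rw [List.sum_cons]; linear_combination h) xs (y :: ys) hx (by simp [hy]),
      weightedSum_cons]
    module
  · rintro w a as b bs _ _ ih h (_ | ⟨x, xs⟩) (_ | ⟨y, ys⟩) hx hy <;> simp at hx hy h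
    simp only [transport, gridPath, List.map_cons, weightedSum_cons]
    rw [ih (a - b) (by rw [List.sum_cons]; linear_combination h) (x :: xs) ys (by simp [hx]) hy,
      weightedSum_cons]
    module

end WeightedSum

lemma sum_transport (w : List Bool) (as bs : List K) (ha : as.length = w.count true + 1)
    (hb : bs.length = w.count false + 1) (hab : as.sum = bs.sum) :
    (transport as bs w).sum = as.sum := by
  refine word_induction (p := fun w as bs => as.sum = bs.sum →
    (transport as bs w).sum = as.sum) ?_ ?_ ?_ w as bs ha hb hab
  · simp [transport]
  · intro w a as b bs _ _ ih h
    simp only [List.sum_cons] at h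
    rw [transport, List.sum_cons, List.sum_cons,
      ih _ (by rw [List.sum_cons]; linear_combination h)]
  · intro w a as b bs _ _ ih h
    simp only [List.sum_cons] at h
    rw [transport, List.sum_cons, List.sum_cons,
      ih _ (by rw [List.sum_cons]; linear_combination h), List.sum_cons]
    ring

lemma transport_neg (w : List Bool) (as bs : List K) (ha : as.length = w.count true + 1)
    (hb : bs.length = w.count false + 1) :
    transport (as.map Neg.neg) (bs.map Neg.neg) w = (transport as bs w).map Neg.neg := by
  refine word_induction (p := fun w as bs =>
    transport (as.map Neg.neg) (bs.map Neg.neg) w = (transport as bs w).map Neg.neg)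
    ?_ ?_ ?_ w as bs ha hb
  · simp [transport]
  · intro w a as b bs _ _ ih
    simp only [List.map_cons, transport, ← ih]
    rw [neg_sub_neg, neg_sub]
  · intro w a as b bs _ _ ih
    simp only [List.map_cons, transport, ← ih]
    rw [neg_sub_neg, neg_sub]

/-- Each prescribed number is a nonempty sum of numbers on the path. -/
lemma pos_of_transport_pos (w : List Bool) (as bs : List K) (ha : as.length = w.count true + 1)
    (hb : bs.length = w.count false + 1) (hab : as.sum = bs.sum)
    (h : ∀ c ∈ transport as bs w, 0 < c) : (∀ a ∈ as, 0 < a) ∧ ∀ b ∈ bs, 0 < b := by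
  refine word_induction (p := fun w as bs => as.sum = bs.sum →
    (∀ c ∈ transport as bs w, 0 < c) → (∀ a ∈ as, 0 < a) ∧ ∀ b ∈ bs, 0 < b)
    ?_ ?_ ?_ w as bs ha hb hab h
  · intro a b hab h
    simp_all [transport]
  · intro w a as b bs _ _ ih hab h
    simp only [transport, List.forall_mem_cons, List.sum_cons] at h hab ⊢
    have := ih _ (by rw [List.sum_cons]; linear_combination hab) h.2
    simp only [List.forall_mem_cons] at this
    exact ⟨⟨h.1, this.1⟩, by linarith [this.2.1, h.1], this.2.2⟩
  · intro w a as b bs _ _ ih hab h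
    simp only [transport, List.forall_mem_cons, List.sum_cons] at h hab ⊢
    have := ih _ (by rw [List.sum_cons]; linear_combination hab) h.2
    simp only [List.forall_mem_cons] at this
    exact ⟨⟨by linarith [this.1.1, h.1], this.1.2⟩, h.1, this.2⟩

/-- The partial sums of two lists are different, except possibly for the total sums. -/
def PartialSumsNe (as bs : List K) : Prop :=
  ∀ i j, 0 < i → 0 < j → i ≤ as.length → j ≤ bs.length → (i < as.length ∨ j < bs.length) →
    (as.take i).sum ≠ (bs.take j).sum

lemma PartialSumsNe.symm {as bs : List K} (h : PartialSumsNe as bs) : PartialSumsNe bs as :=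
  fun i j hi hj hi' hj' hij => (h j i hj hi hj' hi' hij.symm).symm

/-- The first number of the path is subtracted from both partial sums, so their differences persist.
This lets the condition pass along the recursion of `transport`. -/
lemma PartialSumsNe.right {a b : K} {as bs : List K} (h : PartialSumsNe (a :: as) (b :: bs)) :
    PartialSumsNe as ((b - a) :: bs) := by
  intro i j hi hj hi' hj' hij heq
  obtain ⟨j, rfl⟩ : ∃ l, j = l + 1 := ⟨j - 1, by lia⟩
  simp only [List.length_cons] at hj' hij
  apply h (i + 1) (j + 1) (by lia) (by lia) (by simpa using hi') (by simpa using hj') (by simp; lia)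
  simp only [List.take_succ_cons, List.sum_cons] at heq ⊢
  linear_combination heq

lemma PartialSumsNe.up {a b : K} {as bs : List K} (h : PartialSumsNe (a :: as) (b :: bs)) :
    PartialSumsNe ((a - b) :: as) bs := h.symm.right.symm

lemma PartialSumsNe.head_ne {a b : K} {as bs : List K} (h : PartialSumsNe (a :: as) (b :: bs))
    (hl : 0 < as.length ∨ 0 < bs.length) : a ≠ b := by
  simpa using h 1 1 one_pos one_pos (by simp) (by simp) (by simpa using hl)

lemma PartialSumsNe.neg {as bs : List K} (h : PartialSumsNe as bs) :
    PartialSumsNe (as.map Neg.neg) (bs.map Neg.neg) := by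
  intro i j hi hj hi' hj' hij heq
  simp only [List.length_map] at hi' hj' hij
  apply h i j hi hj hi' hj' hij
  have hs : ∀ l : List K, (l.map Neg.neg).sum = - l.sum := fun l => by
    induction l with
    | nil => simp
    | cons a l ih => rw [List.map_cons, List.sum_cons, List.sum_cons, ih]; ring
  rw [← List.map_take, ← List.map_take, hs, hs] at heq
  exact neg_injective heq

/-- Apart from entries of the lists themselves, the numbers met along the path are, up to sign,
differences of partial sums of the two lists. The totals, which agree in the application, are exempt
because their difference never occurs as a number on the path. -/
lemma transport_ne_zero (w : List Bool) (as bs : List K) (ha : as.length = w.count true + 1)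
    (hb : bs.length = w.count false + 1) (hab : PartialSumsNe as bs) (ha0 : ∀ a ∈ as, a ≠ 0)
    (hb0 : ∀ b ∈ bs, b ≠ 0) : ∀ c ∈ transport as bs w, c ≠ 0 := by
  refine word_induction (p := fun w as bs => PartialSumsNe as bs → (∀ a ∈ as, a ≠ 0) →
    (∀ b ∈ bs, b ≠ 0) → ∀ c ∈ transport as bs w, c ≠ 0) ?_ ?_ ?_ w as bs ha hb hab ha0 hb0
  · intro a b _ ha _
    simpa [transport] using ha
  · intro w a as b bs hl _ ih h ha hb
    simp only [transport, List.forall_mem_cons] at ha hb ⊢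
    refine ⟨ha.1, ih _ h.right ha.2 ?_⟩
    rw [List.forall_mem_cons]
    exact ⟨sub_ne_zero.2 (h.head_ne (Or.inl (by lia))).symm, hb.2⟩
  · intro w a as b bs _ hl ih h ha hb
    simp only [transport, List.forall_mem_cons] at ha hb ⊢
    refine ⟨hb.1, ih _ h.up ?_ hb.2⟩
    rw [List.forall_mem_cons]
    exact ⟨sub_ne_zero.2 (h.head_ne (Or.inr (by lia))), ha.2⟩

/-- The north-west corner rule: exactly one path carries positive numbers. -/
lemma sum_transport_pos : ∀ (i j : ℕ) (as bs : List K), as.length = i + 1 → bs.length = j + 1 →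
    as.sum = bs.sum → PartialSumsNe as bs → (∀ a ∈ as, 0 < a) → (∀ b ∈ bs, 0 < b) →
    ∑ w ∈ words i j, (if ∀ c ∈ transport as bs w, 0 < c then 1 else 0 : ℤ) = 1
  | 0, 0, [a], [b], _, _, _, _, ha, _ => by
    have h0 : 0 < a := ha a (by simp)
    rw [words, Finset.sum_singleton, if_pos]
    simpa [transport] using h0
  | i + 1, 0, a :: as, [b], hla, hlb, hab, h, ha, hb => by
    simp only [List.forall_mem_cons, List.sum_cons] at hab ha hb
    have hla' : as.length = i + 1 := by simpa using hla
    -- The path is forced, and `b - a` equals the positive sum of the remaining entries.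
    have hpos : 0 < as.sum := List.sum_pos as ha.2 (by rintro rfl; simp at hla')
    rw [sum_words_succ_zero]
    simp only [transport, List.forall_mem_cons, ha.1, true_and]
    refine sum_transport_pos i 0 _ _ hla' (by simp) ?_ h.right ha.2 ?_
    · rw [List.sum_cons]; linear_combination hab
    · rw [List.forall_mem_cons]
      refine ⟨?_, hb.2⟩
      simp only [List.sum_nil] at hab
      linarith
  | 0, j + 1, [a], b :: bs, hla, hlb, hab, h, ha, hb => by
    simp only [List.forall_mem_cons, List.sum_cons] at hab ha hb
    have hlb' : bs.length = j + 1 := by simpa using hlb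
    have hpos : 0 < bs.sum := List.sum_pos bs hb.2 (by rintro rfl; simp at hlb')
    rw [sum_words_zero_succ]
    simp only [transport, List.forall_mem_cons, hb.1, true_and]
    refine sum_transport_pos 0 j _ _ (by simp) hlb' ?_ h.up ?_ hb.2
    · rw [List.sum_cons]; linear_combination hab
    · rw [List.forall_mem_cons]
      refine ⟨?_, ha.2⟩
      simp only [List.sum_nil] at hab
      linarith
  | i + 1, j + 1, a :: as, b :: bs, hla, hlb, hab, h, ha, hb => by
    simp only [List.forall_mem_cons, List.sum_cons] at hab ha hb
    have hla' : as.length = i + 1 := by simpa using hla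
    have hlb' : bs.length = j + 1 := by simpa using hlb
    have e1 : as.sum = ((b - a) :: bs).sum := by rw [List.sum_cons]; linear_combination hab
    have e2 : ((a - b) :: as).sum = bs.sum := by rw [List.sum_cons]; linear_combination hab
    rw [sum_words_succ_succ]
    simp only [transport, List.forall_mem_cons, ha.1, hb.1, true_and]
    -- The smaller of `a` and `b` must be used up first: the other step would leave the negative
    -- remainder `a - b` or `b - a`, excluded by `pos_of_transport_pos`.
    rcases lt_or_gt_of_ne (h.head_ne (Or.inl (by lia))) with hlt | hlt
    · rw [sum_transport_pos i (j + 1) _ _ hla' (by simp [hlb']) e1 h.right ha.2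
        (by rw [List.forall_mem_cons]; exact ⟨sub_pos.2 hlt, hb.2⟩), Finset.sum_eq_zero, add_zero]
      intro w hw
      rw [if_neg]
      intro hc
      obtain ⟨h1, h2⟩ := mem_words.1 hw
      have := (pos_of_transport_pos w _ _ (by simp [hla', h1]) (by simp [hlb', h2]) e2 hc).1 _
        List.mem_cons_self
      linarith
    · rw [sum_transport_pos (i + 1) j _ _ (by simp [hla']) hlb' e2 h.up
        (by rw [List.forall_mem_cons]; exact ⟨sub_pos.2 hlt, ha.2⟩) hb.2, Finset.sum_eq_zero,
        zero_add]
      intro w hw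
      rw [if_neg]
      intro hc
      obtain ⟨h1, h2⟩ := mem_words.1 hw
      have := (pos_of_transport_pos w _ _ (by simp [hla', h1]) (by simp [hlb', h2]) e1 hc).2 _
        List.mem_cons_self
      linarith

/-- `1` if all entries are positive, `-1` if all are negative, `0` otherwise. -/
def listSign (l : List K) : ℤ :=
  if ∀ x ∈ l, 0 < x then 1 else if ∀ x ∈ l, x < 0 then -1 else 0

lemma commonSign_eq_listSign {m : ℕ} (a : Fin m → K) : commonSign a = listSign (List.ofFn a) := by
  simp only [commonSign, listSign, List.forall_mem_ofFn_iff]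

lemma sum_map_mul (c : K) (l : List K) : (l.map fun x => c * x).sum = c * l.sum :=
  List.sum_map_mul_left l id c |>.trans (by simp)

lemma sum_map_neg (l : List K) : (l.map Neg.neg).sum = - l.sum := by
  simpa using sum_map_mul (-1) l

/-- The sign of the total excludes one of the two constant signs, so only one kind of path has to be
counted. -/
lemma listSign_of_sum_pos {l : List K} (h : 0 < l.sum) :
    listSign l = if ∀ x ∈ l, 0 < x then 1 else 0 := by
  rw [listSign, if_neg (c := ∀ x ∈ l, x < 0)]
  intro h'
  have := List.sum_nonneg (l := l.map Neg.neg) (by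
    intro x hx
    obtain ⟨y, hy, rfl⟩ := List.mem_map.1 hx
    exact neg_nonneg.2 (h' y hy).le)
  rw [sum_map_neg] at this
  linarith

lemma listSign_of_sum_neg {l : List K} (h : l.sum < 0) :
    listSign l = if ∀ x ∈ l, x < 0 then -1 else 0 := by
  rw [listSign, if_neg (c := ∀ x ∈ l, 0 < x)]
  intro h'
  exact h.not_ge (List.sum_nonneg fun x hx => (h' x hx).le)

lemma sum_ite_transport_pos {i j : ℕ} {as bs : List K} (ha : as.length = i + 1)
    (hb : bs.length = j + 1) (hab : as.sum = bs.sum) (h : PartialSumsNe as bs) :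
    ∑ w ∈ words i j, (if ∀ c ∈ transport as bs w, 0 < c then 1 else 0 : ℤ) =
      (if ∀ a ∈ as, 0 < a then 1 else 0) * (if ∀ b ∈ bs, 0 < b then 1 else 0) := by
  by_cases hpos : (∀ a ∈ as, 0 < a) ∧ ∀ b ∈ bs, 0 < b
  · rw [if_pos hpos.1, if_pos hpos.2, sum_transport_pos i j as bs ha hb hab h hpos.1 hpos.2]
    rfl
  · have h0 : (if ∀ a ∈ as, 0 < a then 1 else 0 : ℤ) * (if ∀ b ∈ bs, 0 < b then 1 else 0) = 0 := by
      rcases not_and_or.1 hpos with h | h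
      · rw [if_neg h, zero_mul]
      · rw [if_neg h, mul_zero]
    rw [h0]
    refine Finset.sum_eq_zero fun w hw => if_neg fun hc => hpos ?_
    obtain ⟨h1, h2⟩ := mem_words.1 hw
    exact pos_of_transport_pos w as bs (by lia) (by lia) hab hc

/-- Every path carries the same total `A B`, where `A` and `B` are the sums of `as` and `bs`. Its
sign decides whether all-positive or all-negative paths count, and the corner rule finds one or
none. The factors `B` and `A` may reverse the signs of the lists; the four sign cases compare this
with the product of the original signs. -/
lemma sum_listSign_transport {i j : ℕ} {as bs : List K} (ha : as.length = i + 1)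
    (hb : bs.length = j + 1) (hA : as.sum ≠ 0) (hB : bs.sum ≠ 0)
    (h : PartialSumsNe (as.map fun x => bs.sum * x) (bs.map fun x => as.sum * x)) :
    ∑ w ∈ words i j, listSign
      (transport (as.map fun x => bs.sum * x) (bs.map fun x => as.sum * x) w) =
      listSign as * listSign bs := by
  set as' := as.map fun x => bs.sum * x with has'
  set bs' := bs.map fun x => as.sum * x with hbs'
  have hla : as'.length = i + 1 := by simp [as', ha]
  have hlb : bs'.length = j + 1 := by simp [bs', hb]
  have hS : as'.sum = as.sum * bs.sum := by rw [has', sum_map_mul, mul_comm]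
  have hS' : bs'.sum = as.sum * bs.sum := by rw [hbs', sum_map_mul]
  have hsum : ∀ w ∈ words i j, (transport as' bs' w).sum = as.sum * bs.sum := by
    intro w hw
    obtain ⟨h1, h2⟩ := mem_words.1 hw
    rw [sum_transport w _ _ (by lia) (by lia) (hS.trans hS'.symm), hS]
  have hpos := sum_ite_transport_pos hla hlb (hS.trans hS'.symm) h
  -- Negative numbers are treated by negating both lists, which commutes with `transport`.
  have hneg := sum_ite_transport_pos (as := as'.map Neg.neg) (bs := bs'.map Neg.neg)
    (by simpa using hla) (by simpa using hlb)
    (by rw [sum_map_neg, sum_map_neg, hS, hS']) h.neg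
  have hneg' : ∑ w ∈ words i j, (if ∀ c ∈ transport as' bs' w, c < 0 then 1 else 0 : ℤ) =
      (if ∀ a ∈ as', a < 0 then 1 else 0) * (if ∀ b ∈ bs', b < 0 then 1 else 0) := by
    simp only [List.forall_mem_map, Left.neg_pos_iff] at hneg
    rw [← hneg]
    refine Finset.sum_congr rfl fun w hw => ?_
    obtain ⟨h1, h2⟩ := mem_words.1 hw
    simp only [transport_neg w as' bs' (by lia) (by lia), List.forall_mem_map, Left.neg_pos_iff]
  have e1 : ∑ w ∈ words i j, listSign (transport as' bs' w) =
      if 0 < as.sum * bs.sum then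
        (if ∀ a ∈ as', 0 < a then 1 else 0) * (if ∀ b ∈ bs', 0 < b then 1 else 0) else
      -((if ∀ a ∈ as', a < 0 then 1 else 0) * (if ∀ b ∈ bs', b < 0 then 1 else 0)) := by
    by_cases hs : 0 < as.sum * bs.sum
    · rw [if_pos hs, ← hpos]
      exact Finset.sum_congr rfl fun w hw => listSign_of_sum_pos (by rwa [hsum w hw])
    · have hs' : as.sum * bs.sum < 0 := lt_of_le_of_ne (not_lt.1 hs) (mul_ne_zero hA hB)
      rw [if_neg hs, ← hneg', ← Finset.sum_neg_distrib]
      refine Finset.sum_congr rfl fun w hw => ?_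
      rw [listSign_of_sum_neg (by rwa [hsum w hw])]
      split_ifs <;> rfl
  have P1 : ∀ {c x : K}, c < 0 → (0 < c * x ↔ x < 0) := fun hc => smul_pos_iff_of_neg_left hc
  have P2 : ∀ {c x : K}, c < 0 → (c * x < 0 ↔ 0 < x) := fun hc => smul_neg_iff_of_neg_left hc
  have P3 : ∀ {c x : K}, 0 < c → (c * x < 0 ↔ x < 0) := fun hc => smul_neg_iff_of_pos_left hc
  rw [e1, has', hbs']
  simp only [List.forall_mem_map]
  rcases lt_or_gt_of_ne hA with hA | hA <;> rcases lt_or_gt_of_ne hB with hB | hB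
  · rw [if_pos (mul_pos_of_neg_of_neg hA hB), listSign_of_sum_neg hA, listSign_of_sum_neg hB]
    simp only [P1 hA, P1 hB]
    split_ifs <;> rfl
  · rw [if_neg (mul_neg_of_neg_of_pos hA hB).not_gt, listSign_of_sum_neg hA,
      listSign_of_sum_pos hB]
    simp only [P2 hA, P3 hB]
    split_ifs <;> rfl
  · rw [if_neg (mul_neg_of_pos_of_neg hA hB).not_gt, listSign_of_sum_pos hA,
      listSign_of_sum_neg hB]
    simp only [P3 hA, P2 hB]
    split_ifs <;> rfl
  · rw [if_pos (mul_pos hA hB), listSign_of_sum_pos hA, listSign_of_sum_pos hB]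
    simp only [mul_pos_iff_of_pos_left hA, mul_pos_iff_of_pos_left hB]

end Transport

/-! ### Minors of the vectors along a lattice path -/

section Differences

variable {M : Type*} [AddCommGroup M]

/-- The successive differences of a list. -/
def differences : List M → List M
  | a :: b :: l => (b - a) :: differences (b :: l)
  | _ => []

lemma differences_ofFn : ∀ {m : ℕ} (f : Fin (m + 1) → M),
    differences (List.ofFn f) = List.ofFn fun i : Fin m => f i.succ - f i.castSucc
  | 0, f => by simp [differences]
  | m + 1, f => by
    have h := differences_ofFn fun i : Fin (m + 1) => f i.succ
    rw [List.ofFn_succ] at h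
    rw [List.ofFn_succ, List.ofFn_succ, differences, h, List.ofFn_succ]
    rfl

/-- Two lists merged according to a word. -/
def interleave : List M → List M → List Bool → List M
  | h :: hs, gs, true :: w => h :: interleave hs gs w
  | hs, g :: gs, false :: w => g :: interleave hs gs w
  | _, _, _ => []

lemma gridPath_cons {P Q : Type*} (x : P) (xs : List P) (y : Q) (ys : List Q) (w : List Bool) :
    ∃ l, gridPath (x :: xs) (y :: ys) w = (x, y) :: l := by
  rcases w with _ | ⟨_ | _, w⟩ <;> exact ⟨_, by rw [gridPath]⟩

/-- Each step changes only one coordinate, so the difference along it is a difference of `xs` or of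
`ys`. -/
lemma differences_gridPath (w : List Bool) (xs ys : List M) (hx : xs.length = w.count true + 1)
    (hy : ys.length = w.count false + 1) :
    differences ((gridPath xs ys w).map fun q => q.1 + q.2) =
      interleave (differences xs) (differences ys) w := by
  refine word_induction (p := fun w xs ys =>
    differences ((gridPath xs ys w).map fun q => q.1 + q.2) =
      interleave (differences xs) (differences ys) w) ?_ ?_ ?_ w xs ys hx hy
  · intro x y
    simp [gridPath, differences, interleave]
  · rintro w x (_ | ⟨x', xs⟩) y ys hx _ ih
    · simp at hx
    · obtain ⟨l, hl⟩ := gridPath_cons x' xs y ys w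
      have h := ih y
      rw [hl] at h
      rw [gridPath, hl, differences, interleave, ← h]
      simp [differences]
  · rintro w x xs y (_ | ⟨y', ys⟩) _ hy ih
    · simp at hy
    · obtain ⟨l, hl⟩ := gridPath_cons x xs y' ys w
      have h := ih x
      rw [hl] at h
      rw [gridPath, hl]
      simp only [differences, List.map_cons] at h ⊢
      rw [h]
      cases xs <;> simp [differences, interleave]

end Differences

/-! ### Signs of shuffles in the exterior algebra -/

section Exterior

variable {K : Type u} [Field K] {M : Type*} [AddCommGroup M] [Module K M]

lemma ι_mul_prod (g : M) (hs : List M) :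
    ExteriorAlgebra.ι K g * (hs.map (ExteriorAlgebra.ι K)).prod =
      (-1 : K) ^ hs.length • ((hs.map (ExteriorAlgebra.ι K)).prod * ExteriorAlgebra.ι K g) := by
  induction hs with
  | nil => simp
  | cons h hs ih =>
    have hgh : ExteriorAlgebra.ι K g * ExteriorAlgebra.ι K h =
        - (ExteriorAlgebra.ι K h * ExteriorAlgebra.ι K g) :=
      eq_neg_of_add_eq_zero_left (ExteriorAlgebra.ι_add_mul_swap g h)
    rw [List.map_cons, List.prod_cons, ← mul_assoc, hgh, neg_mul, mul_assoc, ih, List.length_cons,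
      pow_succ, mul_smul_comm, mul_assoc, mul_neg_one, neg_smul]

/-- Sorting the factors moves each upward difference past all later horizontal ones. The number of
transpositions is the area under the path. -/
lemma prod_interleave (w : List Bool) : ∀ hs gs : List M, hs.length = w.count true →
    gs.length = w.count false →
    ((interleave hs gs w).map (ExteriorAlgebra.ι K)).prod =
      (-1 : K) ^ wordArea w • ((hs.map (ExteriorAlgebra.ι K)).prod *
        (gs.map (ExteriorAlgebra.ι K)).prod) := by
  induction w with
  | nil =>
    rintro (_ | ⟨h, hs⟩) (_ | ⟨g, gs⟩) h1 h2 <;> simp at h1 h2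
    simp [interleave, wordArea]
  | cons b w ih =>
    cases b
    · rintro hs (_ | ⟨g, gs⟩) h1 h2
      · simp at h2
      · have h1' : hs.length = w.count true := by simpa using h1
        have e : interleave hs (g :: gs) (false :: w) = g :: interleave hs gs w := by
          cases hs <;> rfl
        rw [e, List.map_cons, List.prod_cons, ih hs gs h1' (by simpa using h2), wordArea,
          mul_smul_comm, ← mul_assoc, ι_mul_prod, smul_mul_assoc, smul_smul, h1', pow_add,
          mul_comm ((-1 : K) ^ _), mul_assoc, List.map_cons, List.prod_cons]
    · rintro (_ | ⟨h, hs⟩) gs h1 h2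
      · simp at h1
      · have e : interleave (h :: hs) gs (true :: w) = h :: interleave hs gs w := rfl
        rw [e, List.map_cons, List.prod_cons, ih hs gs (by simpa using h1) (by simpa using h2),
          wordArea, mul_smul_comm, ← mul_assoc, List.map_cons, List.prod_cons]

/-- The determinant as a linear form on the exterior algebra. -/
noncomputable def detForm (K : Type u) [Field K] (N : ℕ) :
    ExteriorAlgebra K (Fin N → K) →ₗ[K] K :=
  ExteriorAlgebra.liftAlternating (Pi.single N Matrix.detRowAlternating)

lemma detForm_prod {N : ℕ} (d : Fin N → Fin N → K) :
    detForm K N ((List.ofFn d).map (ExteriorAlgebra.ι K)).prod = (Matrix.of d).det := by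
  have h := ExteriorAlgebra.ιMulti_apply (R := K) d
  rw [List.map_ofFn]
  change detForm K N (List.ofFn fun i => ExteriorAlgebra.ι K (d i)).prod = _
  rw [← h, detForm, ExteriorAlgebra.liftAlternating_apply_ιMulti, Pi.single_eq_same]
  rfl

end Exterior

/-! ### Minors along a path and multiplicativity of the degree -/

section Minors

variable {K : Type u} [Field K] [LinearOrder K] [IsStrictOrderedRing K] {n k : ℕ}

/-- Expand the determinant of the matrix bordered by a column of ones. Subtracting from each row its
predecessor clears that column except for its first entry and leaves the successive differences. -/
lemma sum_minor (v : Fin (n + 1) → Fin n → K) :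
    ∑ p, minor v p = (Matrix.of fun i : Fin n => v i.succ - v i.castSucc).det := by
  let A : Matrix (Fin (n + 1)) (Fin (n + 1)) K := Matrix.of fun r => Fin.cons 1 (v r)
  let B : Matrix (Fin (n + 1)) (Fin (n + 1)) K := Matrix.of (Fin.cons (Fin.cons 1 (v 0))
    fun i : Fin n => Fin.cons 0 (v i.succ - v i.castSucc))
  have hA : A.det = ∑ p, minor v p := by
    rw [Matrix.det_succ_column_zero]
    refine Finset.sum_congr rfl fun p _ => ?_
    rw [minor, show A p 0 = 1 from rfl, mul_one]
    rfl
  have hB : B.det = (Matrix.of fun i : Fin n => v i.succ - v i.castSucc).det := by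
    rw [Matrix.det_succ_column_zero, Fin.sum_univ_succ, Finset.sum_eq_zero]
    · simp only [Fin.val_zero, pow_zero, one_mul, add_zero]
      rw [show B 0 0 = 1 from rfl, one_mul]
      rfl
    · intro i _
      rw [show B i.succ 0 = 0 by simp [B]]
      simp
  rw [← hA, ← hB]
  refine Matrix.det_eq_of_forall_row_eq_smul_add_pred (fun _ => 1) ?_ ?_
  · intro j
    rfl
  · intro i j
    refine Fin.cases ?_ (fun j => ?_) j
    · simp [A, B]
    · simp [A, B]

/-- The vectors along a lattice path, for two tuples of vectors. -/
def gridVectors (v : Fin (n + 1) → Fin n → K) (v' : Fin (k + 1) → Fin k → K)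
    (γ : LatticePath n k) (p : Fin (n + k + 1)) : Fin (n + k) → K :=
  Fin.append (v (γ.point p).1) (v' (γ.point p).2)

/-- Extension of a vector by zeros at the end. -/
def extendRight (n k : ℕ) : (Fin n → K) →ₗ[K] (Fin (n + k) → K) where
  toFun x := Fin.append x 0
  map_add' x y := by ext i; refine Fin.addCases (fun i => ?_) (fun i => ?_) i <;> simp
  map_smul' c x := by ext i; refine Fin.addCases (fun i => ?_) (fun i => ?_) i <;> simp

/-- Extension of a vector by zeros at the beginning. -/
def extendLeft (n k : ℕ) : (Fin k → K) →ₗ[K] (Fin (n + k) → K) where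
  toFun x := Fin.append 0 x
  map_add' x y := by ext i; refine Fin.addCases (fun i => ?_) (fun i => ?_) i <;> simp
  map_smul' c x := by ext i; refine Fin.addCases (fun i => ?_) (fun i => ?_) i <;> simp

lemma extendRight_add_extendLeft (x : Fin n → K) (y : Fin k → K) :
    extendRight n k x + extendLeft n k y = Fin.append x y := by
  ext i
  refine Fin.addCases (fun i => ?_) (fun i => ?_) i <;> simp [extendRight, extendLeft]

variable (v : Fin (n + 1) → Fin n → K) (v' : Fin (k + 1) → Fin k → K) (γ : LatticePath n k)

lemma ofFn_gridVectors : List.ofFn (gridVectors v v' γ) =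
    (gridPath (List.ofFn fun i => extendRight n k (v i)) (List.ofFn fun j => extendLeft n k (v' j))
      γ.word).map fun q => q.1 + q.2 := by
  rw [← γ.ofFn_point, List.map_ofFn]
  congr 1
  funext p
  exact (extendRight_add_extendLeft _ _).symm

lemma det_append (h : Fin n → Fin n → K) (g : Fin k → Fin k → K) :
    (Matrix.of (Fin.append (fun i => extendRight n k (h i)) fun j => extendLeft n k (g j))).det =
      (Matrix.of h).det * (Matrix.of g).det := by
  rw [← det_blockMatrix n k (Matrix.of h, Matrix.of g)]
  congr 1
  ext a b
  refine Fin.addCases (fun a => ?_) (fun a => ?_) a <;>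
    refine Fin.addCases (fun b => ?_) (fun b => ?_) b <;>
    simp [blockMatrix, extendRight, extendLeft]

/-- The total of the minors is the determinant of the shuffled differences. Sorting them gives a
block diagonal matrix and costs the sign of the area. This fixes the scale in
`ofFn_minor_gridVectors`. -/
lemma sum_minor_gridVectors : ∑ p, minor (gridVectors v v' γ) p =
    (-1) ^ γ.area * ((∑ i, minor v i) * ∑ j, minor v' j) := by
  obtain ⟨h1, h2⟩ := mem_words.1 γ.word_mem
  rw [sum_minor, sum_minor, sum_minor, ← det_append, ← detForm_prod, ← detForm_prod,
    ← differences_ofFn, ofFn_gridVectors, differences_gridPath _ _ _ (by simp [h1]) (by simp [h2]),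
    differences_ofFn, differences_ofFn, prod_interleave _ _ _ (by simp [h1]) (by simp [h2]),
    map_smul, smul_eq_mul, γ.area_eq_wordArea, List.ofFn_fin_append, List.map_append,
    List.prod_append]
  simp only [map_sub]

/-- The minors of the vectors along a lattice path are given by the transport along the path. -/
lemma ofFn_minor_gridVectors (hA : ∑ i, minor v i ≠ 0) (hB : ∑ j, minor v' j ≠ 0) :
    List.ofFn (minor (gridVectors v v' γ)) =
      (transport ((List.ofFn (minor v)).map fun x => (List.ofFn (minor v')).sum * x)
        ((List.ofFn (minor v')).map fun x => (List.ofFn (minor v)).sum * x) γ.word).map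
          fun x => (-1) ^ γ.area * x := by
  obtain ⟨h1, h2⟩ := mem_words.1 γ.word_mem
  simp only [List.sum_ofFn, List.map_ofFn]
  set A := ∑ i, minor v i
  set B := ∑ j, minor v' j
  set as : List K := List.ofFn ((fun x => B * x) ∘ minor v) with has
  set bs : List K := List.ofFn ((fun x => A * x) ∘ minor v') with hbs
  have hla : as.length = γ.word.count true + 1 := by rw [has, List.length_ofFn, h1]
  have hlb : bs.length = γ.word.count false + 1 := by rw [hbs, List.length_ofFn, h2]
  have hsa : as.sum = A * B := by
    simp only [has, List.sum_ofFn, Function.comp_apply, ← Finset.mul_sum]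
    rw [mul_comm]
  have hsb : bs.sum = A * B := by
    simp only [hbs, List.sum_ofFn, Function.comp_apply, ← Finset.mul_sum]
    rfl
  obtain ⟨c, hc⟩ : ∃ c : Fin (n + k + 1) → K, List.ofFn c = transport as bs γ.word := by
    have hl := length_transport γ.word as bs hla hlb
    rw [γ.length_word] at hl
    exact ⟨fun i => (transport as bs γ.word)[i], List.ext_getElem (by simp [hl])
      fun i _ _ => by rw [List.getElem_ofFn]; rfl⟩
  have hsum : ∑ p, c p = A * B := by
    rw [← List.sum_ofFn, hc, sum_transport _ _ _ hla hlb (hsa.trans hsb.symm), hsa]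
  have hrel : ∑ p, c p • gridVectors v v' γ p = 0 := by
    rw [← weightedSum_ofFn, hc, ofFn_gridVectors, weightedSum_transport _ _ _ hla hlb
      (hsa.trans hsb.symm) _ _ (by simp [has]) (by simp [hbs]), has, hbs, weightedSum_ofFn,
      weightedSum_ofFn]
    simp only [Function.comp_apply, mul_smul, ← map_smul, ← map_sum, ← Finset.smul_sum,
      minor_relation, smul_zero, map_zero, add_zero]
  have htot := sum_minor_gridVectors v v' γ
  have hsq : ((-1 : K) ^ γ.area) * ((-1) ^ γ.area) = 1 := by rw [← mul_pow]; simp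
  have hs0 : ((-1 : K) ^ γ.area) ≠ 0 := pow_ne_zero _ (by simp)
  -- Proportionality of a relation to the minors requires one nonzero minor; it exists because the
  -- total is nonzero.
  obtain ⟨p, -, hp⟩ := Finset.exists_ne_zero_of_sum_ne_zero
    (htot.trans_ne (mul_ne_zero hs0 (mul_ne_zero hA hB)))
  have hprop := minor_of_relation _ p hp c hrel
  -- Summing the proportionality over all indices compares the totals `A B` and `(-1)^area A B`,
  -- which gives the factor.
  have hpp : minor (gridVectors v v' γ) p = (-1) ^ γ.area * c p := by
    have h := Finset.sum_congr rfl fun l (_ : l ∈ Finset.univ) => hprop l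
    rw [← Finset.sum_mul, ← Finset.mul_sum, htot, hsum] at h
    apply mul_left_cancel₀ (mul_ne_zero hA hB)
    rw [h]
    ring
  have hcp : c p ≠ 0 := by
    intro h
    rw [h, mul_zero] at hpp
    exact hp hpp
  rw [← hc, List.map_ofFn]
  congr 1
  funext l
  apply mul_left_cancel₀ hcp
  rw [← hprop l, hpp, Function.comp_apply]
  ring

-- Genericity of the factors passes to the product: up to sign the minors are the numbers of the
-- transport, which avoid zero by the condition on partial sums. Thus the product section can be
-- used in `pairing_eu0`.
variable {v v'} in
lemma minor_gridVectors_ne_zero (hA : ∑ i, minor v i ≠ 0) (hB : ∑ j, minor v' j ≠ 0)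
    (hv : ∀ i, minor v i ≠ 0) (hv' : ∀ j, minor v' j ≠ 0)
    (h : PartialSumsNe ((List.ofFn (minor v)).map fun x => (List.ofFn (minor v')).sum * x)
        ((List.ofFn (minor v')).map fun x => (List.ofFn (minor v)).sum * x))
    (p : Fin (n + k + 1)) : minor (gridVectors v v' γ) p ≠ 0 := by
  obtain ⟨h1, h2⟩ := mem_words.1 γ.word_mem
  have hp : minor (gridVectors v v' γ) p ∈ List.ofFn (minor (gridVectors v v' γ)) :=
    (List.mem_ofFn' _ _).2 ⟨p, rfl⟩
  rw [ofFn_minor_gridVectors v v' γ hA hB] at hp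
  obtain ⟨c, hc, hcp⟩ := List.mem_map.1 hp
  rw [← hcp]
  refine mul_ne_zero (pow_ne_zero _ (by simp)) (transport_ne_zero _ _ _ ?_ ?_ h ?_ ?_ c hc)
  · rw [List.length_map, List.length_ofFn, h1]
  · rw [List.length_map, List.length_ofFn, h2]
  · rw [List.forall_mem_map, List.forall_mem_ofFn_iff, List.sum_ofFn]
    exact fun i => mul_ne_zero hB (hv i)
  · rw [List.forall_mem_map, List.forall_mem_ofFn_iff, List.sum_ofFn]
    exact fun j => mul_ne_zero hA (hv' j)

lemma listSign_map_neg {l : List K} (hl : l ≠ []) : listSign (l.map Neg.neg) = - listSign l := by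
  obtain ⟨a, ha⟩ := List.exists_mem_of_ne_nil l hl
  simp only [listSign, List.forall_mem_map, Left.neg_pos_iff, Left.neg_neg_iff]
  split_ifs with h1 h2 <;> try rfl
  exact absurd (h2 a ha) (h1 a ha).not_gt

lemma listSign_map_neg_one_pow (e : ℕ) {l : List K} (hl : l ≠ []) :
    listSign (l.map fun x => (-1) ^ e * x) = (-1) ^ e * listSign l := by
  rcases Nat.even_or_odd e with h | h
  · simp [h.neg_one_pow]
  · simp only [h.neg_one_pow, neg_one_mul]
    exact listSign_map_neg hl

variable {v v'} in
/-- Multiplicativity of the degree. -/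
lemma degree_mul_degree (hA : ∑ i, minor v i ≠ 0) (hB : ∑ j, minor v' j ≠ 0)
    (h : PartialSumsNe ((List.ofFn (minor v)).map fun x => (List.ofFn (minor v')).sum * x)
        ((List.ofFn (minor v')).map fun x => (List.ofFn (minor v)).sum * x)) :
    degree v * degree v' = ∑ γ : LatticePath n k, (-1) ^ γ.area * degree (gridVectors v v' γ) := by
  have key : ∀ γ : LatticePath n k, (-1) ^ γ.area * degree (gridVectors v v' γ) =
      (-1) ^ (n + k) * listSign
        (transport ((List.ofFn (minor v)).map fun x => (List.ofFn (minor v')).sum * x)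
        ((List.ofFn (minor v')).map fun x => (List.ofFn (minor v)).sum * x) γ.word) := by
    intro γ
    obtain ⟨h1, h2⟩ := mem_words.1 γ.word_mem
    -- The sign in the cross product cancels the sign of the minors along the path.
    have hsq : ((-1 : ℤ) ^ γ.area) * ((-1) ^ γ.area) = 1 := by rw [← mul_pow]; simp
    rw [degree_eq, commonSign_eq_listSign, ofFn_minor_gridVectors v v' γ hA hB,
      listSign_map_neg_one_pow]
    · linear_combination ((-1) ^ (n + k) * listSign
        (transport ((List.ofFn (minor v)).map fun x => (List.ofFn (minor v')).sum * x)
        ((List.ofFn (minor v')).map fun x => (List.ofFn (minor v)).sum * x) γ.word)) * hsq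
    · rw [← List.length_pos_iff, length_transport _ _ _ (by simp [h1]) (by simp [h2])]
      exact Nat.succ_pos _
  rw [Finset.sum_congr rfl fun γ _ => key γ, ← Finset.mul_sum,
    LatticePath.sum_word (fun w => listSign (transport _ _ w)),
    sum_listSign_transport (by simp) (by simp) (by rwa [List.sum_ofFn]) (by rwa [List.sum_ofFn]) h,
    degree_eq, degree_eq, commonSign_eq_listSign, commonSign_eq_listSign, pow_add]
  ring

end Minors

/-! ### Generic sections -/

section Generic

variable {K : Type u} [Field K] {ι : Type v}

/-- Polynomial functions. -/
def IsPolynomial (F : (ι → K) → K) : Prop :=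
  ∃ f : MvPolynomial ι K, ∀ x, MvPolynomial.eval x f = F x

namespace IsPolynomial

lemma coord (i : ι) : IsPolynomial fun x : ι → K => x i := ⟨MvPolynomial.X i, fun x => by simp⟩

lemma const_mul {F : (ι → K) → K} (hF : IsPolynomial F) (c : K) :
    IsPolynomial fun x => c * F x := by
  obtain ⟨f, hf⟩ := hF
  exact ⟨MvPolynomial.C c * f, fun x => by simp [hf]⟩

lemma mul {F F' : (ι → K) → K} (hF : IsPolynomial F) (hF' : IsPolynomial F') :
    IsPolynomial fun x => F x * F' x := by
  obtain ⟨f, hf⟩ := hF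
  obtain ⟨f', hf'⟩ := hF'
  exact ⟨f * f', fun x => by simp [hf, hf']⟩

lemma sub {F F' : (ι → K) → K} (hF : IsPolynomial F) (hF' : IsPolynomial F') :
    IsPolynomial fun x => F x - F' x := by
  obtain ⟨f, hf⟩ := hF
  obtain ⟨f', hf'⟩ := hF'
  exact ⟨f - f', fun x => by simp [hf, hf']⟩

lemma sum {T : Type*} (s : Finset T) {F : T → (ι → K) → K} (hF : ∀ t, IsPolynomial (F t)) :
    IsPolynomial fun x => ∑ t ∈ s, F t x := by
  choose f hf using hF
  exact ⟨∑ t ∈ s, f t, fun x => by simp [hf]⟩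

lemma det {m : ℕ} {F : (ι → K) → Matrix (Fin m) (Fin m) K}
    (hF : ∀ i j, IsPolynomial fun x => F x i j) : IsPolynomial fun x => (F x).det := by
  choose f hf using hF
  refine ⟨(Matrix.of f).det, fun x => ?_⟩
  rw [RingHom.map_det]
  congr 1
  ext i j
  exact hf i j x

end IsPolynomial

/-- Properties that hold outside of the zeros of a nonzero polynomial. -/
def IsGeneric (p : (ι → K) → Prop) : Prop :=
  ∃ f : MvPolynomial ι K, f ≠ 0 ∧ ∀ x, MvPolynomial.eval x f ≠ 0 → p x

namespace IsGeneric

lemma of_forall {p : (ι → K) → Prop} (h : ∀ x, p x) : IsGeneric p := ⟨1, one_ne_zero, fun x _ => h x⟩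

lemma and {p q : (ι → K) → Prop} (hp : IsGeneric p) (hq : IsGeneric q) :
    IsGeneric fun x => p x ∧ q x := by
  obtain ⟨f, hf, h⟩ := hp
  obtain ⟨g, hg, h'⟩ := hq
  refine ⟨f * g, mul_ne_zero hf hg, fun x hx => ?_⟩
  rw [map_mul] at hx
  exact ⟨h x (left_ne_zero_of_mul hx), h' x (right_ne_zero_of_mul hx)⟩

lemma forall_mem {T : Type*} (s : Finset T) {p : T → (ι → K) → Prop} (hp : ∀ t, IsGeneric (p t)) :
    IsGeneric fun x => ∀ t ∈ s, p t x := by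
  choose f hf h using hp
  refine ⟨∏ t ∈ s, f t, Finset.prod_ne_zero_iff.2 fun t _ => hf t, fun x hx t ht => ?_⟩
  rw [map_prod, Finset.prod_ne_zero_iff] at hx
  exact h t x (hx t ht)

lemma of_isPolynomial {F : (ι → K) → K} (hF : IsPolynomial F) (h : ∃ x, F x ≠ 0) :
    IsGeneric fun x => F x ≠ 0 := by
  obtain ⟨f, hf⟩ := hF
  obtain ⟨x, hx⟩ := h
  refine ⟨f, ?_, fun x hx => by rwa [hf] at hx⟩
  rintro rfl
  exact hx (by rw [← hf, map_zero])

lemma exists_of_infinite [Infinite K] {p : (ι → K) → Prop} (hp : IsGeneric p) : ∃ x, p x := by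
  obtain ⟨f, hf, h⟩ := hp
  by_contra! hn
  -- Over an infinite field a polynomial that vanishes at every point is zero.
  refine hf (MvPolynomial.funext fun x => ?_)
  rw [map_zero]
  by_contra hx
  exact hn x (h x hx)

end IsGeneric

end Generic

/-! ### Sections with prescribed values over one simplex -/

section Sections

variable {K : Type u} [Field K] [LinearOrder K] [IsStrictOrderedRing K] {n : ℕ}

/-- The standard basis and a vector with prescribed coordinates. -/
def simplexVectors (α : Fin (n + 1) → K) : Fin (n + 1) → Fin n → K :=
  Fin.snoc (fun i => Pi.single i 1) fun i => - α i.castSucc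

/-- By construction `α` is a linear relation between the vectors, so the minors are a multiple of
it; the last minor is that of the standard basis. Any `α` with last entry `1` is thus realized up to
sign, which provides the test points for genericity. -/
lemma minor_simplexVectors (α : Fin (n + 1) → K) (hα : α (Fin.last n) = 1) (i : Fin (n + 1)) :
    minor (simplexVectors α) i = (-1) ^ n * α i := by
  have hl : minor (simplexVectors α) (Fin.last n) = (-1) ^ n := by
    have : (Matrix.of fun r : Fin n => simplexVectors α ((Fin.last n).succAbove r)) =
        (1 : Matrix (Fin n) (Fin n) K) := by
      ext r s
      simp [simplexVectors, Matrix.one_apply, Pi.single_apply, eq_comm]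
    rw [minor, this, Matrix.det_one, mul_one, Fin.val_last]
  have h := minor_of_relation (simplexVectors α) (Fin.last n) (by rw [hl]; simp) α (by
    rw [Fin.sum_univ_castSucc]
    ext j
    simp [simplexVectors, hα, Pi.single_apply]) i
  rw [hl, hα, one_mul] at h
  rw [← h, mul_comm]

variable {V : Type v} [PartialOrder V] {X : AbstractSimplicialComplex V}

/-- The vertices of a simplex are distinct and the transition matrices invertible, so values over a
single simplex are unconstrained. Genericity may therefore be tested one simplex at a time. -/
lemma exists_sectionValues_eq (E : FlatBundle GL(n, K)⁺ X) {m : ℕ} (σ : IncreasingSimplex X m)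
    (y : Fin (m + 1) → Fin n → K) : ∃ s : V → Fin n → K, sectionValues E s σ = y := by
  refine ⟨Function.extend σ.vertex (fun i => (((E.trans (σ.vertex 0) (σ.vertex i) :
    GL (Fin n) K)⁻¹ : GL (Fin n) K) : Matrix (Fin n) (Fin n) K) *ᵥ y i) 0, ?_⟩
  funext i
  rw [sectionValues, σ.strictMono.injective.extend_apply, Matrix.mulVec_mulVec, ← Units.val_mul,
    mul_inv_cancel, Units.val_one, Matrix.one_mulVec]

lemma isPolynomial_minor {ι : Type*} (E : FlatBundle GL(n, K)⁺ X) (e : V × Fin n → ι)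
    (σ : IncreasingSimplex X n) (p : Fin (n + 1)) :
    IsPolynomial fun x : ι → K => minor (sectionValues E (fun w i => x (e (w, i))) σ) p := by
  have h : IsPolynomial fun x : ι → K => (Matrix.of fun r : Fin n =>
      sectionValues E (fun w i => x (e (w, i))) σ (p.succAbove r)).det :=
    IsPolynomial.det fun i j => IsPolynomial.sum Finset.univ fun l =>
      (IsPolynomial.coord (e (σ.vertex (p.succAbove i), l))).const_mul
        (((E.trans (σ.vertex 0) (σ.vertex (p.succAbove i)) : GL (Fin n) K) :
          Matrix (Fin n) (Fin n) K) j l)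
  exact h.const_mul _

/-- Generically, all minors of the values of a section at the vertices of a simplex, and the sum of
the minors, are nonzero. -/
lemma isGeneric_minor_ne_zero {ι : Type*} (E : FlatBundle GL(n, K)⁺ X) (e : V × Fin n → ι)
    (he : Function.Injective e) (σ : IncreasingSimplex X n) :
    IsGeneric fun x : ι → K =>
      (∀ p ∈ Finset.univ, minor (sectionValues E (fun w i => x (e (w, i))) σ) p ≠ 0) ∧
        ∑ p, minor (sectionValues E (fun w i => x (e (w, i))) σ) p ≠ 0 := by
  obtain ⟨s, hs⟩ := exists_sectionValues_eq E σ (simplexVectors fun _ => 1)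
  have hx : (fun w i => Function.extend e (fun q => s q.1 q.2) 0 (e (w, i))) = s := by
    funext w i
    rw [he.extend_apply]
  refine (IsGeneric.forall_mem _ fun p => IsGeneric.of_isPolynomial (isPolynomial_minor E e σ p)
    ⟨Function.extend e (fun q => s q.1 q.2) 0, ?_⟩).and
    (IsGeneric.of_isPolynomial (IsPolynomial.sum _ fun p => isPolynomial_minor E e σ p)
    ⟨Function.extend e (fun q => s q.1 q.2) 0, ?_⟩)
  · rw [hx, hs, minor_simplexVectors _ rfl]
    simp
  · simp only [hx, hs]
    rw [Finset.sum_congr rfl fun p _ => minor_simplexVectors (fun _ => 1) rfl p]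
    simp only [mul_one, Finset.sum_const, Finset.card_univ, Fintype.card_fin, nsmul_eq_mul]
    exact mul_ne_zero (Nat.cast_ne_zero.2 (Nat.succ_ne_zero n)) (pow_ne_zero _ (by simp))

end Sections

/-! ### Simultaneous genericity and the product section -/

section Main

variable {K : Type u} [Field K] [LinearOrder K] [IsStrictOrderedRing K] {n k : ℕ}
  {V : Type v} {V' : Type w} [LinearOrder V] [LinearOrder V'] {X : AbstractSimplicialComplex V}
  {X' : AbstractSimplicialComplex V'}

lemma sum_filter_lt (m : ℕ) (M : K) (j : ℕ) (hj : 0 < j) (hjm : j ≤ m + 1) :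
    ∑ l : Fin (m + 1) with l.val < j, (if l = 0 then M + 1 else 1) = M + j := by
  have h : ∀ l : Fin (m + 1), (if l = 0 then M + 1 else 1) = (if l = 0 then M else 0) + 1 := by
    intro l
    split_ifs <;> ring
  rw [Finset.sum_congr rfl fun l _ => h l, Finset.sum_add_distrib, Finset.sum_ite_eq', if_pos]
  · simp [Fin.card_filter_val_lt, hjm]
  · simpa using hj

/-- A test point for one condition on partial sums, found by an integer inequality with two explicit
relations. -/
lemma exists_partial_sums_ne (hk : 0 < k) (E : FlatBundle GL(n, K)⁺ X)
    (E' : FlatBundle GL(k, K)⁺ X') (σ : IncreasingSimplex X n) (σ' : IncreasingSimplex X' k)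
    (i j : ℕ) (hi : 0 < i) (hj : 0 < j) (hi' : i ≤ n + 1) (hj' : j ≤ k + 1)
    (hij : i < n + 1 ∨ j < k + 1) :
    ∃ (s : V → Fin n → K) (s' : V' → Fin k → K),
      (∑ p, minor (sectionValues E' s' σ') p) *
          (∑ p : Fin (n + 1) with p.val < i, minor (sectionValues E s σ) p) -
        (∑ p, minor (sectionValues E s σ) p) *
          (∑ p : Fin (k + 1) with p.val < j, minor (sectionValues E' s' σ') p) ≠ 0 := by
  obtain ⟨s, hs⟩ := exists_sectionValues_eq E σ (simplexVectors fun _ => 1)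
  -- The relations are `(1, …, 1)` and `(nk + 1, 1, …, 1)`. The heavy first entry puts every proper
  -- proportion `i / (n + 1)` below `(nk + 1) / (nk + k + 1)`, hence below every partial proportion
  -- of the second relation. The last entry is `1` because `k > 0`.
  obtain ⟨s', hs'⟩ := exists_sectionValues_eq E' σ' (simplexVectors
    fun l => if l = 0 then ((n * k : ℕ) : K) + 1 else 1)
  have hl : (if Fin.last k = 0 then ((n * k : ℕ) : K) + 1 else 1) = 1 := by
    rw [if_neg]
    rw [Fin.ext_iff, Fin.val_last]
    exact hk.ne'
  refine ⟨s, s', ?_⟩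
  have hfull : ∀ m : ℕ, (Finset.univ.filter fun p : Fin (m + 1) => (p : ℕ) < m + 1) =
      Finset.univ := fun m => Finset.filter_true_of_mem fun p _ => p.2
  have ha : ∀ i, 0 < i → i ≤ n + 1 →
      ∑ p : Fin (n + 1) with p.val < i, minor (sectionValues E s σ) p = (-1) ^ n * i := by
    intro i hi hi'
    rw [hs, Finset.sum_congr rfl fun p _ => minor_simplexVectors (fun _ => 1) rfl p, ← Finset.mul_sum]
    simp [Fin.card_filter_val_lt, hi']
  have hb : ∀ j, 0 < j → j ≤ k + 1 → ∑ p : Fin (k + 1) with p.val < j,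
      minor (sectionValues E' s' σ') p = (-1) ^ k * ((n * k : ℕ) + j) := by
    intro j hj hj'
    rw [hs', Finset.sum_congr rfl fun p _ => minor_simplexVectors _ hl p, ← Finset.mul_sum,
      sum_filter_lt _ _ _ hj hj']
  have hA := ha (n + 1) (by lia) le_rfl
  have hB := hb (k + 1) (by lia) le_rfl
  rw [hfull] at hA hB
  rw [ha i hi hi', hb j hj hj', hA, hB]
  -- For `i ≤ n` the extreme cases `i = n`, `j = 1` differ by exactly one. For `i = n + 1` equality
  -- would force `j = k + 1`, the excluded pair of totals.
  have hnat : (n * k + (k + 1)) * i ≠ (n + 1) * (n * k + j) := by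
    rcases Nat.lt_or_ge i (n + 1) with h | h
    · have h1 : (n * k + (k + 1)) * i ≤ (n * k + (k + 1)) * n :=
        Nat.mul_le_mul_left _ (Nat.lt_succ_iff.1 h)
      have h2 : (n + 1) * (n * k + 1) ≤ (n + 1) * (n * k + j) :=
        Nat.mul_le_mul_left _ (by lia)
      have h3 : (n * k + (k + 1)) * n + 1 = (n + 1) * (n * k + 1) := by ring
      lia
    · obtain rfl : i = n + 1 := le_antisymm hi' h
      rw [mul_comm]
      intro h
      have := Nat.eq_of_mul_eq_mul_left (Nat.succ_pos n) h
      lia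
  have hK : (((n * k + (k + 1)) * i : ℕ) : K) ≠ ((n + 1) * (n * k + j) : ℕ) :=
    Nat.cast_injective.ne hnat
  have h0 : ((-1 : K) ^ n * (-1) ^ k) ≠ 0 := mul_ne_zero (pow_ne_zero _ (by simp))
    (pow_ne_zero _ (by simp))
  have := mul_ne_zero h0 (sub_ne_zero.2 hK)
  convert this using 1
  push_cast
  ring

/-- Generic sections of two bundles. -/
lemma exists_generic_sections (hk : 0 < k) (E : FlatBundle GL(n, K)⁺ X)
    (E' : FlatBundle GL(k, K)⁺ X') (S : Finset (IncreasingSimplex X n))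
    (S' : Finset (IncreasingSimplex X' k)) :
    ∃ (s : V → Fin n → K) (s' : V' → Fin k → K),
      (∀ σ ∈ S, (∀ p, minor (sectionValues E s σ) p ≠ 0) ∧
        ∑ p, minor (sectionValues E s σ) p ≠ 0) ∧
      (∀ σ' ∈ S', (∀ p, minor (sectionValues E' s' σ') p ≠ 0) ∧
        ∑ p, minor (sectionValues E' s' σ') p ≠ 0) ∧
      ∀ σ ∈ S, ∀ σ' ∈ S', PartialSumsNe
        ((List.ofFn (minor (sectionValues E s σ))).map
          fun x => (List.ofFn (minor (sectionValues E' s' σ'))).sum * x)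
        ((List.ofFn (minor (sectionValues E' s' σ'))).map
          fun x => (List.ofFn (minor (sectionValues E s σ))).sum * x) := by
  -- The partial-sum conditions involve both sections, so the coordinates of both serve as variables
  -- of a single polynomial ring.
  let e : V × Fin n → (V × Fin n) ⊕ (V' × Fin k) := Sum.inl
  let e' : V' × Fin k → (V × Fin n) ⊕ (V' × Fin k) := Sum.inr
  have h1 : IsGeneric fun x : (V × Fin n) ⊕ (V' × Fin k) → K => ∀ σ ∈ S, _ :=
    IsGeneric.forall_mem S fun σ => isGeneric_minor_ne_zero E e Sum.inl_injective σ
  have h2 : IsGeneric fun x : (V × Fin n) ⊕ (V' × Fin k) → K => ∀ σ' ∈ S', _ :=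
    IsGeneric.forall_mem S' fun σ' => isGeneric_minor_ne_zero E' e' Sum.inr_injective σ'
  have h3 : IsGeneric fun x : (V × Fin n) ⊕ (V' × Fin k) → K => ∀ σ ∈ S, ∀ σ' ∈ S',
      ∀ i ∈ Finset.range (n + 2), ∀ j ∈ Finset.range (k + 2), 0 < i → 0 < j →
        i ≤ n + 1 → j ≤ k + 1 → (i < n + 1 ∨ j < k + 1) →
      (∑ p, minor (sectionValues E' (fun w l => x (e' (w, l))) σ') p) *
          (∑ p : Fin (n + 1) with p.val < i,
            minor (sectionValues E (fun w l => x (e (w, l))) σ) p) -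
        (∑ p, minor (sectionValues E (fun w l => x (e (w, l))) σ) p) *
          (∑ p : Fin (k + 1) with p.val < j,
            minor (sectionValues E' (fun w l => x (e' (w, l))) σ') p) ≠ 0 := by
    refine IsGeneric.forall_mem _ fun σ => IsGeneric.forall_mem _ fun σ' =>
      IsGeneric.forall_mem _ fun i => IsGeneric.forall_mem _ fun j => ?_
    by_cases h : 0 < i ∧ 0 < j ∧ (i < n + 1 ∨ j < k + 1) ∧ i ≤ n + 1 ∧ j ≤ k + 1
    · obtain ⟨hi, hj, hij, hi', hj'⟩ := h
      obtain ⟨s, s', hs⟩ := exists_partial_sums_ne hk E E' σ σ' i j hi hj hi' hj' hij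
      obtain ⟨f, hf, hx⟩ := IsGeneric.of_isPolynomial
        (((IsPolynomial.sum _ fun p => isPolynomial_minor E' e' σ' p).mul
          (IsPolynomial.sum (Finset.univ.filter fun p : Fin (n + 1) => (p : ℕ) < i)
            fun p => isPolynomial_minor E e σ p)).sub
        ((IsPolynomial.sum _ fun p => isPolynomial_minor E e σ p).mul
          (IsPolynomial.sum (Finset.univ.filter fun p : Fin (k + 1) => (p : ℕ) < j)
            fun p => isPolynomial_minor E' e' σ' p)))
        ⟨Sum.elim (fun q => s q.1 q.2) fun q => s' q.1 q.2, hs⟩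
      exact ⟨f, hf, fun x h _ _ _ _ _ => hx x h⟩
    · exact IsGeneric.of_forall fun x hi hj hi' hj' hij => absurd ⟨hi, hj, hij, hi', hj'⟩ h
  obtain ⟨x, hx1, hx2, hx3⟩ := (h1.and (h2.and h3)).exists_of_infinite
  refine ⟨fun w i => x (e (w, i)), fun w i => x (e' (w, i)),
    fun σ hσ => ⟨fun p => (hx1 σ hσ).1 p (Finset.mem_univ p), (hx1 σ hσ).2⟩,
    fun σ hσ => ⟨fun p => (hx2 σ hσ).1 p (Finset.mem_univ p), (hx2 σ hσ).2⟩, ?_⟩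
  intro σ hσ σ' hσ' i j hi hj hi' hj' hij
  simp only [List.length_map, List.length_ofFn] at hi' hj' hij
  have := hx3 σ hσ σ' hσ' i (Finset.mem_range.2 (by lia)) j (Finset.mem_range.2 (by lia)) hi hj
    hi' hj' hij
  rw [← List.map_take, ← List.map_take, sum_map_mul, sum_map_mul, List.sum_take_ofFn,
    List.sum_take_ofFn, List.sum_ofFn, List.sum_ofFn]
  exact sub_ne_zero.1 this

lemma blockMatrix_mulVec_append (A : Matrix (Fin n) (Fin n) K) (B : Matrix (Fin k) (Fin k) K)
    (x : Fin n → K) (y : Fin k → K) :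
    blockMatrix n k (A, B) *ᵥ Fin.append x y = Fin.append (A *ᵥ x) (B *ᵥ y) := by
  ext i
  refine Fin.addCases (fun i => ?_) (fun i => ?_) i <;>
    simp [blockMatrix, Matrix.mulVec, dotProduct, Fin.sum_univ_add]

/-- Every path starts at `(0, 0)`, so its simplex has the pair of first vertices as reference point
and the trivializations of the factors are the ones used in the product. -/
lemma sectionValues_prod (E : FlatBundle GL(n, K)⁺ X) (E' : FlatBundle GL(k, K)⁺ X')
    (s : V → Fin n → K) (s' : V' → Fin k → K) (σ : IncreasingSimplex X n)
    (σ' : IncreasingSimplex X' k) (γ : LatticePath n k) :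
    sectionValues ((E.prod E').map (blockHom n k)) (fun q => Fin.append (s q.1) (s' q.2))
      (γ.simplex σ σ') = gridVectors (sectionValues E s σ) (sectionValues E' s' σ') γ := by
  funext p
  have h0 : (γ.simplex σ σ').vertex 0 = (σ.vertex 0, σ'.vertex 0) := by
    change (σ.vertex (γ.point 0).1, σ'.vertex (γ.point 0).2) = _
    rw [γ.start]
  rw [sectionValues, h0]
  exact blockMatrix_mulVec_append _ _ _ _

lemma exists_of_mem_support_cross (z : (orderedDelta X).Chain n) (z' : (orderedDelta X').Chain k)
    {τ : IncreasingSimplex (stdProduct X X') (n + k)} (hτ : τ ∈ (cross z z').support) :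
    ∃ σ ∈ z.support, ∃ σ' ∈ z'.support, ∃ γ : LatticePath n k, τ = γ.simplex σ σ' := by
  classical
  obtain ⟨σ, hσ, h⟩ := Finset.mem_biUnion.1 (Finsupp.support_sum hτ)
  obtain ⟨σ', hσ', h⟩ := Finset.mem_biUnion.1 (Finsupp.support_sum h)
  obtain ⟨γ, -, h⟩ := Finset.mem_biUnion.1 (Finsupp.support_finsetSum h)
  exact ⟨σ, hσ, σ', hσ', γ, Finset.mem_singleton.1 (Finsupp.support_single_subset h)⟩

lemma sum_cross (z : (orderedDelta X).Chain n) (z' : (orderedDelta X').Chain k)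
    (f : IncreasingSimplex (stdProduct X X') (n + k) → ℤ) :
    (cross z z').sum (fun τ r => r * f τ) = ∑ σ ∈ z.support, ∑ σ' ∈ z'.support,
      z σ * z' σ' * ∑ γ : LatticePath n k, (-1) ^ γ.area * f (γ.simplex σ σ') := by
  obtain ⟨L, hL⟩ : ∃ L : (orderedDelta (stdProduct X X')).Chain (n + k) →ₗ[ℤ] ℤ,
      ∀ c, L c = c.sum fun τ r => r * f τ := ⟨Finsupp.linearCombination ℤ f, fun _ => rfl⟩
  rw [← hL]
  simp only [cross, Finsupp.sum, map_sum, Finset.mul_sum]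
  refine Finset.sum_congr rfl fun σ _ => ?_
  refine Finset.sum_congr rfl fun σ' _ => ?_
  refine Finset.sum_congr rfl fun γ _ => ?_
  rw [hL, ← mul_assoc]
  exact Finsupp.sum_single_index (zero_mul _)

end Main

end TautEuler

theorem theorem11p1 {K : Type*} [Field K] [LinearOrder K] [IsStrictOrderedRing K]
    {n k : ℕ} (hn : 0 < n) (hk : 0 < k)
    {V V' : Type*} [LinearOrder V] [LinearOrder V']
    (X : AbstractSimplicialComplex V) (X' : AbstractSimplicialComplex V')
    (E : TautEuler.FlatBundle GL(n, K)⁺ X) (E' : TautEuler.FlatBundle GL(k, K)⁺ X')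
    (z : (TautEuler.orderedDelta X).cycles n) (z' : (TautEuler.orderedDelta X').cycles k) :
    ∃ h : TautEuler.cross z.1 z'.1 ∈
        (TautEuler.orderedDelta (TautEuler.stdProduct X X')).cycles (n + k),
      (TautEuler.orderedDelta X).pairing ℤ (TautEuler.eu0 hn E) z *
          (TautEuler.orderedDelta X').pairing ℤ (TautEuler.eu0 hk E') z' =
        (TautEuler.orderedDelta (TautEuler.stdProduct X X')).pairing ℤ
          (TautEuler.eu0 (Nat.add_pos_left hn k) ((E.prod E').map (TautEuler.blockHom n k)))
          ⟨TautEuler.cross z.1 z'.1, h⟩ := by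
  open TautEuler in
  obtain ⟨s, s', h1, h2, h3⟩ := exists_generic_sections hk E E' z.1.support z'.1.support
  refine ⟨cross_mem_cycles hn hk z z', ?_⟩
  -- All three pairings become sums of degrees, for `s`, `s'` and the section `(s, s')` of the
  -- product.
  rw [pairing_eu0 hn E z s fun σ hσ => (h1 σ hσ).1,
    pairing_eu0 hk E' z' s' fun σ' hσ' => (h2 σ' hσ').1,
    pairing_eu0 (Nat.add_pos_left hn k) _ _ (fun q => Fin.append (s q.1) (s' q.2)) fun τ hτ => ?_]
  · refine Eq.trans ?_ (sum_cross z.1 z'.1 _).symm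
    rw [Finsupp.sum, Finsupp.sum, Finset.sum_mul_sum]
    refine Finset.sum_congr rfl fun σ hσ => ?_
    refine Finset.sum_congr rfl fun σ' hσ' => ?_
    have e := (Finset.sum_congr rfl fun γ _ => congrArg (fun y => (-1) ^ γ.area * degree y)
      (sectionValues_prod E E' s s' σ σ' γ)).trans
      (degree_mul_degree (h1 σ hσ).2 (h2 σ' hσ').2 (h3 σ hσ σ' hσ')).symm
    exact (mul_mul_mul_comm _ _ _ _).trans (congrArg (z.1 σ * z'.1 σ' * ·) e.symm)
  -- What remains is that the product section is generic over the cross product, whose simplices all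
  -- come from lattice paths over pairs in the two supports.
  · obtain ⟨σ, hσ, σ', hσ', γ, rfl⟩ := exists_of_mem_support_cross z.1 z'.1 hτ
    intro p h
    exact minor_gridVectors_ne_zero γ (h1 σ hσ).2 (h2 σ' hσ').2 (h1 σ hσ).1 (h2 σ' hσ').1
      (h3 σ hσ σ' hσ') p ((congrArg (fun y => minor y p)
        (sectionValues_prod E E' s s' σ σ' γ)).symm.trans h)
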